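/- Let $G$ be a connected Lie group acting smoothly, freely and properly on the left on a smooth manifold $M$, by maps $\psi_g$, with Lie algebra $\mathfrak g$. Let $\tau:TM\to M$, let $G$ act on $TM$ by $T\psi_g$, and let $\pi:TM\to TM/G$ be the projection; a function on an open set of $TM/G$ is smooth if its pullback by $\pi$ is smooth. Let $L:TM\to\mathbb R$ be smooth, $G$-invariant and regular (its fibre Hessian is everywhere non-singular), let $l:TM/G\to\mathbb R$ be the reduced Lagrangian, $L=l\circ\pi$, and let $\Gamma$ be the Euler--Lagrange field of $L$, i.e. the second-order vector field $\Gamma=u^\alpha\,\partial/\partial x^\alpha+\Gamma^\alpha\,\partial/\partial u^\alpha$ on $TM$ with $\Gamma(\partial L/\partial u^\alpha)-\partial L/\partial x^\alpha=0$ in natural coordinates. Then $\Gamma$ is $G$-invariant, and there is a unique smooth vector field $\check\Gamma$ on $TM/G$ with $T\pi\circ\Gamma=\check\Gamma\circ\pi$. Moreover, let $\omega$ be a principal connection on $M\to M/G$, let $U\subset M/G$ be an open coordinate neighbourhood, with coordinates $(x^i)$, over which $M$ is identified equivariantly with $U\times G$ ($G$ acting by left translation on the second factor), and let $(E_a)$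 be a basis of $\mathfrak g$, with $[E_a,E_b]=C^c_{ab}E_c$. Let $X_i$ be the horizontal lift of $\partial/\partial x^i$, and let $\hat E_a$ be the vertical vector field whose value at $(x,g)$ is that of the fundamental vector field of $\mathrm{Ad}_gE_a$. Then over $U$ the fields $X_i,\hat E_a$ form a frame, with quasi-velocities $(v^i,w^a)$ (so $u=v^iX_i+w^a\hat E_a$ for $u\in TM$), and one has $$[X_i,X_j]=K^a_{ij}\hat E_a,\qquad [X_i,\hat E_a]=\Upsilon^b_{ia}\hat E_b,\qquad [\hat E_a,\hat E_b]=C^c_{ab}\hat E_c ,$$ where the functions $K^a_{ij}$ (the components of the curvature) and $\Upsilon^b_{ia}$ are defined by the first two relations. With $Z^{\mathrm C}$ and $Z^{\mathrm V}$ denoting the complete and vertical lifts to $TM$ of a vector field $Z$ on $M$, these lifts of the frame fields form a frame on $TM$ over $U$ and $$\Gamma=v^iX_i^{\mathrm C}+w^a\hat E_a^{\mathrm C}+\Gamma^iX_i^{\mathrm V}+\Gamma^a\hat E_a^{\mathrm V}$$ with $G$-invariant functions $\Gamma^i,\Gamma^a$. The functions $(x^i,v^i,w^a)$ are invariant and induce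 coordinates (a diffeomorphism onto the product of the range of $(x^i)$ with the spaces of all $v$ and all $w$) on the part of $TM/G$ over $U$. In these coordinates $$\check\Gamma=v^i\frac{\partial}{\partial x^i}+\Gamma^i\frac{\partial}{\partial v^i}+\Gamma^a\frac{\partial}{\partial w^a},$$ and $\check\Gamma$ satisfies the Lagrange--Poincaré equations $$\check\Gamma\Big(\frac{\partial l}{\partial v^i}\Big)-\frac{\partial l}{\partial x^i}=-\big(K^a_{ik}v^k+\Upsilon^a_{ib}w^b\big)\frac{\partial l}{\partial w^a},\qquad \check\Gamma\Big(\frac{\partial l}{\partial w^a}\Big)=\big(\Upsilon^b_{ia}v^i-C^b_{ac}w^c\big)\frac{\partial l}{\partial w^b}.$$ Hence, along every integral curve of $\check\Gamma$, the same equations hold with $\check\Gamma$ on the left-hand sides replaced by $\frac{d}{dt}$. -/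

import Mathlib

open Set Filter Topology
open scoped Manifold ContDiff

noncomputable section

namespace LagPoin

/-! ### Linear algebra: components with respect to a basis -/

section LinearAlgebra

variable {J : Type*} {V : Type*} [AddCommGroup V] [Module ℝ V]

/-- The finite family `b` is a basis of the vector space `V`. -/
def IsBasisFamily (b : J → V) : Prop :=
  LinearIndependent ℝ b ∧ ⊤ ≤ Submodule.span ℝ (range b)

open Classical in
/-- The components of `v` with respect to the basis `b` (and `0` if `b` is not a basis). -/
def components (b : J → V) (v : V) : J → ℝ :=
  if h : IsBasisFamily b then (Module.Basis.mk h.1 h.2).repr v else 0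

end LinearAlgebra

/-! ### Calculus on the tangent bundle -/

section Tangent

variable {E : Type*} [NormedAddCommGroup E] [NormedSpace ℝ E]
  {M : Type*} [TopologicalSpace M] [ChartedSpace E M] [IsManifold 𝓘(ℝ, E) ∞ M]

/-- The vertical lift of a vector field `Z` on `M`: its value at `u ∈ T_m M` is the velocity at
`u` of the curve `t ↦ u + t Z(m)` in the fibre `T_m M`. -/
def verticalLift (Z : ∀ m : M, TangentSpace 𝓘(ℝ, E) m) (u : TangentBundle 𝓘(ℝ, E) M) :
    TangentSpace 𝓘(ℝ, E).tangent u :=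
  mfderiv 𝓘(ℝ, E) 𝓘(ℝ, E).tangent
    (fun q : E => (⟨u.1, q⟩ : TangentBundle 𝓘(ℝ, E) M)) u.2 (Z u.1)

/-- The representative of a vector field `Z` on `M` in the preferred chart at `m`:
`Z = Z^α(x) ∂/∂x^α`, as a map `x ↦ (Z^α(x))` on the model space. -/
def localRep (Z : ∀ m : M, TangentSpace 𝓘(ℝ, E) m) (m : M) (x : E) : E :=
  mfderiv 𝓘(ℝ, E) 𝓘(ℝ, E) (extChartAt 𝓘(ℝ, E) m) ((extChartAt 𝓘(ℝ, E) m).symm x)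
    (Z ((extChartAt 𝓘(ℝ, E) m).symm x))

/-- The complete lift `Z^α ∂/∂x^α + u^α (∂Z^β/∂x^α) ∂/∂u^β` of a vector field `Z` on `M`. The
value at `u` is written in the natural coordinates `(x, u)` of the tangent bundle induced by the
preferred chart at the base point of `u`. -/
def completeLift (Z : ∀ m : M, TangentSpace 𝓘(ℝ, E) m) (u : TangentBundle 𝓘(ℝ, E) M) :
    TangentSpace 𝓘(ℝ, E).tangent u :=
  let φ := extChartAt 𝓘(ℝ, E).tangent u
  let z : E × E := φ u
  let W : E × E := (localRep Z u.1 z.1, fderiv ℝ (localRep Z u.1) z.1 z.2)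
  mfderiv 𝓘(ℝ, E × E) 𝓘(ℝ, E).tangent φ.symm z W

/-- The derivative `W(F)` at `u` of a function `F` on the tangent bundle along `W ∈ T_u(TM)`. -/
def dirDeriv (F : TangentBundle 𝓘(ℝ, E) M → ℝ) (u : TangentBundle 𝓘(ℝ, E) M)
    (W : TangentSpace 𝓘(ℝ, E).tangent u) : ℝ :=
  mfderiv 𝓘(ℝ, E).tangent 𝓘(ℝ, ℝ) F u W

/-- The fibre Hessian of `L` at `u ∈ T_m M`, a bilinear form on `T_m M`. -/
def fibreHessian (L : TangentBundle 𝓘(ℝ, E) M → ℝ) (u : TangentBundle 𝓘(ℝ, E) M) (v w : E) : ℝ :=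
  fderiv ℝ (fun p : E =>
    fderiv ℝ (fun q : E => L (⟨u.1, q⟩ : TangentBundle 𝓘(ℝ, E) M)) p w) u.2 v

/-- A Lagrangian is regular if its fibre Hessian is everywhere non-singular. -/
def IsRegular (L : TangentBundle 𝓘(ℝ, E) M → ℝ) : Prop :=
  ∀ (u : TangentBundle 𝓘(ℝ, E) M) (v : E), (∀ w : E, fibreHessian L u v w = 0) → v = 0

/-- `Γ` is a smooth vector field on the tangent bundle. -/
def IsSmoothField (Γ : ∀ u : TangentBundle 𝓘(ℝ, E) M, TangentSpace 𝓘(ℝ, E).tangent u) : Prop :=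
  ContMDiff 𝓘(ℝ, E).tangent 𝓘(ℝ, E).tangent.tangent ∞
    (fun u => (⟨u, Γ u⟩ : TangentBundle 𝓘(ℝ, E).tangent (TangentBundle 𝓘(ℝ, E) M)))

/-- `Γ` is the Euler-Lagrange field of `L`: in the natural coordinates `(x, u)` of the tangent
bundle induced by any chart of the atlas, `Γ = u^α ∂/∂x^α + Γ^α ∂/∂u^α` (second-order field) and
`Γ(∂L/∂u^α) - ∂L/∂x^α = 0`. The partial derivatives `∂/∂x^α` and `∂/∂u^α` are taken along `(e, 0)`
and `(0, e)`, for all `e` in the model space. -/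
def IsEulerLagrangeField (L : TangentBundle 𝓘(ℝ, E) M → ℝ)
    (Γ : ∀ u : TangentBundle 𝓘(ℝ, E) M, TangentSpace 𝓘(ℝ, E).tangent u) : Prop :=
  IsSmoothField Γ ∧
  ∀ (m₀ : M) (u : TangentBundle 𝓘(ℝ, E) M), u.1 ∈ (chartAt E m₀).source →
    let φ := extChartAt 𝓘(ℝ, E).tangent (⟨m₀, 0⟩ : TangentBundle 𝓘(ℝ, E) M)
    let Lφ : E × E → ℝ := fun z => L (φ.symm z)
    let z : E × E := φ u
    let Y : E × E := mfderiv 𝓘(ℝ, E).tangent 𝓘(ℝ, E × E) φ u (Γ u)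
    Y.1 = z.2 ∧
      ∀ e : E, fderiv ℝ (fun z' : E × E => fderiv ℝ Lφ z' (0, e)) z Y - fderiv ℝ Lφ z (e, 0) = 0

end Tangent

/-! ### The action and the quotient of the tangent bundle -/

section Quotient

variable {E : Type*} [NormedAddCommGroup E] [NormedSpace ℝ E]
  {M : Type*} [TopologicalSpace M] [ChartedSpace E M] [IsManifold 𝓘(ℝ, E) ∞ M]
  {G : Type*} [Group G] [MulAction G M]

/-- The induced action of `g : G` on the tangent bundle, the tangent map of `m ↦ g • m`. -/
def tangentAct (g : G) : TangentBundle 𝓘(ℝ, E) M → TangentBundle 𝓘(ℝ, E) M :=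
  tangentMap 𝓘(ℝ, E) 𝓘(ℝ, E) (fun m : M => g • m)

variable (E M G) in
/-- The orbit space `TM/G` of the induced action, with the quotient topology. -/
abbrev RedTangent : Type _ :=
  Quot (fun u u' : TangentBundle 𝓘(ℝ, E) M => ∃ g : G, tangentAct g u = u')

variable (G) in
/-- The projection `TM → TM/G`. -/
def proj (u : TangentBundle 𝓘(ℝ, E) M) : RedTangent E M G := Quot.mk _ u

/-- The reduced Lagrangian: the function `l` on `TM/G` with `L = l ∘ proj`. -/
def reducedLagrangian (L : TangentBundle 𝓘(ℝ, E) M → ℝ)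
    (hL : ∀ (g : G) (u : TangentBundle 𝓘(ℝ, E) M), L (tangentAct g u) = L u) :
    RedTangent E M G → ℝ :=
  Quot.lift L (by rintro u _ ⟨g, rfl⟩; exact (hL g u).symm)

/-- The smooth structure of `TM/G` as a quotient manifold, given by its sheaf of smooth functions:
a function on an open set of `TM/G` is smooth if its pullback to the tangent bundle is. -/
def SmoothOnRed (f : RedTangent E M G → ℝ) (W : Set (RedTangent E M G)) : Prop :=
  ContMDiffOn 𝓘(ℝ, E).tangent 𝓘(ℝ, ℝ) ∞ (fun u => f (proj G u)) (proj G ⁻¹' W)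

/-- `f` is smooth on a neighbourhood of `q` in `TM/G`. -/
def SmoothNearRed (f : RedTangent E M G → ℝ) (q : RedTangent E M G) : Prop :=
  ∃ W : Set (RedTangent E M G), IsOpen W ∧ q ∈ W ∧ SmoothOnRed f W

variable (E M G) in
/-- A (smooth) vector field on `TM/G`: a tangent vector at each point `q`, that is, a derivation
`f ↦ Y f q` of the algebra of germs at `q` of smooth functions, such that `Y f` is smooth wherever
`f` is. The last field is a convention for functions that are not smooth near `q`. -/
structure RedVectorField where
  /-- `toFun f q` is the derivative of `f` at `q` along the vector field. -/
  toFun : (RedTangent E M G → ℝ) → RedTangent E M G → ℝ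
  congr_germ : ∀ f f' q, f =ᶠ[𝓝 q] f' → toFun f q = toFun f' q
  map_add : ∀ f f' q, SmoothNearRed f q → SmoothNearRed f' q →
    toFun (fun p => f p + f' p) q = toFun f q + toFun f' q
  map_smul : ∀ (r : ℝ) f q, SmoothNearRed f q → toFun (fun p => r * f p) q = r * toFun f q
  leibniz : ∀ f f' q, SmoothNearRed f q → SmoothNearRed f' q →
    toFun (fun p => f p * f' p) q = f q * toFun f' q + f' q * toFun f q
  smooth : ∀ f W, IsOpen W → SmoothOnRed f W → SmoothOnRed (toFun f) W
  eq_zero : ∀ f q, ¬ SmoothNearRed f q → toFun f q = 0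

/-- `Y` is the projection of the vector field `Γ`: `T proj (Γ(u)) = Y(proj u)` for all `u`, as
derivations of smooth functions on `TM/G`. -/
def IsProjection (Γ : ∀ u : TangentBundle 𝓘(ℝ, E) M, TangentSpace 𝓘(ℝ, E).tangent u)
    (Y : RedVectorField E M G) : Prop :=
  ∀ (u : TangentBundle 𝓘(ℝ, E) M) (f : RedTangent E M G → ℝ), SmoothNearRed f (proj G u) →
    Y.toFun f (proj G u) = dirDeriv (fun u' => f (proj G u')) u (Γ u)

/-- `γ` is an integral curve of `Y` on the set `S` of times. -/
def IsIntegralCurve (Y : RedVectorField E M G) (γ : ℝ → RedTangent E M G) (S : Set ℝ) : Prop :=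
  ∀ t ∈ S, ∀ f : RedTangent E M G → ℝ, SmoothNearRed f (γ t) →
    HasDerivAt (fun s => f (γ s)) (Y.toFun f (γ t)) t

end Quotient

/-! ### Fundamental fields, principal connections, local trivializations, invariant frames -/

section Bundle

variable {E : Type*} [NormedAddCommGroup E] [NormedSpace ℝ E]
  {M : Type*} [TopologicalSpace M] [ChartedSpace E M] [IsManifold 𝓘(ℝ, E) ∞ M]
  {F : Type*} [NormedAddCommGroup F] [NormedSpace ℝ F]
  {G : Type*} [TopologicalSpace G] [ChartedSpace F G] [Group G] [MulAction G M]

/-- The adjoint representation: the derivative at the identity of `h ↦ g h g⁻¹`. -/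
def Ad (g : G) (ξ : GroupLieAlgebra 𝓘(ℝ, F) G) : GroupLieAlgebra 𝓘(ℝ, F) G :=
  mfderiv 𝓘(ℝ, F) 𝓘(ℝ, F) (fun h : G => g * h * g⁻¹) 1 ξ

/-- The fundamental vector field of `ξ`: the derivative of `g ↦ g • m` at the identity along
`ξ`. -/
def fundamentalField (ξ : GroupLieAlgebra 𝓘(ℝ, F) G) (m : M) : TangentSpace 𝓘(ℝ, E) m :=
  mfderiv 𝓘(ℝ, F) 𝓘(ℝ, E) (fun g : G => g • m) 1 ξ

variable (E M F G) in
/-- A principal connection, as a smooth Lie-algebra-valued one-form on `M`; smoothness is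
smoothness as a (fibrewise linear) function on the tangent bundle. -/
structure PrincipalConnection where
  /-- The connection form. -/
  form : ∀ m : M, TangentSpace 𝓘(ℝ, E) m →ₗ[ℝ] GroupLieAlgebra 𝓘(ℝ, F) G
  smooth : ContMDiff (M' := F) 𝓘(ℝ, E).tangent 𝓘(ℝ, F) ∞
    (fun u : TangentBundle 𝓘(ℝ, E) M => form u.1 u.2)
  form_fundamental : ∀ (ξ : GroupLieAlgebra 𝓘(ℝ, F) G) (m : M),
    form m (fundamentalField ξ m) = ξ
  form_equivariant : ∀ (g : G) (m : M) (v : TangentSpace 𝓘(ℝ, E) m),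
    form (g • m) (mfderiv 𝓘(ℝ, E) 𝓘(ℝ, E) (fun m' : M => g • m') m v) = Ad g (form m v)

variable (E M F G) in
/-- A local trivialization of `M → M/G` over a coordinate neighbourhood `U` of `M/G`: an
equivariant diffeomorphism `m ↦ (x(m), g(m))` from the preimage of `U` onto `base × G`, where
`base ⊆ ℝ^ι` is the image of `U` under the coordinates `(x^i)` and `G` acts on `base × G` by
`h • (x, g) = (x, h g)`. -/
structure CoordTrivialization (ι : Type*) [Fintype ι] where
  /-- The diffeomorphism; its source is the preimage of `U`. -/
  toHomeo : OpenPartialHomeomorph M ((ι → ℝ) × G)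
  /-- The range of the coordinates on `U`. -/
  base : Set (ι → ℝ)
  target_eq : toHomeo.target = base ×ˢ univ
  contMDiffOn_toHomeo : ContMDiffOn 𝓘(ℝ, E) (𝓘(ℝ, ι → ℝ).prod 𝓘(ℝ, F)) ∞ toHomeo toHomeo.source
  contMDiffOn_symm :
    ContMDiffOn (𝓘(ℝ, ι → ℝ).prod 𝓘(ℝ, F)) 𝓘(ℝ, E) ∞ toHomeo.symm toHomeo.target
  smul_mem : ∀ (h : G), ∀ m ∈ toHomeo.source, h • m ∈ toHomeo.source
  equivariant : ∀ (h : G), ∀ m ∈ toHomeo.source,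
    toHomeo (h • m) = ((toHomeo m).1, h * (toHomeo m).2)

variable {ι κ : Type*} [Fintype ι] [DecidableEq ι] [Fintype κ] [DecidableEq κ]

/-- The vector field `∂/∂x^i` on the domain of the trivialization `M ≅ U × G`. -/
def coordField (T : CoordTrivialization E M F G ι) (i : ι) (m : M) : TangentSpace 𝓘(ℝ, E) m :=
  let e : (ι → ℝ) × F := (Pi.single i 1, 0)
  mfderiv (𝓘(ℝ, ι → ℝ).prod 𝓘(ℝ, F)) 𝓘(ℝ, E) T.toHomeo.symm (T.toHomeo m) e

/-- The frame field `X_i`: the horizontal lift, with respect to the connection `θ`, of the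
coordinate field `∂/∂x^i` on `U ⊆ M/G`. It is the horizontal part of a vector field that projects
onto `∂/∂x^i`. -/
def horizontalField (T : CoordTrivialization E M F G ι) (θ : PrincipalConnection E M F G)
    (i : ι) (m : M) : TangentSpace 𝓘(ℝ, E) m :=
  coordField T i m - fundamentalField (θ.form m (coordField T i m)) m

/-- The invariant vertical frame field `Ê_a`, whose value at `m = (x, g)` is that of the
fundamental field of `Ad_g E_a`. -/
def invariantField (T : CoordTrivialization E M F G ι)
    (b : Module.Basis κ ℝ (GroupLieAlgebra 𝓘(ℝ, F) G)) (a : κ) (m : M) :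
    TangentSpace 𝓘(ℝ, E) m :=
  fundamentalField (Ad (T.toHomeo m).2 (b a)) m

/-- The invariant frame `{X_i, Ê_a}`. -/
def frame (T : CoordTrivialization E M F G ι) (θ : PrincipalConnection E M F G)
    (b : Module.Basis κ ℝ (GroupLieAlgebra 𝓘(ℝ, F) G)) :
    ι ⊕ κ → ∀ m : M, TangentSpace 𝓘(ℝ, E) m :=
  Sum.elim (fun i => horizontalField T θ i) (fun a => invariantField T b a)

/-- The quasi-velocities `v^i` (index `Sum.inl i`) and `w^a` (index `Sum.inr a`) of the frame. -/
def quasiVel (T : CoordTrivialization E M F G ι) (θ : PrincipalConnection E M F G)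
    (b : Module.Basis κ ℝ (GroupLieAlgebra 𝓘(ℝ, F) G)) (u : TangentBundle 𝓘(ℝ, E) M) :
    ι ⊕ κ → ℝ :=
  components (fun α => frame T θ b α u.1) u.2

/-- The invariant functions `(x^i, v^i, w^a)` on the part of `TM` over the domain of the
trivialization. -/
def invCoords (T : CoordTrivialization E M F G ι) (θ : PrincipalConnection E M F G)
    (b : Module.Basis κ ℝ (GroupLieAlgebra 𝓘(ℝ, F) G)) (u : TangentBundle 𝓘(ℝ, E) M) :
    (ι → ℝ) × (ι → ℝ) × (κ → ℝ) :=
  ((T.toHomeo u.1).1, fun i => quasiVel T θ b u (Sum.inl i), fun a => quasiVel T θ b u (Sum.inr a))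

/-- The family consisting of the complete lifts (`Sum.inl`) and the vertical lifts (`Sum.inr`) of
the frame fields, at `u`. -/
def liftedFrame (T : CoordTrivialization E M F G ι) (θ : PrincipalConnection E M F G)
    (b : Module.Basis κ ℝ (GroupLieAlgebra 𝓘(ℝ, F) G)) (u : TangentBundle 𝓘(ℝ, E) M) :
    (ι ⊕ κ) ⊕ (ι ⊕ κ) → TangentSpace 𝓘(ℝ, E).tangent u :=
  Sum.elim (fun α => completeLift (frame T θ b α) u) (fun α => verticalLift (frame T θ b α) u)

/-- The coefficients `Γ^i` (index `Sum.inl i`) and `Γ^a` (index `Sum.inr a`) of the vertical lifts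
of the frame fields in the vector field `Γ`. -/
def vertCoeff (T : CoordTrivialization E M F G ι) (θ : PrincipalConnection E M F G)
    (b : Module.Basis κ ℝ (GroupLieAlgebra 𝓘(ℝ, F) G))
    (Γ : ∀ u : TangentBundle 𝓘(ℝ, E) M, TangentSpace 𝓘(ℝ, E).tangent u) (α : ι ⊕ κ)
    (u : TangentBundle 𝓘(ℝ, E) M) : ℝ :=
  components (liftedFrame T θ b u) (Γ u) (Sum.inr α)

/-- The structure constants `C_{ab}^c`: `[E_a, E_b] = C_{ab}^c E_c`. -/
def structConst (b : Module.Basis κ ℝ (GroupLieAlgebra 𝓘(ℝ, F) G)) (a a' c : κ) : ℝ :=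
  b.repr ⁅b a, b a'⁆ c

/-- The curvature components `K^a_{ij}`: `[X_i, X_j] = K^a_{ij} Ê_a`. -/
def curv (T : CoordTrivialization E M F G ι) (θ : PrincipalConnection E M F G)
    (b : Module.Basis κ ℝ (GroupLieAlgebra 𝓘(ℝ, F) G)) (a : κ) (i j : ι) (m : M) : ℝ :=
  components (fun α => frame T θ b α m)
    (VectorField.mlieBracket 𝓘(ℝ, E) (horizontalField T θ i) (horizontalField T θ j) m)
    (Sum.inr a)

/-- The coefficients `Υ_{ia}^c`: `[X_i, Ê_a] = Υ_{ia}^c Ê_c`. -/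
def upsilon (T : CoordTrivialization E M F G ι) (θ : PrincipalConnection E M F G)
    (b : Module.Basis κ ℝ (GroupLieAlgebra 𝓘(ℝ, F) G)) (c : κ) (i : ι) (a : κ) (m : M) : ℝ :=
  components (fun α => frame T θ b α m)
    (VectorField.mlieBracket 𝓘(ℝ, E) (horizontalField T θ i) (invariantField T b a) m)
    (Sum.inr c)

/-! ### Coordinates on `TM/G` -/

/-- `c` is the chart `(x^i, v^i, w^a)` of `TM/G`: a diffeomorphism from the part of `TM/G` over
the domain of the trivialization onto `base × ℝ^ι × ℝ^κ`, induced by the invariant functions. -/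
structure IsInvariantChart (T : CoordTrivialization E M F G ι) (θ : PrincipalConnection E M F G)
    (b : Module.Basis κ ℝ (GroupLieAlgebra 𝓘(ℝ, F) G))
    (c : OpenPartialHomeomorph (RedTangent E M G) ((ι → ℝ) × (ι → ℝ) × (κ → ℝ))) : Prop where
  source_eq : c.source = proj G '' {u | u.1 ∈ T.toHomeo.source}
  target_eq : c.target = T.base ×ˢ univ
  apply_proj : ∀ u : TangentBundle 𝓘(ℝ, E) M, u.1 ∈ T.toHomeo.source →
    c (proj G u) = invCoords T θ b u
  smooth_iff : ∀ (f : RedTangent E M G → ℝ) (W : Set (RedTangent E M G)), IsOpen W →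
    W ⊆ c.source → (SmoothOnRed f W ↔ ContDiffOn ℝ ∞ (fun z => f (c.symm z)) (c '' W))

variable (c : OpenPartialHomeomorph (RedTangent E M G) ((ι → ℝ) × (ι → ℝ) × (κ → ℝ)))

/-- The partial derivative `∂f/∂x^i` of a function on `TM/G` in the chart `c`. -/
def partialX (f : RedTangent E M G → ℝ) (i : ι) (q : RedTangent E M G) : ℝ :=
  fderiv ℝ (fun z => f (c.symm z)) (c q) (Pi.single i 1, 0, 0)

/-- The partial derivative `∂f/∂v^i` of a function on `TM/G` in the chart `c`. -/
def partialV (f : RedTangent E M G → ℝ) (i : ι) (q : RedTangent E M G) : ℝ :=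
  fderiv ℝ (fun z => f (c.symm z)) (c q) (0, Pi.single i 1, 0)

/-- The partial derivative `∂f/∂w^a` of a function on `TM/G` in the chart `c`. -/
def partialW (f : RedTangent E M G → ℝ) (a : κ) (q : RedTangent E M G) : ℝ :=
  fderiv ℝ (fun z => f (c.symm z)) (c q) (0, 0, Pi.single a 1)

end Bundle

end LagPoin

end

/-!
The idea is to write the Euler-Lagrange equations, and the invariant coordinates on `TM`, in a frame
instead of in coordinates.

For a vector field `Z` on `M` the Euler-Lagrange equations say `Γ(Z^V L) = Z^C L`
(`fderiv_verticalLift_of_eulerLagrange`). If `Z_α` is a local frame with quasi-velocities `v^α`,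
then differentiating `∑ v^α Z_α = u` gives `Z_β^V(v^α) = δ^α_β` and `Z_β^C(v^α) = -∑ v^γ [Z_β,
Z_γ]^α` (`fderiv_components_completeLift`). Applied to the invariant frame `X_i, Ê_a` this
determines the derivatives of the functions `(x^i, v^i, w^a)` along the complete and vertical lifts
of the frame (`fderiv_invCoords_completeLift`, `fderiv_invCoords_vertical`). As these functions are
coordinates on `TM/G` and `L` is a function `l` of them, `Z_α^V L` is `∂l/∂v^α` and `Z_α^C L` is the
right-hand side of the Lagrange-Poincaré equations (`IsInvariantChart.projection_partialVel`). Since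
`∑ v^α v^β [Z_α, Z_β] = 0`, the derivative of the coordinates along `Γ` is `(v^i, Γ^i, Γ^a)`
(`fderiv_invCoords_of_secondOrder`), which gives the coordinate expression of the projected field.

The brackets come from relatedness (`mfderiv_mlieBracket_of_related`): the frame fields project onto
constant fields on the base, so their brackets are vertical (`dx_mlieBracket_frame`), and on each
fibre the `Ê_a` correspond to left-invariant fields of `G` (`mlieBracket_invariantField`).

Invariance of `Γ` (`IsEulerLagrangeField.invariant`) follows from the naturality of the
Euler-Lagrange expression (`eulerLagrange_tangent`) and regularity of `L`: the image of `Γ` solves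
the same equations, whose solution is unique. An invariant field acts on functions on `TM/G` through
their pullbacks to `TM` (`projectedField`). The chart of `TM/G` has as inverse the projection of a
section over the points with group coordinate `1` (`coordSection`).

Calculations at a point `u` of the tangent bundle take place in the preferred chart at `u` itself,
where the tangent space at `u` is by definition `E × E` and the derivative of the chart is the
identity; all lifts then have explicit components (`completeLift_eq`, `verticalLift_eq`).
-/

namespace LagPoin

/-! ### Components with respect to a basis -/

section Components

variable {J V V' : Type*} [AddCommGroup V] [Module ℝ V] [AddCommGroup V'] [Module ℝ V']

theorem IsBasisFamily.of_basis (B : Module.Basis J ℝ V) : IsBasisFamily (fun j => B j) :=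
  ⟨B.linearIndependent, B.span_eq.ge⟩

theorem IsBasisFamily.sum_components [Fintype J] {b : J → V} (h : IsBasisFamily b) (v : V) :
    ∑ j, components b v j • b j = v := by
  have := (Module.Basis.mk h.1 h.2).sum_repr v
  simpa [components, h] using this

theorem IsBasisFamily.components_sum [Fintype J] {b : J → V} (h : IsBasisFamily b) (c : J → ℝ) :
    components b (∑ j, c j • b j) = c := by
  have h2 := (Module.Basis.mk h.1 h.2).repr_sum_self c
  simpa [components, h] using h2

theorem IsBasisFamily.components_eq_of_sum [Fintype J] {b : J → V} (h : IsBasisFamily b)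
    {c : J → ℝ} {v : V} (hv : ∑ j, c j • b j = v) : components b v = c := by
  rw [← hv, h.components_sum]

theorem IsBasisFamily.of_equiv (e : V ≃ₗ[ℝ] V') {b : J → V} (h : IsBasisFamily b) :
    IsBasisFamily (fun j => e (b j)) := by
  simpa using IsBasisFamily.of_basis ((Module.Basis.mk h.1 h.2).map e)

theorem isBasisFamily_comp_iff (e : V ≃ₗ[ℝ] V') {b : J → V} :
    IsBasisFamily (fun j => e (b j)) ↔ IsBasisFamily b := by
  refine ⟨fun h => ?_, fun h => h.of_equiv e⟩
  simpa using h.of_equiv e.symm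

/-- Components are natural under linear equivalences, also for families that are not bases. -/
theorem components_comp (e : V ≃ₗ[ℝ] V') (b : J → V) (v : V) :
    components (fun j => e (b j)) (e v) = components b v := by
  by_cases h : IsBasisFamily b
  · have h' := (isBasisFamily_comp_iff e).2 h
    have : (Module.Basis.mk h'.1 h'.2) = (Module.Basis.mk h.1 h.2).map e :=
      Module.Basis.eq_of_apply_eq fun j => by simp
    simp [components, h, h', this]
  · have h' : ¬ IsBasisFamily (fun j => e (b j)) := fun h' => h ((isBasisFamily_comp_iff e).1 h')
    simp [components, h, h']

end Components

/-! ### Smooth dependence of the components -/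

section LocalFrames

variable {J : Type*} [Fintype J] {E : Type*} [NormedAddCommGroup E] [NormedSpace ℝ E]
  {X : Type*} [TopologicalSpace X] {F : Type*} [NormedAddCommGroup F] [NormedSpace ℝ F]

/-- The linear map `c ↦ ∑ c_j b_j`. -/
noncomputable def combination (b : J → E) : (J → ℝ) →L[ℝ] E :=
  ∑ j, (ContinuousLinearMap.proj (R := ℝ) (φ := fun _ : J => ℝ) j).smulRight (b j)

@[simp] theorem combination_apply (b : J → E) (c : J → ℝ) :
    combination b c = ∑ j, c j • b j := by
  simp [combination]

/-- Being a basis is invertibility of a continuous linear map, hence an open condition; the inverse,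
which computes the components, depends smoothly on the basis. -/
theorem isBasisFamily_iff_isInvertible_combination (b : J → E) :
    IsBasisFamily b ↔ (combination b).IsInvertible := by
  constructor
  · intro h
    let B := Module.Basis.mk h.1 h.2
    have : FiniteDimensional ℝ E := B.finiteDimensional_of_finite
    refine ⟨(B.equivFun.symm).toContinuousLinearEquiv, ?_⟩
    ext c
    simp [B, Module.Basis.equivFun_symm_apply]
  · rintro ⟨e, he⟩
    classical
    have := IsBasisFamily.of_basis ((Pi.basisFun ℝ J).map e.toLinearEquiv)
    convert this using 1
    funext j
    have h1 : combination b (Pi.single j 1) = b j := by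
      rw [combination_apply, Finset.sum_eq_single j] <;> simp +contextual
    rw [← h1, ← he]; simp

theorem IsBasisFamily.components_eq_inverse {b : J → E} (h : IsBasisFamily b) (v : E) :
    components b v = (combination b).inverse v := by
  apply h.components_eq_of_sum
  rw [← combination_apply]
  obtain ⟨e, he⟩ := (isBasisFamily_iff_isInvertible_combination b).1 h
  simp [← he]

theorem contDiffAt_combination {n : WithTop ℕ∞} {Z : J → F → E} {x : F}
    (hZ : ∀ j, ContDiffAt ℝ n (Z j) x) :
    ContDiffAt ℝ n (fun y => combination fun j => Z j y) x := by
  unfold combination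
  refine ContDiffAt.sum fun j _ => ?_
  exact contDiffAt_const.smulRight (hZ j)

theorem eventually_isBasisFamily {Z : J → X → E} {x : X} (hZ : ∀ j, ContinuousAt (Z j) x)
    (h : IsBasisFamily fun j => Z j x) : ∀ᶠ y in 𝓝 x, IsBasisFamily fun j => Z j y := by
  simp only [isBasisFamily_iff_isInvertible_combination] at h ⊢
  obtain ⟨e, he⟩ := h
  have hc : ContinuousAt (fun y => combination fun j => Z j y) x := by
    unfold combination
    refine tendsto_finsetSum _ fun j _ => ?_
    exact ((ContinuousLinearMap.smulRightL ℝ (J → ℝ) E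
      (ContinuousLinearMap.proj j)).continuous.continuousAt.comp (hZ j))
  have := hc.preimage_mem_nhds (t := range ((↑) : ((J → ℝ) ≃L[ℝ] E) → _)) (by
    rw [← he]; exact ContinuousLinearEquiv.nhds e)
  filter_upwards [this] with y hy
  exact hy

theorem contDiffAt_components {n : WithTop ℕ∞} {Z : J → F → E} {P : F → E} {x : F}
    (hZ : ∀ j, ContDiffAt ℝ n (Z j) x) (hP : ContDiffAt ℝ n P x)
    (h : IsBasisFamily fun j => Z j x) :
    ContDiffAt ℝ n (fun y => components (fun j => Z j y) (P y)) x := by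
  have hev := eventually_isBasisFamily (fun j => (hZ j).continuousAt) h
  obtain ⟨e, he⟩ := (isBasisFamily_iff_isInvertible_combination _).1 h
  have h1 : ContDiffAt ℝ n (fun y => (combination fun j => Z j y).inverse) x := by
    have h2 := contDiffAt_map_inverse (n := n) e
    rw [he] at h2
    exact ContDiffAt.comp x h2 (contDiffAt_combination hZ)
  refine (h1.clm_apply hP).congr_of_eventuallyEq ?_
  filter_upwards [hev] with y hy
  exact hy.components_eq_inverse _

end LocalFrames

/-! ### Related vector fields on normed spaces -/

section Related

variable {E : Type*} [NormedAddCommGroup E] [NormedSpace ℝ E]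
  {F : Type*} [NormedAddCommGroup F] [NormedSpace ℝ F]

/-- The derivative of the relation `V' ∘ f = Df · V`. -/
theorem fderiv_of_related {f : E → F} {V : E → E} {V' : F → F} {x : E}
    (hf : ContDiffAt ℝ 2 f x) (hV : DifferentiableAt ℝ V x) (hV' : DifferentiableAt ℝ V' (f x))
    (h : ∀ᶠ y in 𝓝 x, V' (f y) = fderiv ℝ f y (V y)) (e : E) :
    fderiv ℝ V' (f x) (fderiv ℝ f x e)
      = fderiv ℝ (fderiv ℝ f) x e (V x) + fderiv ℝ f x (fderiv ℝ V x e) := by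
  have hf1 : DifferentiableAt ℝ f x := hf.differentiableAt (by simp)
  have hf2 : DifferentiableAt ℝ (fderiv ℝ f) x :=
    (hf.fderiv_right (m := 1) (by norm_num)).differentiableAt (by simp)
  have h1 : HasFDerivAt (fun y => V' (f y)) ((fderiv ℝ V' (f x)).comp (fderiv ℝ f x)) x :=
    hV'.hasFDerivAt.comp x hf1.hasFDerivAt
  have h2 := (hf2.hasFDerivAt.clm_apply hV.hasFDerivAt).congr_of_eventuallyEq h
  have h3 := DFunLike.congr_fun (h1.unique h2) e
  simpa [add_comm] using h3

/-- Brackets are natural for related fields: the second-derivative terms of `fderiv_of_related`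
cancel by symmetry. -/
theorem fderiv_lieBracket_of_related {f : E → F} {V W : E → E} {V' W' : F → F} {x : E}
    (hf : ContDiffAt ℝ 2 f x) (hV : DifferentiableAt ℝ V x) (hW : DifferentiableAt ℝ W x)
    (hV' : DifferentiableAt ℝ V' (f x)) (hW' : DifferentiableAt ℝ W' (f x))
    (h : ∀ᶠ y in 𝓝 x, V' (f y) = fderiv ℝ f y (V y))
    (k : ∀ᶠ y in 𝓝 x, W' (f y) = fderiv ℝ f y (W y)) :
    fderiv ℝ f x (VectorField.lieBracket ℝ V W x) = VectorField.lieBracket ℝ V' W' (f x) := by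
  have hs : fderiv ℝ (fderiv ℝ f) x (V x) (W x) = fderiv ℝ (fderiv ℝ f) x (W x) (V x) :=
    (hf.isSymmSndFDerivAt (by simp)).eq _ _
  simp only [VectorField.lieBracket, map_sub, h.self_of_nhds, k.self_of_nhds]
  rw [fderiv_of_related hf hV hV' h, fderiv_of_related hf hW hW' k, hs]
  abel

end Related

/-! ### Quasi-velocities and complete lifts on a normed space -/

section QuasiVelocities

variable {J : Type*} [Fintype J] {E : Type*} [NormedAddCommGroup E] [NormedSpace ℝ E]
  {Z : J → E → E}

/-- The derivative of the quasi-velocities along the complete lift of a frame field `Z_j` is given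
by the brackets of `Z_j` with the frame. -/
theorem fderiv_components_completeLift {x p : E} (hZ : ∀ j, ContDiffAt ℝ ∞ (Z j) x)
    (h : IsBasisFamily fun j => Z j x) (j : J) :
    fderiv ℝ (fun z : E × E => components (fun j => Z j z.1) z.2) (x, p)
        (Z j x, fderiv ℝ (Z j) x p)
      = -∑ k, components (fun j => Z j x) p k •
          components (fun j => Z j x) (VectorField.lieBracket ℝ (Z j) (Z k) x) := by
  have hZ' : ∀ j, ContDiffAt ℝ ∞ (fun z : E × E => Z j z.1) (x, p) := fun j =>
    (hZ j).comp (x, p) contDiffAt_fst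
  have hV := contDiffAt_components hZ' contDiffAt_snd h
  have hVd := hV.differentiableAt (by simp)
  have hev := eventually_isBasisFamily (fun j => (hZ' j).continuousAt) h
  have hZd : ∀ k, HasFDerivAt (fun z : E × E => Z k z.1)
      ((fderiv ℝ (Z k) x).comp (ContinuousLinearMap.fst ℝ E E)) (x, p) := fun k =>
    HasFDerivAt.comp (f := Prod.fst) (g := Z k) (x, p)
      ((hZ k).differentiableAt (by simp)).hasFDerivAt hasFDerivAt_fst
  have hVk : ∀ k, HasFDerivAt (fun z : E × E => components (fun j => Z j z.1) z.2 k)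
      ((ContinuousLinearMap.proj k).comp
        (fderiv ℝ (fun z : E × E => components (fun j => Z j z.1) z.2) (x, p))) (x, p) := fun k =>
    hasFDerivAt_pi'.1 hVd.hasFDerivAt k
  have h1 := HasFDerivAt.fun_sum (u := Finset.univ) fun k _ => (hVk k).smul (hZd k)
  have h2 : HasFDerivAt (fun z : E × E => ∑ k, components (fun j => Z j z.1) z.2 k • Z k z.1)
      (ContinuousLinearMap.snd ℝ E E) (x, p) := by
    refine hasFDerivAt_snd.congr_of_eventuallyEq ?_
    filter_upwards [hev] with z hz
    exact hz.sum_components z.2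
  -- the identity `∑ v^k Z_k = p`, differentiated along the complete lift of `Z_j`
  have h3 := DFunLike.congr_fun (h1.unique h2) (Z j x, fderiv ℝ (Z j) x p)
  simp only [_root_.sum_apply, _root_.add_apply,
    _root_.smul_apply, ContinuousLinearMap.comp_apply,
    ContinuousLinearMap.smulRight_apply, ContinuousLinearMap.coe_fst',
    ContinuousLinearMap.coe_snd', ContinuousLinearMap.proj_apply, Finset.sum_add_distrib] at h3
  have h4 : fderiv ℝ (Z j) x p
      = ∑ k, components (fun j => Z j x) p k • fderiv ℝ (Z j) x (Z k x) := by
    conv_lhs => rw [← h.sum_components p]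
    simp
  -- both sides are families of components, compared through the vectors they represent
  rw [← h.components_sum (-∑ k, _), ← h.components_sum (fderiv ℝ _ _ _)]
  congr 1
  have h5 : ∀ k, VectorField.lieBracket ℝ (Z j) (Z k) x
      = fderiv ℝ (Z k) x (Z j x) - fderiv ℝ (Z j) x (Z k x) := fun k => rfl
  have h6 : ∀ v : E, ∑ i, components (fun j => Z j x) v i • Z i x = v := h.sum_components
  calc _ = fderiv ℝ (Z j) x p
        - ∑ k, components (fun j => Z j x) p k • fderiv ℝ (Z k) x (Z j x) := by
        rw [eq_sub_iff_add_eq, add_comm]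
        exact h3
    _ = -∑ k, components (fun j => Z j x) p k • VectorField.lieBracket ℝ (Z j) (Z k) x := by
        rw [h4]
        simp only [h5, smul_sub, Finset.sum_sub_distrib]
        abel
    _ = _ := by
        simp only [Pi.neg_apply, Finset.sum_apply, Pi.smul_apply, smul_eq_mul, neg_smul,
          Finset.sum_smul, Finset.sum_neg_distrib, mul_smul]
        rw [Finset.sum_comm]
        simp only [← Finset.smul_sum, h6]

/-- A family of vectors over a basis, completed by the same basis in the fibre, is a basis. -/
theorem IsBasisFamily.sumElim {V : Type*} [AddCommGroup V] [Module ℝ V] {b : J → V}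
    (h : IsBasisFamily b) (a : J → V) :
    IsBasisFamily (V := V × V) (Sum.elim (fun j => (b j, a j)) (fun j => (0, b j))) := by
  let B := Module.Basis.mk h.1 h.2
  let A : V →ₗ[ℝ] V := B.constr ℝ a
  have := IsBasisFamily.of_basis ((B.prod B).map
    ((LinearEquiv.refl ℝ V).skewProd (LinearEquiv.refl ℝ V) A))
  convert this using 1
  funext j
  have hA : ∀ j, A (b j) = a j := fun j => by
    simpa [B, A, -Module.Basis.constr_apply_fintype] using B.constr_basis ℝ a j
  rcases j with j | j <;> simp [B, hA]

/-- The components of `(p, q)` along the first half of the basis `IsBasisFamily.sumElim` depend only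
on `p`. -/
theorem IsBasisFamily.sumElim_components {V : Type*} [AddCommGroup V] [Module ℝ V] {b : J → V}
    (h : IsBasisFamily b) (a : J → V) (p q : V) (j : J) :
    components (V := V × V) (Sum.elim (fun j => (b j, a j)) (fun j => (0, b j))) (p, q)
      (Sum.inl j) = components b p j := by
  have h1 := (h.sumElim a).sum_components (p, q)
  have h2 := congrArg Prod.fst h1
  simp only [Fintype.sum_sum_type, Sum.elim_inl, Sum.elim_inr, Prod.fst_add, Prod.fst_sum,
    Prod.smul_fst, smul_zero, Finset.sum_const_zero, add_zero] at h2
  exact (congrFun (h.components_eq_of_sum h2) j).symm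

end QuasiVelocities

/-! ### The Euler-Lagrange expression on a normed space -/

section EulerLagrange

variable {E : Type*} [NormedAddCommGroup E] [NormedSpace ℝ E]
  {F : Type*} [NormedAddCommGroup F] [NormedSpace ℝ F]

theorem contDiffAt_tangent {m n : WithTop ℕ∞} {f : E → F} {z : E × E} (hf : ContDiffAt ℝ n f z.1)
    (hmn : m + 1 ≤ n) : ContDiffAt ℝ m (fun z : E × E => (f z.1, fderiv ℝ f z.1 z.2)) z := by
  have h1 : ContDiffAt ℝ m (fderiv ℝ f) z.1 := hf.fderiv_right hmn
  exact ((hf.of_le (le_self_add.trans hmn)).comp z contDiffAt_fst).prodMk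
    ((h1.comp z contDiffAt_fst).clm_apply contDiffAt_snd)

/-- The derivative of the tangent map `(x, p) ↦ (f x, Df(x) p)`. -/
theorem fderiv_tangent {f : E → F} {z : E × E} (hf : ContDiffAt ℝ 2 f z.1) (a b : E) :
    fderiv ℝ (fun z : E × E => (f z.1, fderiv ℝ f z.1 z.2)) z (a, b)
      = (fderiv ℝ f z.1 a, fderiv ℝ (fderiv ℝ f) z.1 a z.2 + fderiv ℝ f z.1 b) := by
  have h1 : HasFDerivAt (fun z : E × E => f z.1) _ z :=
    (hf.differentiableAt (by simp)).hasFDerivAt.comp z hasFDerivAt_fst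
  have h2 : HasFDerivAt (fun z : E × E => fderiv ℝ f z.1) _ z :=
    ((hf.fderiv_right (m := 1) (by norm_num)).differentiableAt
      (by simp)).hasFDerivAt.comp z hasFDerivAt_fst
  rw [(h1.prodMk (h2.clm_apply hasFDerivAt_snd)).fderiv]
  simp [add_comm]

theorem fderiv_fderiv_apply {L : E → ℝ} {z : E} (hL : ContDiffAt ℝ 2 L z) {c : E → E}
    {c' : E →L[ℝ] E} (hc : HasFDerivAt c c' z) (Y : E) :
    fderiv ℝ (fun z => fderiv ℝ L z (c z)) z Y
      = fderiv ℝ (fderiv ℝ L) z Y (c z) + fderiv ℝ L z (c' Y) := by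
  have h2 : DifferentiableAt ℝ (fderiv ℝ L) z :=
    (hL.fderiv_right (m := 1) (by norm_num)).differentiableAt (by simp)
  rw [(h2.hasFDerivAt.clm_apply hc).fderiv]
  simp [add_comm]

/-- The Euler-Lagrange expression is natural under the tangent map of a local change of
coordinates. -/
theorem eulerLagrange_tangent {f : E → F} {z Y : E × E} {L : E × E → ℝ} {L' : F × F → ℝ}
    (hf : ContDiffAt ℝ 2 f z.1) (hL' : ContDiffAt ℝ 2 L' (f z.1, fderiv ℝ f z.1 z.2))
    (hL : L =ᶠ[𝓝 z] fun z => L' (f z.1, fderiv ℝ f z.1 z.2)) (hY : Y.1 = z.2) (e : E) :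
    fderiv ℝ (fun z' => fderiv ℝ L z' (0, e)) z Y - fderiv ℝ L z (e, 0)
      = fderiv ℝ (fun z' => fderiv ℝ L' z' (0, fderiv ℝ f z.1 e)) (f z.1, fderiv ℝ f z.1 z.2)
          (fderiv ℝ (fun z : E × E => (f z.1, fderiv ℝ f z.1 z.2)) z Y)
        - fderiv ℝ L' (f z.1, fderiv ℝ f z.1 z.2) (fderiv ℝ f z.1 e, 0) := by
  set T : E × E → F × F := fun z => (f z.1, fderiv ℝ f z.1 z.2) with hT
  have hTc : ContDiffAt ℝ 1 T z := contDiffAt_tangent hf (by norm_num)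
  have hfe : ∀ᶠ z' in 𝓝 z, ContDiffAt ℝ 2 f z'.1 :=
    continuousAt_fst.eventually (hf.eventually (by simp))
  have hLe : ∀ᶠ z' in 𝓝 z, ContDiffAt ℝ 2 L' (T z') :=
    hTc.continuousAt.eventually (hL'.eventually (by simp))
  have hD : ∀ᶠ z' in 𝓝 z, fderiv ℝ L z' = (fderiv ℝ L' (T z')).comp (fderiv ℝ T z') := by
    filter_upwards [hfe, hLe, hL.eventuallyEq_nhds] with z' h1 h2 h3
    rw [h3.fderiv_eq]
    exact fderiv_comp z' (h2.differentiableAt (by simp))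
      ((contDiffAt_tangent (m := 1) h1 (by norm_num)).differentiableAt (by simp))
  have hD1 : (fun z' => fderiv ℝ L z' (0, e)) =ᶠ[𝓝 z]
      fun z' => fderiv ℝ L' (T z') (0, fderiv ℝ f z'.1 e) := by
    filter_upwards [hD, hfe] with z' h1 h2
    rw [h1, ContinuousLinearMap.comp_apply, hT, fderiv_tangent h2]
    simp
  have hL2 : HasFDerivAt (fun z' => fderiv ℝ L' (T z')) _ z :=
    ((hL'.fderiv_right (m := 1) (by norm_num)).differentiableAt
      (by simp)).hasFDerivAt.comp z (hTc.differentiableAt (by simp)).hasFDerivAt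
  have hf2 : HasFDerivAt (fun z' : E × E => fderiv ℝ f z'.1) _ z :=
    ((hf.fderiv_right (m := 1) (by norm_num)).differentiableAt
      (by simp)).hasFDerivAt.comp z hasFDerivAt_fst
  have hc : HasFDerivAt (fun z' : E × E => ((0 : F), fderiv ℝ f z'.1 e)) _ z :=
    (hasFDerivAt_const (0 : F) z).prodMk (hf2.clm_apply (hasFDerivAt_const e z))
  -- the two second-derivative terms match because `Y` is second-order
  have hs : fderiv ℝ (fderiv ℝ f) z.1 Y.1 e = fderiv ℝ (fderiv ℝ f) z.1 e Y.1 :=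
    (hf.isSymmSndFDerivAt (by simp)).eq _ _
  rw [hD1.fderiv_eq, (hL2.clm_apply hc).fderiv, hD.self_of_nhds,
    fderiv_fderiv_apply hL' (hasFDerivAt_const _ _)]
  have h3 : fderiv ℝ T z (e, 0) = (fderiv ℝ f z.1 e, fderiv ℝ (fderiv ℝ f) z.1 e z.2) := by
    rw [hT, fderiv_tangent hf]; simp
  have h4 : fderiv ℝ L' (T z) (fderiv ℝ f z.1 e, fderiv ℝ (fderiv ℝ f) z.1 e z.2)
      = fderiv ℝ L' (T z) (fderiv ℝ f z.1 e, 0)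
        + fderiv ℝ L' (T z) (0, fderiv ℝ (fderiv ℝ f) z.1 e z.2) := by
    rw [← map_add]; simp
  rw [ContinuousLinearMap.comp_apply, h3, h4]
  rw [hY] at hs
  simp only [hT] at *
  simp [hs, hY]
  abel

/-- If the Euler-Lagrange equations hold at `z` along `Y`, then `Y(Z^V L) = Z^C L` for every vector
field `Z`. -/
theorem fderiv_verticalLift_of_eulerLagrange {z Y : E × E} {L : E × E → ℝ}
    (hL : ContDiffAt ℝ 2 L z) (hY : Y.1 = z.2) {Z : E → E} (hZ : DifferentiableAt ℝ Z z.1)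
    (h : fderiv ℝ (fun z' => fderiv ℝ L z' (0, Z z.1)) z Y - fderiv ℝ L z (Z z.1, 0) = 0) :
    fderiv ℝ (fun z' : E × E => fderiv ℝ L z' (0, Z z'.1)) z Y
      = fderiv ℝ L z (Z z.1, fderiv ℝ Z z.1 z.2) := by
  have hZ' : HasFDerivAt (fun z' : E × E => Z z'.1) _ z := hZ.hasFDerivAt.comp z hasFDerivAt_fst
  rw [fderiv_fderiv_apply hL (hasFDerivAt_const _ _)] at h
  rw [fderiv_fderiv_apply hL ((hasFDerivAt_const (0 : E) z).prodMk hZ')]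
  have h1 : fderiv ℝ L z (Z z.1, fderiv ℝ Z z.1 z.2)
      = fderiv ℝ L z (Z z.1, 0) + fderiv ℝ L z (0, fderiv ℝ Z z.1 z.2) := by
    rw [← map_add]; simp
  rw [h1]
  simp only [zero_apply, map_zero, add_zero] at h
  rw [sub_eq_zero.1 h]
  simp [hY]

end EulerLagrange

/-! ### Natural coordinates on the tangent bundle -/

section Charts

variable {E : Type*} [NormedAddCommGroup E] [NormedSpace ℝ E]
  {M : Type*} [TopologicalSpace M] [ChartedSpace E M] [IsManifold 𝓘(ℝ, E) ∞ M]

theorem extChartAt_tangent_eq (u : TangentBundle 𝓘(ℝ, E) M) :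
    extChartAt 𝓘(ℝ, E).tangent (⟨u.1, 0⟩ : TangentBundle 𝓘(ℝ, E) M)
      = extChartAt 𝓘(ℝ, E).tangent u := rfl

/-- Natural coordinates: the chart at `u` of the tangent bundle is the chart at `u.1` together with
its derivative. -/
theorem extChartAt_tangent_apply (u v : TangentBundle 𝓘(ℝ, E) M)
    (hv : v.1 ∈ (chartAt E u.1).source) :
    extChartAt 𝓘(ℝ, E).tangent u v = (extChartAt 𝓘(ℝ, E) u.1 v.1,
      (mfderiv 𝓘(ℝ, E) 𝓘(ℝ, E) (extChartAt 𝓘(ℝ, E) u.1) v.1 v.2 : E)) := by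
  have h := TangentBundle.continuousLinearMapAt_trivializationAt (I := 𝓘(ℝ, E)) hv
  rw [← h, TangentBundle.continuousLinearMapAt_trivializationAt_eq_core hv]
  rfl

/-- At `u` itself, the fibre coordinate of the chart at `u` is the identity of the model space. -/
theorem extChartAt_tangent_self (u : TangentBundle 𝓘(ℝ, E) M) :
    extChartAt 𝓘(ℝ, E).tangent u u = (extChartAt 𝓘(ℝ, E) u.1 u.1, (u.2 : E)) := by
  rw [extChartAt_tangent_apply u u (mem_chart_source E u.1), mfderiv_extChartAt_self]
  rfl

theorem extChartAt_tangent_symm_fst (u : TangentBundle 𝓘(ℝ, E) M) (z : E × E) :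
    ((extChartAt 𝓘(ℝ, E).tangent u).symm z).1 = (extChartAt 𝓘(ℝ, E) u.1).symm z.1 := rfl

theorem mem_extChartAt_tangent_target (u : TangentBundle 𝓘(ℝ, E) M) (z : E × E) :
    z ∈ (extChartAt 𝓘(ℝ, E).tangent u).target ↔ z.1 ∈ (extChartAt 𝓘(ℝ, E) u.1).target := by
  have h := TangentBundle.mem_chart_target_iff (I := 𝓘(ℝ, E)) (H := E) z u
  have h1 : (extChartAt 𝓘(ℝ, E).tangent u).target = (chartAt (ModelProd E E) u).target := by
    ext z; simp [extChartAt]; rfl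
  have h2 : (extChartAt 𝓘(ℝ, E) u.1).target = (chartAt E u.1).target := by
    simp [extChartAt]
  rw [h1, h2]
  exact h

theorem mem_extChartAt_tangent_source (u v : TangentBundle 𝓘(ℝ, E) M) :
    v ∈ (extChartAt 𝓘(ℝ, E).tangent u).source ↔ v.1 ∈ (chartAt E u.1).source := by
  rw [extChartAt_source, TangentBundle.mem_chart_source_iff]

theorem mfderiv_extChartAt_isInvertible {m x : M} (hx : x ∈ (chartAt E m).source) :
    (mfderiv 𝓘(ℝ, E) 𝓘(ℝ, E) (extChartAt 𝓘(ℝ, E) m) x).IsInvertible :=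
  isInvertible_mfderiv_extChartAt (by simpa using hx)

theorem localRep_self (Z : ∀ m : M, TangentSpace 𝓘(ℝ, E) m) (m : M) :
    localRep Z m (extChartAt 𝓘(ℝ, E) m m) = Z m := by
  unfold localRep
  rw [extChartAt_to_inv, mfderiv_extChartAt_self]
  rfl

theorem localRep_eq_mpullbackWithin (Z : ∀ m : M, TangentSpace 𝓘(ℝ, E) m) (m : M) {x : E}
    (hx : x ∈ (extChartAt 𝓘(ℝ, E) m).target) :
    localRep Z m x = VectorField.mpullbackWithin 𝓘(ℝ, E) 𝓘(ℝ, E) (extChartAt 𝓘(ℝ, E) m).symm Z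
      (range 𝓘(ℝ, E)) x := by
  unfold localRep VectorField.mpullbackWithin
  congr 1
  symm
  apply ContinuousLinearMap.inverse_eq
  · exact mfderivWithin_extChartAt_symm_comp_mfderiv_extChartAt hx
  · exact mfderiv_extChartAt_comp_mfderivWithin_extChartAt_symm hx

/-- At the centre of the chart, where the derivative of the chart is the identity, the bracket is
computed from the representatives in that chart. -/
theorem mlieBracket_eq_lieBracket_localRep (V W : ∀ m : M, TangentSpace 𝓘(ℝ, E) m) (m : M) :
    VectorField.mlieBracket 𝓘(ℝ, E) V W m
      = VectorField.lieBracket ℝ (localRep V m) (localRep W m) (extChartAt 𝓘(ℝ, E) m m) := by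
  have h : ∀ Z : (∀ m : M, TangentSpace 𝓘(ℝ, E) m), localRep Z m
      =ᶠ[𝓝 (extChartAt 𝓘(ℝ, E) m m)] VectorField.mpullbackWithin 𝓘(ℝ, E) 𝓘(ℝ, E)
        (extChartAt 𝓘(ℝ, E) m).symm Z (range 𝓘(ℝ, E)) := fun Z => by
    filter_upwards [extChartAt_target_mem_nhds (I := 𝓘(ℝ, E)) m] with x hx
    exact localRep_eq_mpullbackWithin Z m hx
  rw [(h V).lieBracket_vectorField_eq (h W), ← VectorField.mlieBracketWithin_univ,
    VectorField.mlieBracketWithin_apply, mfderiv_extChartAt_self]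
  refine (congrArg (fun A : E →L[ℝ] E => A _)
    (ContinuousLinearMap.inverse_id (R := ℝ) (M := E))).trans ?_
  rw [preimage_univ, univ_inter, 𝓘(ℝ, E).range_eq_univ]
  exact congrFun VectorField.lieBracketWithin_univ _

theorem contDiffAt_localRep {Z : ∀ m : M, TangentSpace 𝓘(ℝ, E) m} {m : M}
    (hZ : ContMDiffAt 𝓘(ℝ, E) 𝓘(ℝ, E).tangent ∞
      (fun m => (⟨m, Z m⟩ : TangentBundle 𝓘(ℝ, E) M)) m) :
    ContDiffAt ℝ ∞ (localRep Z m) (extChartAt 𝓘(ℝ, E) m m) := by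
  have h1 : ContMDiffAt 𝓘(ℝ, E) 𝓘(ℝ, E × E) ∞ (fun x : M =>
      extChartAt 𝓘(ℝ, E).tangent (⟨m, Z m⟩ : TangentBundle 𝓘(ℝ, E) M) ⟨x, Z x⟩) m :=
    ContMDiffAt.comp m contMDiffAt_extChartAt hZ
  have h2 : ContMDiffAt 𝓘(ℝ, E) 𝓘(ℝ, E) ∞ (extChartAt 𝓘(ℝ, E) m).symm (extChartAt 𝓘(ℝ, E) m m) := by
    have := contMDiffOn_extChartAt_symm (I := 𝓘(ℝ, E)) (n := ∞) m
    exact this.contMDiffAt (extChartAt_target_mem_nhds (I := 𝓘(ℝ, E)) m)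
  have h3 := h1.comp_of_eq h2 (extChartAt_to_inv (I := 𝓘(ℝ, E)) m)
  have h4 := h3.contDiffAt.snd
  refine h4.congr_of_eventuallyEq ?_
  filter_upwards [extChartAt_target_mem_nhds (I := 𝓘(ℝ, E)) m] with x hx
  simp only [Function.comp_apply]
  rw [extChartAt_tangent_apply]
  · rfl
  · simpa using (extChartAt 𝓘(ℝ, E) m).map_target hx

end Charts

/-! ### Complete and vertical lifts in natural coordinates -/

section Lifts

variable {E : Type*} [NormedAddCommGroup E] [NormedSpace ℝ E]
  {M : Type*} [TopologicalSpace M] [ChartedSpace E M] [IsManifold 𝓘(ℝ, E) ∞ M]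

theorem mfderiv_eq_fderiv_chart {H₁ H₂ : Type*} [NormedAddCommGroup H₁] [NormedSpace ℝ H₁]
    [NormedAddCommGroup H₂] [NormedSpace ℝ H₂] {N₁ N₂ A B : Type*}
    [TopologicalSpace A] [TopologicalSpace B] {I : ModelWithCorners ℝ H₁ A}
    {J : ModelWithCorners ℝ H₂ B} [I.Boundaryless]
    [TopologicalSpace N₁] [TopologicalSpace N₂]
    [ChartedSpace A N₁] [ChartedSpace B N₂] {f : N₁ → N₂} {x : N₁}
    (hf : MDifferentiableAt I J f x) :
    mfderiv I J f x
      = fderiv ℝ (extChartAt J (f x) ∘ f ∘ (extChartAt I x).symm) (extChartAt I x x) := by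
  rw [hf.mfderiv, writtenInExtChartAt, I.range_eq_univ, fderivWithin_univ]

/-- In the chart at `u` the tangent space at `u` is by definition `E × E`, and the derivative
along `W` is the derivative of the representative along the same vector. -/
theorem dirDeriv_eq_fderiv {F : TangentBundle 𝓘(ℝ, E) M → ℝ} {u : TangentBundle 𝓘(ℝ, E) M}
    (hF : MDifferentiableAt 𝓘(ℝ, E).tangent 𝓘(ℝ, ℝ) F u) (W : TangentSpace 𝓘(ℝ, E).tangent u) :
    dirDeriv F u W = fderiv ℝ (fun z => F ((extChartAt 𝓘(ℝ, E).tangent u).symm z))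
      (extChartAt 𝓘(ℝ, E).tangent u u) W := by
  unfold dirDeriv
  rw [mfderiv_eq_fderiv_chart hF]
  rfl

theorem completeLift_eq (Z : ∀ m : M, TangentSpace 𝓘(ℝ, E) m) (u : TangentBundle 𝓘(ℝ, E) M) :
    (completeLift Z u : E × E) =
      ((Z u.1 : E), fderiv ℝ (localRep Z u.1) (extChartAt 𝓘(ℝ, E) u.1 u.1) u.2) := by
  unfold completeLift
  simp only
  have := mfderivWithin_range_extChartAt_symm (I := 𝓘(ℝ, E).tangent) (x := u)
  rw [𝓘(ℝ, E).tangent.range_eq_univ, mfderivWithin_univ] at this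
  have h2 : mfderiv 𝓘(ℝ, E × E) 𝓘(ℝ, E).tangent (extChartAt 𝓘(ℝ, E).tangent u).symm
      (extChartAt 𝓘(ℝ, E).tangent u u) = ContinuousLinearMap.id ℝ (E × E) := this
  rw [h2, extChartAt_tangent_self]
  simp only [localRep_self]
  rfl

theorem verticalLift_eq (Z : ∀ m : M, TangentSpace 𝓘(ℝ, E) m) (u : TangentBundle 𝓘(ℝ, E) M) :
    (verticalLift Z u : E × E) = ((0 : E), (Z u.1 : E)) := by
  unfold verticalLift
  have h0 : ∀ q : E, extChartAt 𝓘(ℝ, E).tangent u (⟨u.1, q⟩ : TangentBundle 𝓘(ℝ, E) M)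
      = (extChartAt 𝓘(ℝ, E) u.1 u.1, q) := fun q =>
    extChartAt_tangent_self (⟨u.1, q⟩ : TangentBundle 𝓘(ℝ, E) M)
  have hs : ∀ q : E, (extChartAt 𝓘(ℝ, E).tangent u).symm (extChartAt 𝓘(ℝ, E) u.1 u.1, q) =
      (⟨u.1, q⟩ : TangentBundle 𝓘(ℝ, E) M) := fun q => by
    rw [← h0, (extChartAt 𝓘(ℝ, E).tangent u).left_inv]
    rw [mem_extChartAt_tangent_source]
    exact mem_chart_source E u.1
  have hd : ContMDiffAt 𝓘(ℝ, E) 𝓘(ℝ, E).tangent ∞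
      (fun q : E => (⟨u.1, q⟩ : TangentBundle 𝓘(ℝ, E) M)) u.2 := by
    have h1 := (contMDiffOn_extChartAt_symm (I := 𝓘(ℝ, E).tangent) (n := ∞) u).contMDiffAt
      (extChartAt_target_mem_nhds (I := 𝓘(ℝ, E).tangent) u)
    have h2 : ContMDiffAt 𝓘(ℝ, E) 𝓘(ℝ, E × E) ∞ (fun q : E => (extChartAt 𝓘(ℝ, E) u.1 u.1, q))
      (u.2 : E) := (contDiffAt_const.prodMk contDiffAt_id).contMDiffAt
    have h3 := h1.comp_of_eq h2 (extChartAt_tangent_self u).symm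
    refine h3.congr_of_eventuallyEq (.of_forall fun q => ?_)
    exact (hs q).symm
  rw [mfderiv_eq_fderiv_chart (hd.mdifferentiableAt (by simp))]
  have h3 : (extChartAt 𝓘(ℝ, E).tangent (⟨u.1, u.2⟩ : TangentBundle 𝓘(ℝ, E) M) ∘
      (fun q : E => (⟨u.1, q⟩ : TangentBundle 𝓘(ℝ, E) M)) ∘
      (extChartAt 𝓘(ℝ, E) (show E from u.2)).symm)
      = fun q => (extChartAt 𝓘(ℝ, E) u.1 u.1, q) := by
    funext q
    exact h0 q
  have h4 : HasFDerivAt (fun q : E => (extChartAt 𝓘(ℝ, E) u.1 u.1, q))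
    (ContinuousLinearMap.inr ℝ E E) u.2 := hasFDerivAt_prodMk_right _ _
  have h5 := h4.fderiv
  rw [← h3] at h5
  exact DFunLike.congr_fun h5 (Z u.1)

end Lifts

/-! ### Tangent maps in natural coordinates -/

section MapsInCharts

variable {E : Type*} [NormedAddCommGroup E] [NormedSpace ℝ E]
  {M : Type*} [TopologicalSpace M] [ChartedSpace E M] [IsManifold 𝓘(ℝ, E) ∞ M]
  {F : Type*} [NormedAddCommGroup F] [NormedSpace ℝ F]
  {N : Type*} [TopologicalSpace N] [ChartedSpace F N] [IsManifold 𝓘(ℝ, F) ∞ N]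

variable (E F) in
/-- The representative of a map between manifolds in the preferred charts at `m` and `n`. -/
noncomputable def chartRep (h : M → N) (m : M) (n : N) : E → F :=
  extChartAt 𝓘(ℝ, F) n ∘ h ∘ (extChartAt 𝓘(ℝ, E) m).symm

theorem contDiffAt_chartRep {h : M → N} {m x : M} {n : N}
    (hh : ContMDiffAt 𝓘(ℝ, E) 𝓘(ℝ, F) ∞ h x) (hx : x ∈ (chartAt E m).source)
    (hn : h x ∈ (chartAt F n).source) :
    ContDiffAt ℝ ∞ (chartRep E F h m n) (extChartAt 𝓘(ℝ, E) m x) := by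
  have hx' : x ∈ (extChartAt 𝓘(ℝ, E) m).source := by simpa using hx
  have h1 : ContMDiffAt 𝓘(ℝ, E) 𝓘(ℝ, E) ∞ (extChartAt 𝓘(ℝ, E) m).symm (extChartAt 𝓘(ℝ, E) m x) :=
    (contMDiffOn_extChartAt_symm (I := 𝓘(ℝ, E)) (n := ∞) m).contMDiffAt
      ((isOpen_extChartAt_target m).mem_nhds ((extChartAt 𝓘(ℝ, E) m).map_source hx'))
  have h2 := hh.comp_of_eq h1 ((extChartAt 𝓘(ℝ, E) m).left_inv hx')
  have h3 : ContMDiffAt 𝓘(ℝ, F) 𝓘(ℝ, F) ∞ (extChartAt 𝓘(ℝ, F) n) (h x) := contMDiffAt_extChartAt' hn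
  exact (h3.comp_of_eq h2 (by simp only [Function.comp_apply,
    (extChartAt 𝓘(ℝ, E) m).left_inv hx'])).contDiffAt

theorem fderiv_chartRep {h : M → N} {m x : M} {n : N}
    (hh : ContMDiffAt 𝓘(ℝ, E) 𝓘(ℝ, F) ∞ h x) (hx : x ∈ (chartAt E m).source)
    (hn : h x ∈ (chartAt F n).source) (w : TangentSpace 𝓘(ℝ, E) x) :
    fderiv ℝ (chartRep E F h m n) (extChartAt 𝓘(ℝ, E) m x)
        (mfderiv 𝓘(ℝ, E) 𝓘(ℝ, E) (extChartAt 𝓘(ℝ, E) m) x w)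
      = mfderiv 𝓘(ℝ, F) 𝓘(ℝ, F) (extChartAt 𝓘(ℝ, F) n) (h x)
          (mfderiv 𝓘(ℝ, E) 𝓘(ℝ, F) h x w) := by
  have h1 := mdifferentiableAt_extChartAt (I := 𝓘(ℝ, E)) hx
  have h2 := mdifferentiableAt_extChartAt (I := 𝓘(ℝ, F)) hn
  have h3 := (contDiffAt_chartRep hh hx hn).differentiableAt (by simp)
  have h4 : chartRep E F h m n ∘ extChartAt 𝓘(ℝ, E) m =ᶠ[𝓝 x] extChartAt 𝓘(ℝ, F) n ∘ h := by
    filter_upwards [(chartAt E m).open_source.mem_nhds hx] with y hy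
    simp only [Function.comp_apply, chartRep]
    rw [(extChartAt 𝓘(ℝ, E) m).left_inv (by simpa using hy)]
  have h5 := h4.mfderiv_eq (I := 𝓘(ℝ, E)) (I' := 𝓘(ℝ, F))
  rw [mfderiv_comp x h3.mdifferentiableAt h1, mfderiv_eq_fderiv,
    mfderiv_comp x h2 (hh.mdifferentiableAt (by simp))] at h5
  exact DFunLike.congr_fun h5 w

/-- In the natural coordinates, the tangent map of `h` is `(x, p) ↦ (f(x), Df(x) p)`. -/
theorem extChartAt_tangentMap {h : M → N} (u : TangentBundle 𝓘(ℝ, E) M)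
    (u' : TangentBundle 𝓘(ℝ, F) N) {z : E × E} (hz : z.1 ∈ (extChartAt 𝓘(ℝ, E) u.1).target)
    (hh : ContMDiffAt 𝓘(ℝ, E) 𝓘(ℝ, F) ∞ h ((extChartAt 𝓘(ℝ, E) u.1).symm z.1))
    (hn : h ((extChartAt 𝓘(ℝ, E) u.1).symm z.1) ∈ (chartAt F u'.1).source) :
    extChartAt 𝓘(ℝ, F).tangent u'
        (tangentMap 𝓘(ℝ, E) 𝓘(ℝ, F) h ((extChartAt 𝓘(ℝ, E).tangent u).symm z))
      = (chartRep E F h u.1 u'.1 z.1, fderiv ℝ (chartRep E F h u.1 u'.1) z.1 z.2) := by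
  set v := (extChartAt 𝓘(ℝ, E).tangent u).symm z with hv
  have hv1 : v.1 ∈ (chartAt E u.1).source := by
    have := (extChartAt 𝓘(ℝ, E) u.1).map_target hz
    rwa [extChartAt_source] at this
  have hzv : z = extChartAt 𝓘(ℝ, E).tangent u v :=
    ((extChartAt 𝓘(ℝ, E).tangent u).right_inv ((mem_extChartAt_tangent_target u z).2 hz)).symm
  rw [extChartAt_tangent_apply u v hv1] at hzv
  rw [extChartAt_tangent_apply _ _ hn, hzv]
  refine Prod.ext ?_ ?_
  · simp only [chartRep, Function.comp_apply]
    rw [(extChartAt 𝓘(ℝ, E) u.1).left_inv (by simpa using hv1)]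
    rfl
  · exact (fderiv_chartRep hh hv1 hn v.2).symm

theorem localRep_of_related {h : M → N} {m x : M} {n : N}
    {V : ∀ m : M, TangentSpace 𝓘(ℝ, E) m} {V' : ∀ n : N, TangentSpace 𝓘(ℝ, F) n}
    (hh : ContMDiffAt 𝓘(ℝ, E) 𝓘(ℝ, F) ∞ h x) (hx : x ∈ (chartAt E m).source)
    (hn : h x ∈ (chartAt F n).source) (hV : V' (h x) = mfderiv 𝓘(ℝ, E) 𝓘(ℝ, F) h x (V x)) :
    localRep V' n (chartRep E F h m n (extChartAt 𝓘(ℝ, E) m x))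
      = fderiv ℝ (chartRep E F h m n) (extChartAt 𝓘(ℝ, E) m x)
          (localRep V m (extChartAt 𝓘(ℝ, E) m x)) := by
  have h1 : (extChartAt 𝓘(ℝ, E) m).symm (extChartAt 𝓘(ℝ, E) m x) = x :=
    (extChartAt 𝓘(ℝ, E) m).left_inv (by simpa using hx)
  have h2 : (extChartAt 𝓘(ℝ, F) n).symm (chartRep E F h m n (extChartAt 𝓘(ℝ, E) m x)) = h x := by
    simp only [chartRep, Function.comp_apply, h1]
    exact (extChartAt 𝓘(ℝ, F) n).left_inv (by simpa using hn)
  unfold localRep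
  rw [h1, h2, hV]
  exact (fderiv_chartRep hh hx hn (V x)).symm

/-- The tangent map carries brackets of vector fields to brackets of related vector fields. -/
theorem mfderiv_mlieBracket_of_related {h : M → N} {m : M}
    {V W : ∀ m : M, TangentSpace 𝓘(ℝ, E) m} {V' W' : ∀ n : N, TangentSpace 𝓘(ℝ, F) n}
    (hh : ∀ᶠ x in 𝓝 m, ContMDiffAt 𝓘(ℝ, E) 𝓘(ℝ, F) ∞ h x)
    (hV : ContMDiffAt 𝓘(ℝ, E) 𝓘(ℝ, E).tangent ∞
      (fun m => (⟨m, V m⟩ : TangentBundle 𝓘(ℝ, E) M)) m)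
    (hW : ContMDiffAt 𝓘(ℝ, E) 𝓘(ℝ, E).tangent ∞
      (fun m => (⟨m, W m⟩ : TangentBundle 𝓘(ℝ, E) M)) m)
    (hV' : ContMDiffAt 𝓘(ℝ, F) 𝓘(ℝ, F).tangent ∞
      (fun m => (⟨m, V' m⟩ : TangentBundle 𝓘(ℝ, F) N)) (h m))
    (hW' : ContMDiffAt 𝓘(ℝ, F) 𝓘(ℝ, F).tangent ∞
      (fun m => (⟨m, W' m⟩ : TangentBundle 𝓘(ℝ, F) N)) (h m))
    (hVV' : ∀ᶠ x in 𝓝 m, V' (h x) = mfderiv 𝓘(ℝ, E) 𝓘(ℝ, F) h x (V x))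
    (hWW' : ∀ᶠ x in 𝓝 m, W' (h x) = mfderiv 𝓘(ℝ, E) 𝓘(ℝ, F) h x (W x)) :
    mfderiv 𝓘(ℝ, E) 𝓘(ℝ, F) h m (VectorField.mlieBracket 𝓘(ℝ, E) V W m)
      = VectorField.mlieBracket 𝓘(ℝ, F) V' W' (h m) := by
  have hm := hh.self_of_nhds
  have hs : ∀ᶠ x in 𝓝 m, x ∈ (chartAt E m).source ∧ h x ∈ (chartAt F (h m)).source :=
    Filter.Eventually.and ((chartAt E m).open_source.mem_nhds (mem_chart_source E m))
      (hm.continuousAt.eventually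
        ((chartAt F (h m)).open_source.mem_nhds (mem_chart_source F (h m))))
  have hc : ∀ {P : M → Prop}, (∀ᶠ x in 𝓝 m, P x) →
      ∀ᶠ y in 𝓝 (extChartAt 𝓘(ℝ, E) m m), P ((extChartAt 𝓘(ℝ, E) m).symm y) := fun hP => by
    refine (continuousAt_extChartAt_symm (I := 𝓘(ℝ, E)) m).eventually ?_
    rwa [extChartAt_to_inv]
  have key : ∀ {V : ∀ m : M, TangentSpace 𝓘(ℝ, E) m} {V' : ∀ n : N, TangentSpace 𝓘(ℝ, F) n},
      (∀ᶠ x in 𝓝 m, V' (h x) = mfderiv 𝓘(ℝ, E) 𝓘(ℝ, F) h x (V x)) →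
      ∀ᶠ y in 𝓝 (extChartAt 𝓘(ℝ, E) m m), localRep V' (h m) (chartRep E F h m (h m) y)
        = fderiv ℝ (chartRep E F h m (h m)) y (localRep V m y) := by
    intro V V' hVV'
    filter_upwards [hc (hh.and (hs.and hVV')), extChartAt_target_mem_nhds (I := 𝓘(ℝ, E)) m]
      with y hy hyt
    have := localRep_of_related hy.1 hy.2.1.1 hy.2.1.2 hy.2.2
    rwa [(extChartAt 𝓘(ℝ, E) m).right_inv hyt] at this
  have hf := contDiffAt_chartRep hm (mem_chart_source E m) (mem_chart_source F (h m))
  have h0 : chartRep E F h m (h m) (extChartAt 𝓘(ℝ, E) m m) = extChartAt 𝓘(ℝ, F) (h m) (h m) := by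
    simp only [chartRep, Function.comp_apply, extChartAt_to_inv]
  have := fderiv_lieBracket_of_related (hf.of_le (by norm_cast))
    ((contDiffAt_localRep hV).differentiableAt (by simp))
    ((contDiffAt_localRep hW).differentiableAt (by simp))
    (by rw [h0]; exact (contDiffAt_localRep hV').differentiableAt (by simp))
    (by rw [h0]; exact (contDiffAt_localRep hW').differentiableAt (by simp))
    (key hVV') (key hWW')
  rw [h0] at this
  rw [mlieBracket_eq_lieBracket_localRep, mlieBracket_eq_lieBracket_localRep, ← this,
    mfderiv_eq_fderiv_chart (hm.mdifferentiableAt (by simp))]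
  rfl

end MapsInCharts

/-! ### The Euler-Lagrange equations in natural coordinates -/

section EulerLagrangeChart

variable {E : Type*} [NormedAddCommGroup E] [NormedSpace ℝ E]
  {M : Type*} [TopologicalSpace M] [ChartedSpace E M] [IsManifold 𝓘(ℝ, E) ∞ M]
  {L : TangentBundle 𝓘(ℝ, E) M → ℝ}
  {Γ : ∀ u : TangentBundle 𝓘(ℝ, E) M, TangentSpace 𝓘(ℝ, E).tangent u}

/-- A tangent vector to the tangent bundle at `u`, as a pair of vectors of the model space: its
components in the natural coordinates centred at `u`. -/
def natCoords {u : TangentBundle 𝓘(ℝ, E) M} (W : TangentSpace 𝓘(ℝ, E).tangent u) : E × E := W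

/-- The Euler-Lagrange equations at `u`, in the natural coordinates centred at `u`, where the
tangent space to the tangent bundle at `u` is by definition `E × E`. -/
theorem IsEulerLagrangeField.in_chart (hΓ : IsEulerLagrangeField L Γ)
    (u : TangentBundle 𝓘(ℝ, E) M) :
    (natCoords (Γ u)).1 = (extChartAt 𝓘(ℝ, E).tangent u u).2 ∧
    ∀ e : E, fderiv ℝ (fun z : E × E =>
        fderiv ℝ (fun z => L ((extChartAt 𝓘(ℝ, E).tangent u).symm z)) z (0, e))
          (extChartAt 𝓘(ℝ, E).tangent u u) (natCoords (Γ u))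
      - fderiv ℝ (fun z => L ((extChartAt 𝓘(ℝ, E).tangent u).symm z))
          (extChartAt 𝓘(ℝ, E).tangent u u) (e, 0) = 0 := by
  have h := hΓ.2 u.1 u (mem_chart_source E u.1)
  have h1 : mfderiv 𝓘(ℝ, E).tangent 𝓘(ℝ, E × E)
      (extChartAt 𝓘(ℝ, E).tangent (⟨u.1, 0⟩ : TangentBundle 𝓘(ℝ, E) M)) u
      = ContinuousLinearMap.id ℝ (E × E) := by
    rw [extChartAt_tangent_eq]
    exact mfderiv_extChartAt_self
  simp only [h1] at h
  exact h

theorem contDiffAt_chart_of_contMDiffAt {H : Type*} [NormedAddCommGroup H] [NormedSpace ℝ H]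
    {n : WithTop ℕ∞} [IsManifold 𝓘(ℝ, E).tangent n (TangentBundle 𝓘(ℝ, E) M)]
    {f : TangentBundle 𝓘(ℝ, E) M → H} (u : TangentBundle 𝓘(ℝ, E) M)
    {z : E × E} (hz : z ∈ (extChartAt 𝓘(ℝ, E).tangent u).target)
    (hf : ContMDiffAt 𝓘(ℝ, E).tangent 𝓘(ℝ, H) n f ((extChartAt 𝓘(ℝ, E).tangent u).symm z)) :
    ContDiffAt ℝ n (fun z => f ((extChartAt 𝓘(ℝ, E).tangent u).symm z)) z := by
  have h1 : ContMDiffAt 𝓘(ℝ, E × E) 𝓘(ℝ, E).tangent n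
      (extChartAt 𝓘(ℝ, E).tangent u).symm z :=
    (contMDiffOn_extChartAt_symm u).contMDiffAt ((isOpen_extChartAt_target u).mem_nhds hz)
  exact (hf.comp z h1).contDiffAt

theorem extChartAt_tangent_symm_mk (u : TangentBundle 𝓘(ℝ, E) M) (q : E) :
    (extChartAt 𝓘(ℝ, E).tangent u).symm (extChartAt 𝓘(ℝ, E) u.1 u.1, q)
      = (⟨u.1, q⟩ : TangentBundle 𝓘(ℝ, E) M) := by
  have h0 : extChartAt 𝓘(ℝ, E).tangent u (⟨u.1, q⟩ : TangentBundle 𝓘(ℝ, E) M)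
      = (extChartAt 𝓘(ℝ, E) u.1 u.1, q) :=
    extChartAt_tangent_self (⟨u.1, q⟩ : TangentBundle 𝓘(ℝ, E) M)
  rw [← h0, (extChartAt 𝓘(ℝ, E).tangent u).left_inv]
  rw [mem_extChartAt_tangent_source]
  exact mem_chart_source E u.1

/-- The fibre Hessian is the block `∂²L/∂u∂u` in the natural coordinates centred at `u`. -/
theorem fibreHessian_eq (hL : ContMDiff 𝓘(ℝ, E).tangent 𝓘(ℝ, ℝ) ∞ L)
    (u : TangentBundle 𝓘(ℝ, E) M) (v w : E) :
    fibreHessian L u v w = fderiv ℝ (fun z : E × E =>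
        fderiv ℝ (fun z => L ((extChartAt 𝓘(ℝ, E).tangent u).symm z)) z (0, w))
          (extChartAt 𝓘(ℝ, E).tangent u u) (0, v) := by
  set x := extChartAt 𝓘(ℝ, E) u.1 u.1 with hx
  set L' : E × E → ℝ := fun z => L ((extChartAt 𝓘(ℝ, E).tangent u).symm z) with hL'
  have hLc : ∀ q : E, ContDiffAt ℝ ∞ L' (x, q) := fun q =>
    contDiffAt_chart_of_contMDiffAt u
      ((mem_extChartAt_tangent_target u _).2 (mem_extChartAt_target u.1)) hL.contMDiffAt
  have hr : ∀ q : E, HasFDerivAt (fun q : E => (x, q)) (ContinuousLinearMap.inr ℝ E E) q :=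
    fun q => hasFDerivAt_prodMk_right _ _
  have h1 : ∀ p w : E, fderiv ℝ (fun q : E => L (⟨u.1, q⟩ : TangentBundle 𝓘(ℝ, E) M)) p w
      = fderiv ℝ L' (x, p) (0, w) := fun p w => by
    have h2 : (fun q : E => L (⟨u.1, q⟩ : TangentBundle 𝓘(ℝ, E) M)) = L' ∘ fun q => (x, q) := by
      funext q
      simp only [hL', Function.comp_apply, hx, extChartAt_tangent_symm_mk]
    rw [h2, (HasFDerivAt.comp p ((hLc p).differentiableAt (by simp)).hasFDerivAt (hr p)).fderiv]
    simp
  have hd : DifferentiableAt ℝ (fun z => fderiv ℝ L' z (0, w)) (x, (u.2 : E)) :=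
    (((hLc u.2).fderiv_right (m := ∞) (by simp)).clm_apply contDiffAt_const).differentiableAt
      (by simp)
  unfold fibreHessian
  simp only [h1]
  rw [extChartAt_tangent_self, ← hx]
  have h3 := HasFDerivAt.comp (f := fun q : E => (x, q)) (u.2 : E) hd.hasFDerivAt (hr u.2)
  have h4 := h3.fderiv
  simp only [Function.comp_def] at h4
  rw [h4]
  rfl

end EulerLagrangeChart

/-! ### Invariance of the Euler-Lagrange field -/

section TangentAction

variable {E : Type*} [NormedAddCommGroup E] [NormedSpace ℝ E]
  {M : Type*} [TopologicalSpace M] [ChartedSpace E M] [IsManifold 𝓘(ℝ, E) ∞ M]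
  {G : Type*} [Group G] [MulAction G M]
  (hG : ∀ g : G, ContMDiff 𝓘(ℝ, E) 𝓘(ℝ, E) ∞ (fun m : M => g • m))

include hG

omit [IsManifold 𝓘(ℝ, E) ∞ M] in
theorem tangentAct_mul (g h : G) (u : TangentBundle 𝓘(ℝ, E) M) :
    tangentAct (g * h) u = tangentAct g (tangentAct h u) := by
  unfold tangentAct
  have h1 : (fun m : M => (g * h) • m) = (fun m => g • m) ∘ fun m => h • m := by
    funext m; simp [mul_smul]
  rw [h1, tangentMap_comp_at (I' := 𝓘(ℝ, E))]
  · exact (hG g).mdifferentiable (by simp) _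
  · exact (hG h).mdifferentiable (by simp) _

omit hG [IsManifold 𝓘(ℝ, E) ∞ M] in
theorem tangentAct_one (u : TangentBundle 𝓘(ℝ, E) M) : tangentAct (1 : G) u = u := by
  unfold tangentAct
  have h1 : (fun m : M => (1 : G) • m) = id := by funext m; simp
  rw [h1]
  exact congrFun (tangentMap_id (I := 𝓘(ℝ, E)) (M := M)) u

omit [IsManifold 𝓘(ℝ, E) ∞ M] in
theorem tangentAct_inv_tangentAct (g : G) (u : TangentBundle 𝓘(ℝ, E) M) :
    tangentAct g⁻¹ (tangentAct g u) = u := by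
  rw [← tangentAct_mul hG, inv_mul_cancel, tangentAct_one]

omit [IsManifold 𝓘(ℝ, E) ∞ M] in
theorem tangentAct_tangentAct_inv (g : G) (u : TangentBundle 𝓘(ℝ, E) M) :
    tangentAct g (tangentAct g⁻¹ u) = u := by
  rw [← tangentAct_mul hG, mul_inv_cancel, tangentAct_one]

theorem contMDiff_tangentAct (g : G) : ContMDiff 𝓘(ℝ, E).tangent 𝓘(ℝ, E).tangent ∞
    (tangentAct g : TangentBundle 𝓘(ℝ, E) M → TangentBundle 𝓘(ℝ, E) M) :=
  (hG g).contMDiff_tangentMap (by simp)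

omit [IsManifold 𝓘(ℝ, E) ∞ M] in
/-- The differential of the action of `g` at a point, as a linear equivalence. -/
theorem exists_linearEquiv_mfderiv_smul (g : G) (m : M) :
    ∃ e : TangentSpace 𝓘(ℝ, E) m ≃ₗ[ℝ] TangentSpace 𝓘(ℝ, E) (g • m),
      ∀ v, e v = mfderiv 𝓘(ℝ, E) 𝓘(ℝ, E) (fun m : M => g • m) m v := by
  let A := mfderiv 𝓘(ℝ, E) 𝓘(ℝ, E) (fun m : M => g • m) m
  have hA : Function.Bijective A := by
    constructor
    · intro v w hvw
      have h1 : tangentAct g (⟨m, v⟩ : TangentBundle 𝓘(ℝ, E) M) = tangentAct g ⟨m, w⟩ :=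
        congrArg (fun x => (⟨g • m, x⟩ : TangentBundle 𝓘(ℝ, E) M)) hvw
      have h2 := congrArg (tangentAct g⁻¹) h1
      rw [tangentAct_inv_tangentAct hG, tangentAct_inv_tangentAct hG] at h2
      simpa using h2
    · intro w
      have h1 := tangentAct_tangentAct_inv hG g (⟨g • m, w⟩ : TangentBundle 𝓘(ℝ, E) M)
      have h2 : ∃ v : TangentSpace 𝓘(ℝ, E) m,
          tangentAct g⁻¹ (⟨g • m, w⟩ : TangentBundle 𝓘(ℝ, E) M) = ⟨m, v⟩ := by
        have h3 : (tangentAct g⁻¹ (⟨g • m, w⟩ : TangentBundle 𝓘(ℝ, E) M)).1 = m :=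
          inv_smul_smul g m
        generalize tangentAct g⁻¹ (⟨g • m, w⟩ : TangentBundle 𝓘(ℝ, E) M) = v' at h3
        obtain ⟨m', v'⟩ := v'
        subst h3
        exact ⟨v', rfl⟩
      obtain ⟨v, hv⟩ := h2
      rw [hv] at h1
      refine ⟨v, ?_⟩
      have h3 : (⟨g • m, A v⟩ : TangentBundle 𝓘(ℝ, E) M) = ⟨g • m, w⟩ := h1
      simpa using h3
  exact ⟨LinearEquiv.ofBijective A.toLinearMap hA, fun v => rfl⟩

/-- The action of `g` on the tangent bundle in natural coordinates. -/
theorem tangentAct_in_charts (g : G) (u : TangentBundle 𝓘(ℝ, E) M) :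
    ∀ᶠ z in 𝓝 (extChartAt 𝓘(ℝ, E).tangent u u),
      tangentAct g ((extChartAt 𝓘(ℝ, E).tangent u).symm z)
          ∈ (extChartAt 𝓘(ℝ, E).tangent (tangentAct g u)).source ∧
        extChartAt 𝓘(ℝ, E).tangent (tangentAct g u)
          (tangentAct g ((extChartAt 𝓘(ℝ, E).tangent u).symm z))
        = (chartRep E E (fun m : M => g • m) u.1 (g • u.1) z.1,
            fderiv ℝ (chartRep E E (fun m : M => g • m) u.1 (g • u.1)) z.1 z.2) := by
  have hc : ContinuousAt (fun z => tangentAct g ((extChartAt 𝓘(ℝ, E).tangent u).symm z))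
      (extChartAt 𝓘(ℝ, E).tangent u u) :=
    (contMDiff_tangentAct hG g).continuous.continuousAt.comp (continuousAt_extChartAt_symm u)
  have h1 := hc.preimage_mem_nhds (t := (extChartAt 𝓘(ℝ, E).tangent (tangentAct g u)).source) (by
    rw [extChartAt_to_inv]
    exact extChartAt_source_mem_nhds _)
  filter_upwards [h1, extChartAt_target_mem_nhds (I := 𝓘(ℝ, E).tangent) u] with z hz hz'
  refine ⟨hz, ?_⟩
  refine extChartAt_tangentMap (h := fun m : M => g • m) u (tangentAct g u)
    ((mem_extChartAt_tangent_target u z).1 hz') (hG g).contMDiffAt ?_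
  exact (mem_extChartAt_tangent_source _ _).1 hz

/-- Both `Γ(g u)` and the image of `Γ(u)` are second-order vectors satisfying the Euler-Lagrange
equations at `g u`, so their difference is vertical and in the kernel of the fibre Hessian. -/
theorem IsEulerLagrangeField.invariant {L : TangentBundle 𝓘(ℝ, E) M → ℝ}
    (hL : ContMDiff 𝓘(ℝ, E).tangent 𝓘(ℝ, ℝ) ∞ L) (hLreg : IsRegular L)
    (hLinv : ∀ (g : G) (u : TangentBundle 𝓘(ℝ, E) M), L (tangentAct g u) = L u)
    {Γ : ∀ u : TangentBundle 𝓘(ℝ, E) M, TangentSpace 𝓘(ℝ, E).tangent u}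
    (hΓ : IsEulerLagrangeField L Γ) (g : G) (u : TangentBundle 𝓘(ℝ, E) M) :
    mfderiv 𝓘(ℝ, E).tangent 𝓘(ℝ, E).tangent
      (tangentAct g : TangentBundle 𝓘(ℝ, E) M → TangentBundle 𝓘(ℝ, E) M) u (Γ u)
      = Γ (tangentAct g u) := by
  set u' := tangentAct g u with hu'
  set z := extChartAt 𝓘(ℝ, E).tangent u u with hz
  set f := chartRep E E (fun m : M => g • m) u.1 (g • u.1) with hf
  have hz1 : z.1 = extChartAt 𝓘(ℝ, E) u.1 u.1 := by rw [hz, extChartAt_tangent_self]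
  have hfc : ContDiffAt ℝ ∞ f z.1 := by
    rw [hz1]
    exact contDiffAt_chartRep (hG g).contMDiffAt (mem_chart_source E u.1) (mem_chart_source E _)
  have hT := tangentAct_in_charts hG g u
  have hTz : (f z.1, fderiv ℝ f z.1 z.2) = extChartAt 𝓘(ℝ, E).tangent u' u' := by
    rw [← hT.self_of_nhds.2, extChartAt_to_inv]
  have hTΓ : ∀ W : TangentSpace 𝓘(ℝ, E).tangent u,
      mfderiv 𝓘(ℝ, E).tangent 𝓘(ℝ, E).tangent
      (tangentAct g : TangentBundle 𝓘(ℝ, E) M → TangentBundle 𝓘(ℝ, E) M) u W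
      = fderiv ℝ (fun z : E × E => (f z.1, fderiv ℝ f z.1 z.2)) z W := fun W => by
    rw [mfderiv_eq_fderiv_chart ((contMDiff_tangentAct hG g).mdifferentiable (by simp) u)]
    have h1 : (extChartAt 𝓘(ℝ, E).tangent u' ∘ tangentAct g ∘
      (extChartAt 𝓘(ℝ, E).tangent u).symm) =ᶠ[𝓝 z] fun z => (f z.1, fderiv ℝ f z.1 z.2) :=
      hT.mono fun z h => h.2
    exact DFunLike.congr_fun h1.fderiv_eq W
  obtain ⟨hY, hEL⟩ := hΓ.in_chart u
  obtain ⟨hY', hEL'⟩ := hΓ.in_chart u'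
  set L₁ : E × E → ℝ := fun z => L ((extChartAt 𝓘(ℝ, E).tangent u).symm z) with hL₁
  set L₂ : E × E → ℝ := fun z => L ((extChartAt 𝓘(ℝ, E).tangent u').symm z) with hL₂
  have hL₂c : ContDiffAt ℝ ∞ L₂ (extChartAt 𝓘(ℝ, E).tangent u' u') :=
    contDiffAt_chart_of_contMDiffAt u' (mem_extChartAt_target u') hL.contMDiffAt
  -- invariance of `L`, in the charts at `u` and at `g u`
  have hLL : L₁ =ᶠ[𝓝 z] fun z => L₂ (f z.1, fderiv ℝ f z.1 z.2) := by
    filter_upwards [hT] with z' hz'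
    simp only [hL₁, hL₂]
    rw [← hz'.2, (extChartAt 𝓘(ℝ, E).tangent (tangentAct g u)).left_inv hz'.1, hLinv]
  rw [hTΓ]
  set Y' : E × E :=
    fderiv ℝ (fun z : E × E => (f z.1, fderiv ℝ f z.1 z.2)) z (natCoords (Γ u))
  have hY1 : Y'.1 = (extChartAt 𝓘(ℝ, E).tangent u' u').2 := by
    have h1 := fderiv_tangent (hfc.of_le (by norm_cast)) (natCoords (Γ u)).1
      (natCoords (Γ u)).2
    have h2 : Y'.1 = fderiv ℝ f z.1 (natCoords (Γ u)).1 := congrArg Prod.fst h1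
    rw [h2, hY, ← hTz]
  have hmf : ∀ e, fderiv ℝ f z.1 e = mfderiv 𝓘(ℝ, E) 𝓘(ℝ, E) (fun m : M => g • m) u.1 e :=
    fun e => by
    rw [mfderiv_eq_fderiv_chart ((hG g).mdifferentiable (by simp) u.1), hz1]
    rfl
  obtain ⟨A, hA⟩ := exists_linearEquiv_mfderiv_smul hG g u.1
  -- the Hessian of `L` at `g u` annihilates the difference of the two vectors
  have hEL2 : ∀ e : E, fderiv ℝ (fun z' => fderiv ℝ L₂ z' (0, e))
      (extChartAt 𝓘(ℝ, E).tangent u' u') (Y' - (natCoords (Γ u'))) = 0 := fun e => by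
    obtain ⟨e₀, he₀⟩ := A.surjective e
    rw [hA] at he₀
    have he : fderiv ℝ f z.1 e₀ = e := (hmf e₀).trans he₀
    have h1 := eulerLagrange_tangent (L' := L₂) (hfc.of_le (by norm_cast))
      (by rw [hTz]; exact hL₂c.of_le (by norm_cast)) hLL hY e₀
    rw [he, hTz] at h1
    have h2 := hEL e₀
    have h3 := hEL' e
    have h4 := h1.symm.trans h2
    rw [map_sub, sub_eq_zero]
    rw [sub_eq_zero] at h3 h4
    exact h4.trans h3.symm
  have hD : Y' - (natCoords (Γ u')) = ((0 : E), (Y' - (natCoords (Γ u'))).2) := by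
    refine Prod.ext ?_ rfl
    simp only [Prod.fst_sub]
    rw [hY1, hY', sub_self]
  have h5 := hLreg u' (Y' - (natCoords (Γ u'))).2 fun w => by
    rw [fibreHessian_eq hL, ← hD]
    exact hEL2 w
  rw [h5] at hD
  exact sub_eq_zero.1 hD

end TangentAction

/-! ### Directional derivatives and the orbit projection -/

section Reduction

variable {E : Type*} [NormedAddCommGroup E] [NormedSpace ℝ E]
  {M : Type*} [TopologicalSpace M] [ChartedSpace E M] [IsManifold 𝓘(ℝ, E) ∞ M]

theorem dirDeriv_congr {F F' : TangentBundle 𝓘(ℝ, E) M → ℝ} {u : TangentBundle 𝓘(ℝ, E) M}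
    (h : F =ᶠ[𝓝 u] F') (W : TangentSpace 𝓘(ℝ, E).tangent u) :
    dirDeriv F u W = dirDeriv F' u W := by
  unfold dirDeriv
  exact DFunLike.congr_fun (h.mfderiv_eq) W

theorem contMDiffOn_dirDeriv {F : TangentBundle 𝓘(ℝ, E) M → ℝ}
    {O : Set (TangentBundle 𝓘(ℝ, E) M)} (hO : IsOpen O)
    (hF : ContMDiffOn 𝓘(ℝ, E).tangent 𝓘(ℝ, ℝ) ∞ F O)
    {Γ : ∀ u : TangentBundle 𝓘(ℝ, E) M, TangentSpace 𝓘(ℝ, E).tangent u} (hΓ : IsSmoothField Γ) :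
    ContMDiffOn 𝓘(ℝ, E).tangent 𝓘(ℝ, ℝ) ∞ (fun u => dirDeriv F u (Γ u)) O := by
  have h1 := hF.contMDiffOn_tangentMapWithin (m := ∞) (by simp) hO.uniqueMDiffOn
  have h2 := h1.comp (hΓ.contMDiffOn (s := O)) (fun u hu => hu)
  have h3 := (contMDiff_snd_tangentBundle_modelSpace (n := ∞) ℝ 𝓘(ℝ, ℝ)).comp_contMDiffOn h2
  refine h3.congr fun u hu => ?_
  have h4 : mfderiv 𝓘(ℝ, E).tangent 𝓘(ℝ, ℝ) F u = mfderivWithin 𝓘(ℝ, E).tangent 𝓘(ℝ, ℝ) F O u :=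
    (mfderivWithin_of_isOpen hO hu).symm
  exact DFunLike.congr_fun h4 (Γ u)

theorem dirDeriv_eq_of_contMDiffAt {F : TangentBundle 𝓘(ℝ, E) M → ℝ} {u : TangentBundle 𝓘(ℝ, E) M}
    (hF : ContMDiffAt 𝓘(ℝ, E).tangent 𝓘(ℝ, ℝ) ∞ F u) {F' : E × E →L[ℝ] ℝ}
    (h : HasFDerivAt (fun z => F ((extChartAt 𝓘(ℝ, E).tangent u).symm z)) F'
      (extChartAt 𝓘(ℝ, E).tangent u u)) (W : TangentSpace 𝓘(ℝ, E).tangent u) :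
    dirDeriv F u W = F' (natCoords W) := by
  rw [dirDeriv_eq_fderiv (hF.mdifferentiableAt (by simp)), h.fderiv]
  rfl

theorem hasFDerivAt_chart {F : TangentBundle 𝓘(ℝ, E) M → ℝ} {u : TangentBundle 𝓘(ℝ, E) M}
    (hF : ContMDiffAt 𝓘(ℝ, E).tangent 𝓘(ℝ, ℝ) ∞ F u) :
    HasFDerivAt (fun z => F ((extChartAt 𝓘(ℝ, E).tangent u).symm z))
      (fderiv ℝ (fun z => F ((extChartAt 𝓘(ℝ, E).tangent u).symm z))
        (extChartAt 𝓘(ℝ, E).tangent u u)) (extChartAt 𝓘(ℝ, E).tangent u u) :=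
  ((contDiffAt_chart_of_contMDiffAt u (mem_extChartAt_target u)
    (by rwa [extChartAt_to_inv])).differentiableAt (by simp)).hasFDerivAt

section Algebra

variable {F F' : TangentBundle 𝓘(ℝ, E) M → ℝ} {u : TangentBundle 𝓘(ℝ, E) M}
  (hF : ContMDiffAt 𝓘(ℝ, E).tangent 𝓘(ℝ, ℝ) ∞ F u)
  (hF' : ContMDiffAt 𝓘(ℝ, E).tangent 𝓘(ℝ, ℝ) ∞ F' u)
  (W : TangentSpace 𝓘(ℝ, E).tangent u)

include hF

theorem dirDeriv_const_mul (r : ℝ) :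
    dirDeriv (fun u => r * F u) u W = r * dirDeriv F u W := by
  have h := hasFDerivAt_chart hF
  rw [dirDeriv_eq_of_contMDiffAt (F := fun u => r * F u) (contMDiffAt_const.mul hF) (h.const_mul r),
    dirDeriv_eq_of_contMDiffAt hF h]
  rfl

include hF'

theorem dirDeriv_add :
    dirDeriv (fun u => F u + F' u) u W = dirDeriv F u W + dirDeriv F' u W := by
  have h := hasFDerivAt_chart hF
  have h' := hasFDerivAt_chart hF'
  rw [dirDeriv_eq_of_contMDiffAt (F := fun u => F u + F' u) (hF.add hF') (h.add h'),
    dirDeriv_eq_of_contMDiffAt hF h, dirDeriv_eq_of_contMDiffAt hF' h']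
  rfl

theorem dirDeriv_mul :
    dirDeriv (fun u => F u * F' u) u W = F u * dirDeriv F' u W + F' u * dirDeriv F u W := by
  have h := hasFDerivAt_chart hF
  have h' := hasFDerivAt_chart hF'
  rw [dirDeriv_eq_of_contMDiffAt (F := fun u => F u * F' u) (hF.mul hF') (h.mul h'),
    dirDeriv_eq_of_contMDiffAt hF h, dirDeriv_eq_of_contMDiffAt hF' h', extChartAt_to_inv]
  rfl

end Algebra

variable {G : Type*} [Group G] [MulAction G M]
  (hG : ∀ g : G, ContMDiff 𝓘(ℝ, E) 𝓘(ℝ, E) ∞ (fun m : M => g • m))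

omit [IsManifold 𝓘(ℝ, E) ∞ M] in
theorem proj_surjective : Function.Surjective (proj (E := E) (M := M) G) := Quot.mk_surjective

theorem continuous_proj : Continuous (proj (E := E) (M := M) G) := continuous_quot_mk

omit [IsManifold 𝓘(ℝ, E) ∞ M] in
theorem proj_tangentAct (g : G) (u : TangentBundle 𝓘(ℝ, E) M) :
    proj G (tangentAct g u) = proj G u := (Quot.sound ⟨g, rfl⟩).symm

include hG

omit [IsManifold 𝓘(ℝ, E) ∞ M] in
/-- The relation defining `TM/G` is an equivalence relation, `G` acting on the tangent bundle. -/
theorem proj_eq_proj_iff {u u' : TangentBundle 𝓘(ℝ, E) M} :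
    proj G u = proj G u' ↔ ∃ g : G, tangentAct g u = u' := by
  constructor
  · intro h
    have h1 := Quot.eqvGen_exact h
    clear h
    induction h1 with
    | rel _ _ h => exact h
    | refl u => exact ⟨1, tangentAct_one u⟩
    | symm u u' _ ih =>
      obtain ⟨g, rfl⟩ := ih
      exact ⟨g⁻¹, tangentAct_inv_tangentAct hG g u⟩
    | trans u u' u'' h1 h2 ih1 ih2 =>
      obtain ⟨g, rfl⟩ := ih1
      obtain ⟨g', rfl⟩ := ih2
      exact ⟨g' * g, tangentAct_mul hG g' g u⟩
  · rintro ⟨g, rfl⟩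
    exact (proj_tangentAct g u).symm

/-- The saturation of an open set is the union of its translates. -/
theorem isOpenMap_proj : IsOpenMap (proj (E := E) (M := M) G) := by
  intro O hO
  refine isOpen_coinduced.2 ?_
  have h1 : proj (E := E) (M := M) G ⁻¹' (proj G '' O) = ⋃ g : G, tangentAct g ⁻¹' O := by
    ext u
    simp only [mem_preimage, mem_image, mem_iUnion]
    constructor
    · rintro ⟨u', hu', h⟩
      obtain ⟨g, rfl⟩ := (proj_eq_proj_iff hG).1 h.symm
      exact ⟨g, hu'⟩
    · rintro ⟨g, hg⟩
      exact ⟨_, hg, proj_tangentAct g u⟩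
  change IsOpen (proj (E := E) (M := M) G ⁻¹' (proj G '' O))
  rw [h1]
  exact isOpen_iUnion fun g => hO.preimage (contMDiff_tangentAct hG g).continuous

/-- The derivative along a transported vector is the derivative of the pulled back function. -/
theorem dirDeriv_tangentAct {F F' : TangentBundle 𝓘(ℝ, E) M → ℝ} {g : G}
    {u : TangentBundle 𝓘(ℝ, E) M}
    (hF : MDifferentiableAt 𝓘(ℝ, E).tangent 𝓘(ℝ, ℝ) F (tangentAct g u))
    (h : F ∘ tangentAct g =ᶠ[𝓝 u] F') (W : TangentSpace 𝓘(ℝ, E).tangent u) :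
    dirDeriv F (tangentAct g u) (mfderiv 𝓘(ℝ, E).tangent 𝓘(ℝ, E).tangent
      (tangentAct g : TangentBundle 𝓘(ℝ, E) M → TangentBundle 𝓘(ℝ, E) M) u W)
      = dirDeriv F' u W := by
  rw [← dirDeriv_congr h]
  unfold dirDeriv
  rw [mfderiv_comp u hF ((contMDiff_tangentAct hG g).mdifferentiable (by simp) u)]
  rfl

end Reduction

/-! ### Projection of an invariant vector field -/

section ReducedField

variable {E : Type*} [NormedAddCommGroup E] [NormedSpace ℝ E]
  {M : Type*} [TopologicalSpace M] [ChartedSpace E M] [IsManifold 𝓘(ℝ, E) ∞ M]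
  {G : Type*} [Group G] [MulAction G M]

theorem SmoothOnRed.contMDiffAt {f : RedTangent E M G → ℝ} {W : Set (RedTangent E M G)}
    (hW : IsOpen W) (hf : SmoothOnRed f W) {u : TangentBundle 𝓘(ℝ, E) M} (hu : proj G u ∈ W) :
    ContMDiffAt 𝓘(ℝ, E).tangent 𝓘(ℝ, ℝ) ∞ (fun u => f (proj G u)) u :=
  ContMDiffOn.contMDiffAt hf ((hW.preimage continuous_proj).mem_nhds hu)

theorem SmoothNearRed.contMDiffAt {f : RedTangent E M G → ℝ} {u : TangentBundle 𝓘(ℝ, E) M}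
    (hf : SmoothNearRed f (proj G u)) :
    ContMDiffAt 𝓘(ℝ, E).tangent 𝓘(ℝ, ℝ) ∞ (fun u => f (proj G u)) u := by
  obtain ⟨W, hW, hu, h⟩ := hf
  exact h.contMDiffAt hW hu

/-- A smooth function of two functions smooth near `q` is smooth near `q`; used for sums,
multiples and products. -/
theorem SmoothNearRed.comp₂ {f f' : RedTangent E M G → ℝ} {q : RedTangent E M G}
    {φ : ℝ → ℝ → ℝ} (hφ : ContDiff ℝ ∞ (fun p : ℝ × ℝ => φ p.1 p.2))
    (hf : SmoothNearRed f q) (hf' : SmoothNearRed f' q) :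
    SmoothNearRed (fun p => φ (f p) (f' p)) q := by
  obtain ⟨W, hW, hu, h⟩ := hf
  obtain ⟨W', hW', hu', h'⟩ := hf'
  refine ⟨W ∩ W', hW.inter hW', ⟨hu, hu'⟩, ?_⟩
  have h1 : ContMDiffOn 𝓘(ℝ, E).tangent 𝓘(ℝ, ℝ × ℝ) ∞
      (fun u => (f (proj G u), f' (proj G u))) (proj G ⁻¹' (W ∩ W')) :=
    (ContMDiffOn.mono h fun u hu => hu.1).prodMk_space (ContMDiffOn.mono h' fun u hu => hu.2)
  exact hφ.contMDiff.comp_contMDiffOn h1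

theorem SmoothNearRed.congr {f f' : RedTangent E M G → ℝ} {q : RedTangent E M G}
    (hf : SmoothNearRed f q) (h : f =ᶠ[𝓝 q] f') : SmoothNearRed f' q := by
  obtain ⟨W, hW, hu, hs⟩ := hf
  obtain ⟨W', hW's, hW', hu'⟩ := mem_nhds_iff.1 h
  refine ⟨W ∩ W', hW.inter hW', ⟨hu, hu'⟩, ?_⟩
  exact (ContMDiffOn.mono hs fun u hu => hu.1).congr fun u hu => (hW's hu.2).symm

open Classical in
/-- The derivative of `f` at `q` along the projection of an invariant field `Γ`, computed at a
representative of `q`. -/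
noncomputable def projectedDeriv
    (Γ : ∀ u : TangentBundle 𝓘(ℝ, E) M, TangentSpace 𝓘(ℝ, E).tangent u)
    (f : RedTangent E M G → ℝ) (q : RedTangent E M G) : ℝ :=
  if SmoothNearRed f q then dirDeriv (fun u => f (proj G u)) (Quot.out q) (Γ (Quot.out q)) else 0

/-- For an invariant field, the derivative may be computed at any representative of the orbit. -/
theorem projectedDeriv_proj
    (hG : ∀ g : G, ContMDiff 𝓘(ℝ, E) 𝓘(ℝ, E) ∞ (fun m : M => g • m))
    {Γ : ∀ u : TangentBundle 𝓘(ℝ, E) M, TangentSpace 𝓘(ℝ, E).tangent u}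
    (hΓ : ∀ (g : G) (u : TangentBundle 𝓘(ℝ, E) M),
      mfderiv 𝓘(ℝ, E).tangent 𝓘(ℝ, E).tangent
        (tangentAct g : TangentBundle 𝓘(ℝ, E) M → TangentBundle 𝓘(ℝ, E) M) u (Γ u)
        = Γ (tangentAct g u))
    {f : RedTangent E M G → ℝ} {u : TangentBundle 𝓘(ℝ, E) M} (hf : SmoothNearRed f (proj G u)) :
    projectedDeriv Γ f (proj G u) = dirDeriv (fun u => f (proj G u)) u (Γ u) := by
  unfold projectedDeriv
  rw [if_pos hf]
  have h1 : proj G (Quot.out (proj G u)) = proj G u := Quot.out_eq _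
  generalize Quot.out (proj G u) = u' at h1
  obtain ⟨g, rfl⟩ := (proj_eq_proj_iff hG).1 h1.symm
  rw [← hΓ]
  refine dirDeriv_tangentAct hG ?_ (.of_forall fun v => ?_) _
  · exact (SmoothNearRed.contMDiffAt (by rwa [proj_tangentAct])).mdifferentiableAt (by simp)
  · simp [proj_tangentAct]

/-- The projection to `TM/G` of an invariant vector field on the tangent bundle. -/
noncomputable def projectedField
    (hG : ∀ g : G, ContMDiff 𝓘(ℝ, E) 𝓘(ℝ, E) ∞ (fun m : M => g • m))
    {Γ : ∀ u : TangentBundle 𝓘(ℝ, E) M, TangentSpace 𝓘(ℝ, E).tangent u} (hs : IsSmoothField Γ)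
    (hΓ : ∀ (g : G) (u : TangentBundle 𝓘(ℝ, E) M),
      mfderiv 𝓘(ℝ, E).tangent 𝓘(ℝ, E).tangent
        (tangentAct g : TangentBundle 𝓘(ℝ, E) M → TangentBundle 𝓘(ℝ, E) M) u (Γ u)
        = Γ (tangentAct g u)) : RedVectorField E M G where
  toFun := projectedDeriv Γ
  congr_germ f f' q h := by
    by_cases hf : SmoothNearRed f q
    · obtain ⟨u, rfl⟩ := proj_surjective q
      rw [projectedDeriv_proj hG hΓ hf, projectedDeriv_proj hG hΓ (hf.congr h)]
      exact dirDeriv_congr (continuous_proj.continuousAt.eventually h) _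
    · have hf' : ¬ SmoothNearRed f' q := fun hf' => hf (hf'.congr h.symm)
      simp [projectedDeriv, hf, hf']
  map_add f f' q hf hf' := by
    obtain ⟨u, rfl⟩ := proj_surjective q
    rw [projectedDeriv_proj hG hΓ hf, projectedDeriv_proj hG hΓ hf',
      projectedDeriv_proj hG hΓ (hf.comp₂ (φ := fun a b => a + b) (by fun_prop) hf')]
    rw [dirDeriv_add hf.contMDiffAt hf'.contMDiffAt]
  map_smul r f q hf := by
    obtain ⟨u, rfl⟩ := proj_surjective q
    rw [projectedDeriv_proj hG hΓ hf,
      projectedDeriv_proj hG hΓ (hf.comp₂ (φ := fun a b => r * a) (by fun_prop) hf)]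
    rw [dirDeriv_const_mul hf.contMDiffAt]
  leibniz f f' q hf hf' := by
    obtain ⟨u, rfl⟩ := proj_surjective q
    rw [projectedDeriv_proj hG hΓ hf, projectedDeriv_proj hG hΓ hf',
      projectedDeriv_proj hG hΓ (hf.comp₂ (φ := fun a b => a * b) (by fun_prop) hf')]
    rw [dirDeriv_mul hf.contMDiffAt hf'.contMDiffAt]
  smooth f W hW hf := by
    refine (contMDiffOn_dirDeriv (hW.preimage continuous_proj) hf hs).congr fun u hu => ?_
    exact projectedDeriv_proj hG hΓ ⟨W, hW, hu, hf⟩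
  eq_zero f q hf := by simp [projectedDeriv, hf]

/-- A vector field on `TM/G` is determined by its action on functions, and `TM → TM/G` is onto. -/
theorem IsProjection.unique
    {Γ : ∀ u : TangentBundle 𝓘(ℝ, E) M, TangentSpace 𝓘(ℝ, E).tangent u}
    {Y Y' : RedVectorField E M G} (hY : IsProjection Γ Y) (hY' : IsProjection Γ Y') : Y' = Y := by
  have h : Y'.toFun = Y.toFun := by
    funext f q
    by_cases hf : SmoothNearRed f q
    · obtain ⟨u, rfl⟩ := proj_surjective q
      rw [hY u f hf, hY' u f hf]
    · rw [Y.eq_zero f q hf, Y'.eq_zero f q hf]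
  cases Y; cases Y'
  simpa using h

end ReducedField

/-! ### Smoothness of partial derivatives of maps of manifolds -/

section PartialDerivative

variable {E : Type*} [NormedAddCommGroup E] [NormedSpace ℝ E]
  {M : Type*} [TopologicalSpace M] [ChartedSpace E M] [IsManifold 𝓘(ℝ, E) ∞ M]
  {F : Type*} [NormedAddCommGroup F] [NormedSpace ℝ F]
  {P : Type*} [TopologicalSpace P] [ChartedSpace F P] [IsManifold 𝓘(ℝ, F) ∞ P]
  {H : Type*} [NormedAddCommGroup H] [NormedSpace ℝ H]
  {N : Type*} [TopologicalSpace N] [ChartedSpace H N] [IsManifold 𝓘(ℝ, H) ∞ N]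

/-- The derivative of a smooth family of maps `p ↦ Ψ(n, p)` along a fixed tangent vector depends
smoothly on the parameter `n`. -/
theorem contMDiffAt_mfderiv_family {Ψ : N → P → M} {n₀ : N} {p₀ : P} (ξ : F)
    (hΨ : ContMDiffAt (𝓘(ℝ, H).prod 𝓘(ℝ, F)) 𝓘(ℝ, E) ∞ (Function.uncurry Ψ) (n₀, p₀))
    {σ : N → M} (hσ : ∀ᶠ n in 𝓝 n₀, σ n = Ψ n p₀)
    {V : ∀ n, TangentSpace 𝓘(ℝ, E) (σ n)}
    (hV : ∀ᶠ n in 𝓝 n₀, (V n : E) = mfderiv 𝓘(ℝ, F) 𝓘(ℝ, E) (Ψ n) p₀ ξ) :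
    ContMDiffAt 𝓘(ℝ, H) 𝓘(ℝ, E).tangent ∞
      (fun n => (⟨σ n, V n⟩ : TangentBundle 𝓘(ℝ, E) M)) n₀ := by
  have h0 : ContMDiffAt 𝓘(ℝ, H) 𝓘(ℝ, E).tangent ∞ (fun n => (⟨Ψ n p₀,
      (mfderiv 𝓘(ℝ, F) 𝓘(ℝ, E) (Ψ n) p₀ ξ)⟩ : TangentBundle 𝓘(ℝ, E) M)) n₀ := by
    have h1 : ContMDiffAt 𝓘(ℝ, H) 𝓘(ℝ, E) ∞ (fun n => Ψ n p₀) n₀ :=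
      ContMDiffAt.comp n₀ (g := Function.uncurry Ψ) (f := fun n => (n, p₀)) hΨ
        (contMDiffAt_id.prodMk contMDiffAt_const)
    have h2 : ContMDiffAt 𝓘(ℝ, H) 𝓘(ℝ, F →L[ℝ] E) ∞ (inTangentCoordinates 𝓘(ℝ, F) 𝓘(ℝ, E)
        (fun _ => p₀) (fun n => Ψ n p₀) (fun n => mfderiv 𝓘(ℝ, F) 𝓘(ℝ, E) (Ψ n) p₀) n₀) n₀ :=
      ContMDiffAt.mfderiv (m := ∞) Ψ (fun _ => p₀) hΨ contMDiffAt_const (by simp)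
    have h3 : ContMDiffAt 𝓘(ℝ, H) 𝓘(ℝ, F) ∞ (fun _ : N => ξ) n₀ := contMDiffAt_const
    rw [Bundle.contMDiffAt_totalSpace]
    refine ⟨h1, (h2.clm_apply h3).congr_of_eventuallyEq ?_⟩
    have h4 := h1.continuousAt.eventually
      ((chartAt E (Ψ n₀ p₀)).open_source.mem_nhds (mem_chart_source E (Ψ n₀ p₀)))
    filter_upwards [h4] with n hn
    have h5 := inTangentCoordinates_eq (I := 𝓘(ℝ, F)) (I' := 𝓘(ℝ, E)) (fun _ : N => p₀)
      (fun n => Ψ n p₀) (fun n => mfderiv 𝓘(ℝ, F) 𝓘(ℝ, E) (Ψ n) p₀) (x₀ := n₀) (x := n)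
      (mem_chart_source F p₀) hn
    refine Eq.trans ?_ (congrArg (fun A : F →L[ℝ] E => A ξ) h5).symm
    -- the base point of the domain does not move, so its coordinate change is the identity
    have h6 := (tangentBundleCore 𝓘(ℝ, F) P).coordChange_self (achart F p₀) p₀
      (mem_chart_source F p₀) ξ
    change _ = (tangentBundleCore 𝓘(ℝ, E) M).coordChange _ _ _
      (mfderiv 𝓘(ℝ, F) 𝓘(ℝ, E) (Ψ n) p₀
        ((tangentBundleCore 𝓘(ℝ, F) P).coordChange (achart F p₀) (achart F p₀) p₀ ξ))
    rw [h6]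
    rfl
  refine h0.congr_of_eventuallyEq ?_
  filter_upwards [hσ, hV] with n h1 h2
  have h3 : ∀ (a b : M) (v w : E), a = b → v = w →
      (⟨a, v⟩ : TangentBundle 𝓘(ℝ, E) M) = ⟨b, w⟩ := by
    rintro a b v w rfl rfl; rfl
  exact h3 _ _ _ _ h1 h2

end PartialDerivative

/-! ### The adjoint representation and fundamental fields -/

theorem contMDiff_action (F : Type*) {E M G : Type*} [NormedAddCommGroup E] [NormedSpace ℝ E]
    [TopologicalSpace M] [ChartedSpace E M] [NormedAddCommGroup F] [NormedSpace ℝ F]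
    [TopologicalSpace G] [ChartedSpace F G] [Group G] [MulAction G M]
    [ContMDiffSMul 𝓘(ℝ, F) 𝓘(ℝ, E) ∞ G M] (g : G) :
    ContMDiff 𝓘(ℝ, E) 𝓘(ℝ, E) ∞ (fun m : M => g • m) :=
  ContMDiffSMul.contMDiff_const_smul (I := 𝓘(ℝ, F)) g

section FundamentalFields

variable {E : Type*} [NormedAddCommGroup E] [NormedSpace ℝ E]
  {M : Type*} [TopologicalSpace M] [ChartedSpace E M] [IsManifold 𝓘(ℝ, E) ∞ M]
  {F : Type*} [NormedAddCommGroup F] [NormedSpace ℝ F]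
  {G : Type*} [TopologicalSpace G] [ChartedSpace F G] [Group G] [LieGroup 𝓘(ℝ, F) ∞ G]
  [MulAction G M]

section Ad

variable {M : Type*} [TopologicalSpace M] [ChartedSpace E M]

theorem contMDiff_conj (g : G) : ContMDiff 𝓘(ℝ, F) 𝓘(ℝ, F) ∞ (fun h : G => g * h * g⁻¹) :=
  (contMDiff_const.mul contMDiff_id).mul contMDiff_const

theorem Ad_mul (g h : G) (ξ : GroupLieAlgebra 𝓘(ℝ, F) G) : Ad (g * h) ξ = Ad g (Ad h ξ) := by
  unfold Ad
  have h1 : (fun k : G => g * h * k * (g * h)⁻¹)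
      = (fun k => g * k * g⁻¹) ∘ fun k => h * k * h⁻¹ := by
    funext k; simp [mul_assoc]
  rw [h1]
  exact mfderiv_comp_apply_of_eq 1 ((contMDiff_conj g).mdifferentiable (by simp) _)
    ((contMDiff_conj h).mdifferentiable (by simp) _) (by simp) ξ

omit [LieGroup 𝓘(ℝ, F) ∞ G] in
theorem Ad_one (ξ : GroupLieAlgebra 𝓘(ℝ, F) G) : Ad (1 : G) ξ = ξ := by
  unfold Ad
  have h1 : (fun k : G => 1 * k * (1 : G)⁻¹) = id := by funext k; simp
  rw [h1]
  exact DFunLike.congr_fun (mfderiv_id (I := 𝓘(ℝ, F)) (M := G)) ξ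

theorem Ad_inv_Ad (g : G) (ξ : GroupLieAlgebra 𝓘(ℝ, F) G) : Ad g⁻¹ (Ad g ξ) = ξ := by
  rw [← Ad_mul, inv_mul_cancel, Ad_one]

theorem Ad_Ad_inv (g : G) (ξ : GroupLieAlgebra 𝓘(ℝ, F) G) : Ad g (Ad g⁻¹ ξ) = ξ := by
  rw [← Ad_mul, mul_inv_cancel, Ad_one]

/-- The adjoint representation of `g` as a linear map. -/
noncomputable def adLinear (g : G) :
    GroupLieAlgebra 𝓘(ℝ, F) G →ₗ[ℝ] GroupLieAlgebra 𝓘(ℝ, F) G where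
  toFun := Ad g
  map_add' ξ η := map_add (mfderiv 𝓘(ℝ, F) 𝓘(ℝ, F) (fun h : G => g * h * g⁻¹) 1) ξ η
  map_smul' r ξ := map_smul (mfderiv 𝓘(ℝ, F) 𝓘(ℝ, F) (fun h : G => g * h * g⁻¹) 1) r ξ

end Ad

/-- The fundamental vector field at `m`, as a linear map of the Lie algebra. -/
noncomputable def fundamentalLinear (m : M) :
    GroupLieAlgebra 𝓘(ℝ, F) G →ₗ[ℝ] TangentSpace 𝓘(ℝ, E) m where
  toFun ξ := fundamentalField ξ m
  map_add' ξ η := map_add (mfderiv 𝓘(ℝ, F) 𝓘(ℝ, E) (fun g : G => g • m) 1) ξ η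
  map_smul' r ξ := map_smul (mfderiv 𝓘(ℝ, F) 𝓘(ℝ, E) (fun g : G => g • m) 1) r ξ

variable [ContMDiffSMul 𝓘(ℝ, F) 𝓘(ℝ, E) ∞ G M]

omit [IsManifold 𝓘(ℝ, E) ∞ M] [LieGroup 𝓘(ℝ, F) ∞ G] in
theorem contMDiff_orbit (m : M) : ContMDiff 𝓘(ℝ, F) 𝓘(ℝ, E) ∞ (fun h : G => h • m) :=
  contMDiff_id.smul contMDiff_const

omit [IsManifold 𝓘(ℝ, E) ∞ M] in
/-- The fundamental field of `Ad_g ξ` is the velocity of `h ↦ (g h g⁻¹) m`, so that `Ad` need not be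
differentiated separately. -/
theorem mfderiv_conj_smul (g : G) (m : M) (ξ : GroupLieAlgebra 𝓘(ℝ, F) G) :
    (mfderiv 𝓘(ℝ, F) 𝓘(ℝ, E) (fun h : G => (g * h * g⁻¹) • m) 1 ξ : E)
      = fundamentalField (Ad g ξ) m :=
  mfderiv_comp_apply_of_eq (g := fun h : G => h • m) (f := fun h : G => g * h * g⁻¹) 1
    ((contMDiff_orbit m).mdifferentiable (by simp) _)
    ((contMDiff_conj g).mdifferentiable (by simp) _) (by simp) ξ

omit [IsManifold 𝓘(ℝ, E) ∞ M] in
/-- The action maps the fundamental field of `ξ` to that of `Ad_g ξ`. -/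
theorem mfderiv_smul_fundamentalField (g : G) (m : M) (ξ : GroupLieAlgebra 𝓘(ℝ, F) G) :
    mfderiv 𝓘(ℝ, E) 𝓘(ℝ, E) (fun m : M => g • m) m (fundamentalField ξ m)
      = fundamentalField (Ad g ξ) (g • m) := by
  refine Eq.trans ?_ (mfderiv_conj_smul g (g • m) ξ)
  have h1 : (fun h : G => (g * h * g⁻¹) • g • m) = (fun m : M => g • m) ∘ fun h : G => h • m := by
    funext h; simp [mul_smul]
  rw [h1]
  exact (mfderiv_comp_apply_of_eq 1 ((contMDiff_action F g).mdifferentiable (by simp) m)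
    ((contMDiff_orbit m).mdifferentiable (by simp) _) (by simp) ξ).symm

theorem contMDiff_fundamentalField (ξ : GroupLieAlgebra 𝓘(ℝ, F) G) :
    ContMDiff 𝓘(ℝ, E) 𝓘(ℝ, E).tangent ∞
      (fun m => (⟨m, fundamentalField ξ m⟩ : TangentBundle 𝓘(ℝ, E) M)) := fun m => by
  refine contMDiffAt_mfderiv_family (F := F) (Ψ := fun (m : M) (h : G) => h • m)
    (p₀ := (1 : G)) ξ ?_ (.of_forall fun n => (one_smul G n).symm) (.of_forall fun n => rfl)
  exact (contMDiff_snd.smul contMDiff_fst).contMDiffAt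

/-- Left-invariant vector fields of a smooth Lie group are smooth. -/
theorem contMDiff_mulInvariant (ξ : GroupLieAlgebra 𝓘(ℝ, F) G) :
    ContMDiff 𝓘(ℝ, F) 𝓘(ℝ, F).tangent ∞
      (fun g : G => (⟨g, mulInvariantVectorField ξ g⟩ : TangentBundle 𝓘(ℝ, F) G)) := fun g => by
  refine contMDiffAt_mfderiv_family (F := F) (Ψ := fun (g : G) (h : G) => g * h)
    (p₀ := (1 : G)) ξ ?_ (.of_forall fun n => (mul_one n).symm) (.of_forall fun n => rfl)
  exact (contMDiff_fst.mul contMDiff_snd).contMDiffAt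

end FundamentalFields

/-! ### Coordinate fields in an equivariant trivialization -/

section Trivialization

variable {E : Type*} [NormedAddCommGroup E] [NormedSpace ℝ E]
  {M : Type*} [TopologicalSpace M] [ChartedSpace E M] [IsManifold 𝓘(ℝ, E) ∞ M]
  {F : Type*} [NormedAddCommGroup F] [NormedSpace ℝ F]
  {G : Type*} [TopologicalSpace G] [ChartedSpace F G] [Group G] [LieGroup 𝓘(ℝ, F) ∞ G]
  [MulAction G M] [ContMDiffSMul 𝓘(ℝ, F) 𝓘(ℝ, E) ∞ G M]
  {ι : Type*} [Fintype ι] (T : CoordTrivialization E M F G ι)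

namespace CoordTrivialization

section Basic

omit [IsManifold 𝓘(ℝ, E) ∞ M] [LieGroup 𝓘(ℝ, F) ∞ G] [ContMDiffSMul 𝓘(ℝ, F) 𝓘(ℝ, E) ∞ G M]

theorem mem_target_iff (p : (ι → ℝ) × G) : p ∈ T.toHomeo.target ↔ p.1 ∈ T.base := by
  simp [T.target_eq]

theorem isOpen_base : IsOpen T.base := by
  have h1 : T.base = (fun y => (y, (1 : G))) ⁻¹' T.toHomeo.target := by
    ext y; simp [T.mem_target_iff]
  rw [h1]
  exact T.toHomeo.open_target.preimage (by fun_prop)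

theorem fst_mem_base {m : M} (hm : m ∈ T.toHomeo.source) : (T.toHomeo m).1 ∈ T.base :=
  (T.mem_target_iff _).1 (T.toHomeo.map_source hm)

/-- The inverse of the trivialization is equivariant. -/
theorem smul_symm {y : ι → ℝ} (hy : y ∈ T.base) (g h : G) :
    g • T.toHomeo.symm (y, h) = T.toHomeo.symm (y, g * h) := by
  have h1 : T.toHomeo.symm (y, h) ∈ T.toHomeo.source :=
    T.toHomeo.map_target ((T.mem_target_iff _).2 hy)
  have h2 := T.equivariant g _ h1
  rw [T.toHomeo.right_inv ((T.mem_target_iff _).2 hy)] at h2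
  rw [← h2, T.toHomeo.left_inv (T.smul_mem g _ h1)]

theorem contMDiffAt_symm {p : (ι → ℝ) × G} (hp : p.1 ∈ T.base) :
    ContMDiffAt (𝓘(ℝ, ι → ℝ).prod 𝓘(ℝ, F)) 𝓘(ℝ, E) ∞ T.toHomeo.symm p :=
  T.contMDiffOn_symm.contMDiffAt (T.toHomeo.open_target.mem_nhds ((T.mem_target_iff _).2 hp))

theorem contMDiffAt_toHomeo {m : M} (hm : m ∈ T.toHomeo.source) :
    ContMDiffAt 𝓘(ℝ, E) (𝓘(ℝ, ι → ℝ).prod 𝓘(ℝ, F)) ∞ T.toHomeo m :=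
  T.contMDiffOn_toHomeo.contMDiffAt (T.toHomeo.open_source.mem_nhds hm)

theorem contMDiffAt_baseCoord {m : M} (hm : m ∈ T.toHomeo.source) :
    ContMDiffAt 𝓘(ℝ, E) 𝓘(ℝ, ι → ℝ) ∞ (fun m => (T.toHomeo m).1) m :=
  ContMDiffAt.comp m contMDiff_fst.contMDiffAt (T.contMDiffAt_toHomeo hm)

theorem contMDiffAt_groupCoord {m : M} (hm : m ∈ T.toHomeo.source) :
    ContMDiffAt 𝓘(ℝ, E) 𝓘(ℝ, F) ∞ (fun m => (T.toHomeo m).2) m :=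
  ContMDiffAt.comp m contMDiff_snd.contMDiffAt (T.contMDiffAt_toHomeo hm)

end Basic

/-- The derivative at `m` of the coordinates `(x^i)` of the base. -/
noncomputable def dx (m : M) : TangentSpace 𝓘(ℝ, E) m →L[ℝ] (ι → ℝ) :=
  mfderiv 𝓘(ℝ, E) 𝓘(ℝ, ι → ℝ) (fun m => (T.toHomeo m).1) m

omit [IsManifold 𝓘(ℝ, E) ∞ M] [LieGroup 𝓘(ℝ, F) ∞ G] in
/-- The coordinates of the base are constant along orbits. -/
theorem dx_fundamentalField {m : M} (hm : m ∈ T.toHomeo.source) (ξ : GroupLieAlgebra 𝓘(ℝ, F) G) :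
    T.dx m (fundamentalField ξ m) = 0 := by
  have h1 : (fun m => (T.toHomeo m).1) ∘ (fun g : G => g • m) = fun _ => (T.toHomeo m).1 := by
    funext g
    simp [T.equivariant g m hm]
  have h2 := mfderiv_comp_apply_of_eq (I := 𝓘(ℝ, F)) (I' := 𝓘(ℝ, E)) (I'' := 𝓘(ℝ, ι → ℝ))
    (g := fun m => (T.toHomeo m).1) (f := fun g : G => g • m) 1
    ((T.contMDiffAt_baseCoord hm).mdifferentiableAt (by simp))
    ((contMDiff_orbit m).mdifferentiable (by simp) _) (one_smul G m) ξ
  rw [h1, mfderiv_const] at h2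
  exact h2.symm

omit [IsManifold 𝓘(ℝ, E) ∞ M] [LieGroup 𝓘(ℝ, F) ∞ G] [ContMDiffSMul 𝓘(ℝ, F) 𝓘(ℝ, E) ∞ G M] in
/-- The chain rule for curves and maps `n ↦ (a(n), β(n))` written in the trivialization. -/
theorem mfderiv_symm_comp {H N : Type*} [NormedAddCommGroup H] [NormedSpace ℝ H]
    [TopologicalSpace N] [ChartedSpace H N] {a : N → ι → ℝ} {β : N → G} {n : N}
    (ha : MDifferentiableAt 𝓘(ℝ, H) 𝓘(ℝ, ι → ℝ) a n) (hβ : MDifferentiableAt 𝓘(ℝ, H) 𝓘(ℝ, F) β n)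
    {p : (ι → ℝ) × G} (hp : p.1 ∈ T.base) (hap : a n = p.1) (hbp : β n = p.2) (w : H) :
    (mfderiv 𝓘(ℝ, H) 𝓘(ℝ, E) (fun n => T.toHomeo.symm (a n, β n)) n w : E)
      = mfderiv (𝓘(ℝ, ι → ℝ).prod 𝓘(ℝ, F)) 𝓘(ℝ, E) T.toHomeo.symm p
        (((mfderiv 𝓘(ℝ, H) 𝓘(ℝ, ι → ℝ) a n w : ι → ℝ), (mfderiv 𝓘(ℝ, H) 𝓘(ℝ, F) β n w : F)) :
          (ι → ℝ) × F) := by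
  have h1 := mfderiv_comp_apply_of_eq (I := 𝓘(ℝ, H)) (g := T.toHomeo.symm)
    (f := fun n => (a n, β n)) n
    ((T.contMDiffAt_symm hp).mdifferentiableAt (by simp)) (ha.prodMk hβ) (Prod.ext hap hbp) w
  refine h1.trans ?_
  rw [mfderiv_prodMk ha hβ]
  rfl

variable [DecidableEq ι]

omit [IsManifold 𝓘(ℝ, E) ∞ M] [LieGroup 𝓘(ℝ, F) ∞ G] [ContMDiffSMul 𝓘(ℝ, F) 𝓘(ℝ, E) ∞ G M] in
/-- `∂/∂x^i` as the velocity of a translation of the base coordinates. -/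
theorem coordField_eq {m : M} (hm : m ∈ T.toHomeo.source) (i : ι) :
    (coordField T i m : E) = mfderiv 𝓘(ℝ, ι → ℝ) 𝓘(ℝ, E)
      (fun y : ι → ℝ => T.toHomeo.symm ((T.toHomeo m).1 + y, (T.toHomeo m).2)) 0
        (Pi.single i 1 : ι → ℝ) := by
  have ha : HasMFDerivAt 𝓘(ℝ, ι → ℝ) 𝓘(ℝ, ι → ℝ) (fun y : ι → ℝ => (T.toHomeo m).1 + y) 0
      (ContinuousLinearMap.id ℝ (ι → ℝ)) :=
    ((hasFDerivAt_id (𝕜 := ℝ) (0 : ι → ℝ)).const_add _).hasMFDerivAt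
  have hβ : HasMFDerivAt 𝓘(ℝ, ι → ℝ) 𝓘(ℝ, F) (fun _ : ι → ℝ => (T.toHomeo m).2) 0 0 :=
    hasMFDerivAt_const _ _
  rw [T.mfderiv_symm_comp ha.mdifferentiableAt hβ.mdifferentiableAt (T.fst_mem_base hm)
    (by simp) rfl, ha.mfderiv, hβ.mfderiv]
  rfl

end CoordTrivialization

end Trivialization

section Trivialization

variable {E : Type*} [NormedAddCommGroup E] [NormedSpace ℝ E]
  {M : Type*} [TopologicalSpace M] [ChartedSpace E M] [IsManifold 𝓘(ℝ, E) ∞ M]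
  {F : Type*} [NormedAddCommGroup F] [NormedSpace ℝ F]
  {G : Type*} [TopologicalSpace G] [ChartedSpace F G] [Group G] [LieGroup 𝓘(ℝ, F) ∞ G]
  [MulAction G M] [ContMDiffSMul 𝓘(ℝ, F) 𝓘(ℝ, E) ∞ G M]
  {ι : Type*} [Fintype ι] (T : CoordTrivialization E M F G ι)

namespace CoordTrivialization

omit [IsManifold 𝓘(ℝ, E) ∞ M] in
/-- Vectors annihilated by `dx` are values of fundamental fields. -/
theorem exists_eq_fundamentalField {m : M} (hm : m ∈ T.toHomeo.source)
    {v : TangentSpace 𝓘(ℝ, E) m} (hv : T.dx m v = 0) :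
    ∃ ξ : GroupLieAlgebra 𝓘(ℝ, F) G, v = fundamentalField ξ m := by
  set g := (T.toHomeo m).2 with hg
  set η : F := mfderiv 𝓘(ℝ, E) 𝓘(ℝ, F) (fun m => (T.toHomeo m).2) m v with hη
  have hb := T.fst_mem_base hm
  have h1 := T.mfderiv_symm_comp ((T.contMDiffAt_baseCoord hm).mdifferentiableAt (by simp))
    ((T.contMDiffAt_groupCoord hm).mdifferentiableAt (by simp)) (p := T.toHomeo m) hb rfl rfl
    (v : E)
  have h2 : (fun n => T.toHomeo.symm ((T.toHomeo n).1, (T.toHomeo n).2)) =ᶠ[𝓝 m] id := by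
    filter_upwards [T.toHomeo.open_source.mem_nhds hm] with n hn
    exact T.toHomeo.left_inv hn
  rw [h2.mfderiv_eq, mfderiv_id] at h1
  have hr : ContMDiff 𝓘(ℝ, F) 𝓘(ℝ, F) ∞ (fun h : G => h * g⁻¹) :=
    contMDiff_id.mul contMDiff_const
  -- the group component of `v`, translated on the right to the identity
  refine ⟨(mfderiv 𝓘(ℝ, F) 𝓘(ℝ, F) (fun h : G => h * g⁻¹) g η : F), ?_⟩
  have h3 := mfderiv_comp_apply_of_eq (I := 𝓘(ℝ, F)) (I' := 𝓘(ℝ, F)) (I'' := 𝓘(ℝ, E))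
    (g := fun h : G => h • m) (f := fun h : G => h * g⁻¹) g (y := 1)
    ((contMDiff_orbit m).mdifferentiable (by simp) _) (hr.mdifferentiable (by simp) _)
    (mul_inv_cancel g) η
  refine Eq.trans ?_ h3
  have h4 : (fun h : G => h • m) ∘ (fun h : G => h * g⁻¹)
      = fun k => T.toHomeo.symm ((T.toHomeo m).1, k) := by
    funext k
    have h5 := T.smul_symm hb (k * g⁻¹) g
    rw [hg, Prod.mk.eta, T.toHomeo.left_inv hm] at h5
    simp only [Function.comp_apply, hg, h5]
    simp
  have ha : HasMFDerivAt 𝓘(ℝ, F) 𝓘(ℝ, ι → ℝ) (fun _ : G => (T.toHomeo m).1) g 0 :=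
    hasMFDerivAt_const _ _
  have hβ : HasMFDerivAt 𝓘(ℝ, F) 𝓘(ℝ, F) (fun k : G => k) g
      (ContinuousLinearMap.id ℝ (TangentSpace 𝓘(ℝ, F) g)) := hasMFDerivAt_id _
  have h6 := T.mfderiv_symm_comp ha.mdifferentiableAt hβ.mdifferentiableAt (p := T.toHomeo m)
    hb rfl rfl η
  rw [h4]
  refine Eq.trans ?_ h6.symm
  rw [ha.mfderiv, hβ.mfderiv]
  refine h1.trans ?_
  have h7 : (mfderiv 𝓘(ℝ, E) 𝓘(ℝ, ι → ℝ) (fun m => (T.toHomeo m).1) m v : ι → ℝ) = 0 := hv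
  have h8 : ∀ (a : ι → ℝ), a = 0 → ∀ A : (ι → ℝ) × F →L[ℝ] E, A (a, η) = A (0, η) := by
    rintro a rfl A; rfl
  exact h8 _ h7 _

omit [IsManifold 𝓘(ℝ, E) ∞ M] in
/-- In the trivialization, the field `m ↦ (Ad_{g(m)} ξ)_M(m)` is the left-invariant field of `ξ` on
the second factor. -/
theorem mfderiv_mulInvariant {x : ι → ℝ} (hx : x ∈ T.base) (g : G)
    (ξ : GroupLieAlgebra 𝓘(ℝ, F) G) :
    (mfderiv 𝓘(ℝ, F) 𝓘(ℝ, E) (fun h => T.toHomeo.symm (x, h)) g (mulInvariantVectorField ξ g) : E)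
      = fundamentalField (Ad g ξ) (T.toHomeo.symm (x, g)) := by
  have hj : ContMDiffAt 𝓘(ℝ, F) 𝓘(ℝ, E) ∞ (fun h => T.toHomeo.symm (x, h)) g :=
    ContMDiffAt.comp g (f := fun h => (x, h)) (T.contMDiffAt_symm (p := (x, g)) hx)
      (contMDiffAt_const.prodMk contMDiffAt_id)
  refine Eq.trans ?_ (mfderiv_conj_smul g _ ξ)
  have h3 := mfderiv_comp_apply_of_eq (I := 𝓘(ℝ, F)) (I' := 𝓘(ℝ, F)) (I'' := 𝓘(ℝ, E))
    (g := fun h => T.toHomeo.symm (x, h)) (f := fun h : G => g * h) 1 (y := g)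
    (hj.mdifferentiableAt (by simp))
    ((contMDiff_const.mul contMDiff_id : ContMDiff 𝓘(ℝ, F) 𝓘(ℝ, F) ∞ (fun h : G => g * h))
      |>.mdifferentiable (by simp) _) (mul_one g) ξ
  have h4 : (fun h => T.toHomeo.symm (x, h)) ∘ (fun h : G => g * h)
      = fun h => (g * h * g⁻¹) • T.toHomeo.symm (x, g) := by
    funext h
    simp [T.smul_symm hx]
  rw [h4] at h3
  exact h3.symm

theorem contMDiffAt_fundamentalField_Ad {m : M} (hm : m ∈ T.toHomeo.source)
    (ξ : GroupLieAlgebra 𝓘(ℝ, F) G) :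
    ContMDiffAt 𝓘(ℝ, E) 𝓘(ℝ, E).tangent ∞ (fun m =>
      (⟨m, fundamentalField (Ad (T.toHomeo m).2 ξ) m⟩ : TangentBundle 𝓘(ℝ, E) M)) m := by
  refine contMDiffAt_mfderiv_family (F := F) (Ψ := fun (m : M) (h : G) =>
    ((T.toHomeo m).2 * h * (T.toHomeo m).2⁻¹) • m) (p₀ := (1 : G)) ξ ?_
    (.of_forall fun n => by simp) (.of_forall fun n => (mfderiv_conj_smul _ n ξ).symm)
  have h1 : ContMDiffAt (𝓘(ℝ, E).prod 𝓘(ℝ, F)) 𝓘(ℝ, F) ∞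
      (fun p : M × G => (T.toHomeo p.1).2) (m, 1) :=
    ContMDiffAt.comp (m, (1 : G)) (f := Prod.fst) (T.contMDiffAt_groupCoord hm) contMDiffAt_fst
  exact ((h1.mul contMDiffAt_snd).mul h1.inv).smul contMDiffAt_fst

section CoordField

omit [LieGroup 𝓘(ℝ, F) ∞ G] [ContMDiffSMul 𝓘(ℝ, F) 𝓘(ℝ, E) ∞ G M]

omit [IsManifold 𝓘(ℝ, E) ∞ M] in
theorem contMDiffAt_translate {p : (ι → ℝ) × G} (hp : p.1 ∈ T.base) :
    ContMDiffAt 𝓘(ℝ, ι → ℝ) 𝓘(ℝ, E) ∞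
      (fun y : ι → ℝ => T.toHomeo.symm (p.1 + y, p.2)) 0 := by
  have h1 : ContMDiffAt 𝓘(ℝ, ι → ℝ) (𝓘(ℝ, ι → ℝ).prod 𝓘(ℝ, F)) ∞
      (fun y : ι → ℝ => (p.1 + y, p.2)) 0 :=
    (contDiffAt_const.add contDiffAt_id).contMDiffAt.prodMk contMDiffAt_const
  exact (T.contMDiffAt_symm hp).comp_of_eq h1 (by simp)

omit [IsManifold 𝓘(ℝ, E) ∞ M] in
theorem eventually_translate_mem {x : ι → ℝ} (hx : x ∈ T.base) :
    ∀ᶠ y : ι → ℝ in 𝓝 0, x + y ∈ T.base := by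
  have h1 : ContinuousAt (fun y : ι → ℝ => x + y) 0 := by fun_prop
  exact h1.eventually (by simpa using T.isOpen_base.mem_nhds hx)

variable [DecidableEq ι]

omit [IsManifold 𝓘(ℝ, E) ∞ M] in
theorem dx_coordField {m : M} (hm : m ∈ T.toHomeo.source) (i : ι) :
    T.dx m (coordField T i m) = Pi.single i 1 := by
  have hb := T.fst_mem_base hm
  have h1 := mfderiv_comp_apply_of_eq (I := 𝓘(ℝ, ι → ℝ)) (I' := 𝓘(ℝ, E)) (I'' := 𝓘(ℝ, ι → ℝ))
    (g := fun m => (T.toHomeo m).1)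
    (f := fun y : ι → ℝ => T.toHomeo.symm ((T.toHomeo m).1 + y, (T.toHomeo m).2)) 0 (y := m)
    ((T.contMDiffAt_baseCoord hm).mdifferentiableAt (by simp))
    ((T.contMDiffAt_translate hb).mdifferentiableAt (by simp))
    (by simp [T.toHomeo.left_inv hm]) (Pi.single i 1 : ι → ℝ)
  have h2 : (fun m => (T.toHomeo m).1) ∘
      (fun y : ι → ℝ => T.toHomeo.symm ((T.toHomeo m).1 + y, (T.toHomeo m).2))
      =ᶠ[𝓝 0] fun y => (T.toHomeo m).1 + y := by
    filter_upwards [T.eventually_translate_mem hb] with y hy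
    simp only [Function.comp_apply]
    rw [T.toHomeo.right_inv ((T.mem_target_iff _).2 hy)]
  have ha : HasMFDerivAt 𝓘(ℝ, ι → ℝ) 𝓘(ℝ, ι → ℝ) (fun y : ι → ℝ => (T.toHomeo m).1 + y) 0
      (ContinuousLinearMap.id ℝ (ι → ℝ)) :=
    ((hasFDerivAt_id (𝕜 := ℝ) (0 : ι → ℝ)).const_add _).hasMFDerivAt
  rw [h2.mfderiv_eq, ha.mfderiv] at h1
  refine Eq.trans ?_ h1.symm
  exact congrArg (fun v => T.dx m v) (T.coordField_eq hm i)

omit [IsManifold 𝓘(ℝ, E) ∞ M] in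
/-- The coordinate fields are invariant, since `G` acts on the second factor only. -/
theorem mfderiv_smul_coordField
    (hG : ∀ g : G, ContMDiff 𝓘(ℝ, E) 𝓘(ℝ, E) ∞ (fun m : M => g • m))
    {m : M} (hm : m ∈ T.toHomeo.source) (i : ι) (g : G) :
    mfderiv 𝓘(ℝ, E) 𝓘(ℝ, E) (fun m : M => g • m) m (coordField T i m)
      = coordField T i (g • m) := by
  have hb := T.fst_mem_base hm
  have h1 := mfderiv_comp_apply_of_eq (I := 𝓘(ℝ, ι → ℝ)) (I' := 𝓘(ℝ, E)) (I'' := 𝓘(ℝ, E))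
    (g := fun m : M => g • m)
    (f := fun y : ι → ℝ => T.toHomeo.symm ((T.toHomeo m).1 + y, (T.toHomeo m).2)) 0 (y := m)
    ((hG g).mdifferentiable (by simp) _)
    ((T.contMDiffAt_translate hb).mdifferentiableAt (by simp))
    (by simp [T.toHomeo.left_inv hm]) (Pi.single i 1 : ι → ℝ)
  have h2 : (fun m : M => g • m) ∘
      (fun y : ι → ℝ => T.toHomeo.symm ((T.toHomeo m).1 + y, (T.toHomeo m).2))
      =ᶠ[𝓝 0] fun y => T.toHomeo.symm ((T.toHomeo (g • m)).1 + y, (T.toHomeo (g • m)).2) := by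
    filter_upwards [T.eventually_translate_mem hb] with y hy
    simp only [Function.comp_apply]
    rw [T.smul_symm hy, T.equivariant g m hm]
  rw [h2.mfderiv_eq] at h1
  refine Eq.trans ?_ (h1.symm.trans (T.coordField_eq (T.smul_mem g m hm) i).symm)
  exact congrArg (fun v => mfderiv 𝓘(ℝ, E) 𝓘(ℝ, E) (fun m : M => g • m) m v) (T.coordField_eq hm i)

theorem contMDiffAt_coordField [IsManifold 𝓘(ℝ, F) ∞ G] {m : M} (hm : m ∈ T.toHomeo.source)
    (i : ι) :
    ContMDiffAt 𝓘(ℝ, E) 𝓘(ℝ, E).tangent ∞ (fun m =>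
      (⟨m, coordField T i m⟩ : TangentBundle 𝓘(ℝ, E) M)) m := by
  have hb := T.fst_mem_base hm
  have hs := T.toHomeo.open_source.mem_nhds hm
  refine contMDiffAt_mfderiv_family (Ψ := fun (m : M) (y : ι → ℝ) =>
    T.toHomeo.symm ((T.toHomeo m).1 + y, (T.toHomeo m).2)) (p₀ := (0 : ι → ℝ))
    (Pi.single i 1 : ι → ℝ) ?_ ?_ ?_
  · have h1 : ContMDiffAt (𝓘(ℝ, E).prod 𝓘(ℝ, ι → ℝ)) 𝓘(ℝ, ι → ℝ) ∞
        (fun p : M × (ι → ℝ) => (T.toHomeo p.1).1) (m, 0) :=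
      ContMDiffAt.comp (m, (0 : ι → ℝ)) (f := Prod.fst) (T.contMDiffAt_baseCoord hm) contMDiffAt_fst
    have h2 : ContMDiffAt (𝓘(ℝ, E).prod 𝓘(ℝ, ι → ℝ)) 𝓘(ℝ, F) ∞
        (fun p : M × (ι → ℝ) => (T.toHomeo p.1).2) (m, 0) :=
      ContMDiffAt.comp (m, (0 : ι → ℝ)) (f := Prod.fst) (T.contMDiffAt_groupCoord hm)
        contMDiffAt_fst
    have h3 := (h1.add contMDiffAt_snd).prodMk h2
    exact (T.contMDiffAt_symm hb).comp_of_eq h3 (by simp)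
  · filter_upwards [hs] with n hn
    simp [T.toHomeo.left_inv hn]
  · filter_upwards [hs] with n hn
    exact T.coordField_eq hn i

end CoordField

end CoordTrivialization

end Trivialization

/-! ### The invariant frame -/

section Frame

variable {E : Type*} [NormedAddCommGroup E] [NormedSpace ℝ E]
  {M : Type*} [TopologicalSpace M] [ChartedSpace E M] [IsManifold 𝓘(ℝ, E) ∞ M]
  {F : Type*} [NormedAddCommGroup F] [NormedSpace ℝ F]
  {G : Type*} [TopologicalSpace G] [ChartedSpace F G] [Group G] [LieGroup 𝓘(ℝ, F) ∞ G]
  [MulAction G M] [ContMDiffSMul 𝓘(ℝ, F) 𝓘(ℝ, E) ∞ G M]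
  {ι κ : Type*} [Fintype ι] [DecidableEq ι] [Fintype κ]
  (T : CoordTrivialization E M F G ι) (θ : PrincipalConnection E M F G)
  (b : Module.Basis κ ℝ (GroupLieAlgebra 𝓘(ℝ, F) G))

/-- The frame field `Ê_ξ` with `ξ` not necessarily a basis vector, as a linear map of `ξ`. -/
noncomputable def invariantLinear (m : M) :
    GroupLieAlgebra 𝓘(ℝ, F) G →ₗ[ℝ] TangentSpace 𝓘(ℝ, E) m :=
  (fundamentalLinear m).comp (adLinear (T.toHomeo m).2)

section Pointwise

theorem dx_horizontalField {m : M} (hm : m ∈ T.toHomeo.source) (i : ι) :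
    T.dx m (horizontalField T θ i m) = Pi.single i 1 := by
  unfold horizontalField
  rw [map_sub, T.dx_coordField hm, T.dx_fundamentalField hm, sub_zero]

theorem form_horizontalField (i : ι) (m : M) : θ.form m (horizontalField T θ i m) = 0 := by
  unfold horizontalField
  rw [map_sub, θ.form_fundamental, sub_self]

theorem dx_invariantField {m : M} (hm : m ∈ T.toHomeo.source) (a : κ) :
    T.dx m (invariantField T b a m) = 0 := T.dx_fundamentalField hm _

theorem form_invariantField (a : κ) (m : M) :
    θ.form m (invariantField T b a m) = Ad (T.toHomeo m).2 (b a) := θ.form_fundamental _ _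

/-- The `X_i` lift a basis of the base and the `Ê_a` are fundamental fields of the basis `Ad_g E_a`;
the connection form separates the latter, and a vector killed by `dx` is a fundamental vector. -/
theorem isBasisFamily_frame {m : M} (hm : m ∈ T.toHomeo.source) :
    IsBasisFamily (fun α => frame T θ b α m) := by
  constructor
  · rw [Fintype.linearIndependent_iff]
    intro c hc
    simp only [Fintype.sum_sum_type, frame, Sum.elim_inl, Sum.elim_inr] at hc
    have h1 : ∀ i, c (Sum.inl i) = 0 := fun i => by
      have h2 := congrArg (fun v => T.dx m v i) hc
      simpa [dx_horizontalField T θ hm, dx_invariantField T b hm, Finset.sum_apply,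
        Pi.single_apply] using h2
    -- apply the connection form and undo `Ad_g`
    have h3 : ∑ a, c (Sum.inr a) • b a = 0 := by
      have h2 := congrArg (fun v => adLinear (T.toHomeo m).2⁻¹ (θ.form m v)) hc
      simp only [map_add, map_sum, map_smul, form_horizontalField, form_invariantField,
        smul_zero, Finset.sum_const_zero, zero_add, map_zero] at h2
      rw [← h2]
      refine Finset.sum_congr rfl fun a _ => ?_
      congr 1
      exact (Ad_inv_Ad _ _).symm
    have h4 := Fintype.linearIndependent_iff.1 b.linearIndependent _ h3
    rintro (i | a)
    · exact h1 i
    · exact h4 a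
  · intro v _
    set v' := v - ∑ i, T.dx m v i • horizontalField T θ i m with hv'
    have h1 : T.dx m v' = 0 := by
      funext j
      simp [hv', dx_horizontalField T θ hm, Finset.sum_apply, Pi.single_apply]
    obtain ⟨ξ, hξ⟩ := T.exists_eq_fundamentalField hm h1
    have h2 : fundamentalField ξ m
        = ∑ a, b.repr (Ad (T.toHomeo m).2⁻¹ ξ) a • invariantField T b a m := by
      have h3 : invariantLinear T m (Ad (T.toHomeo m).2⁻¹ ξ) = fundamentalField ξ m :=
        congrArg (fun η => fundamentalField η m) (Ad_Ad_inv _ _)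
      conv_lhs => rw [← h3, ← b.sum_repr (Ad (T.toHomeo m).2⁻¹ ξ)]
      simp only [map_sum, map_smul]
      rfl
    have h4 : v = ∑ i, T.dx m v i • frame T θ b (Sum.inl i) m
        + ∑ a, b.repr (Ad (T.toHomeo m).2⁻¹ ξ) a • frame T θ b (Sum.inr a) m := by
      have h5 := h2.symm.trans hξ.symm
      rw [hv', eq_sub_iff_add_eq, add_comm] at h5
      exact h5.symm
    rw [h4]
    refine Submodule.add_mem _ ?_ ?_ <;>
    exact Submodule.sum_mem _ fun j _ => Submodule.smul_mem _ _ (Submodule.subset_span ⟨_, rfl⟩)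

/-- The quasi-velocities `v^i` are the velocities `dx^i`. -/
theorem components_frame_inl {m : M} (hm : m ∈ T.toHomeo.source) (v : TangentSpace 𝓘(ℝ, E) m)
    (i : ι) : components (fun α => frame T θ b α m) v (Sum.inl i) = T.dx m v i := by
  have h1 := (isBasisFamily_frame T θ b hm).sum_components v
  have h2 := congrArg (fun v => T.dx m v i) h1
  simpa [Fintype.sum_sum_type, frame, dx_horizontalField T θ hm, dx_invariantField T b hm,
    Finset.sum_apply, Pi.single_apply] using h2

/-- The frame is invariant. For `X_i` this is equivariance of the connection form; for `Ê_a` it is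
`Ad_{g h} = Ad_g Ad_h`. -/
theorem mfderiv_smul_frame {m : M} (hm : m ∈ T.toHomeo.source) (α : ι ⊕ κ) (g : G) :
    mfderiv 𝓘(ℝ, E) 𝓘(ℝ, E) (fun m : M => g • m) m (frame T θ b α m) = frame T θ b α (g • m) := by
  rcases α with i | a
  · have h1 := T.mfderiv_smul_coordField (contMDiff_action F) hm i g
    change mfderiv 𝓘(ℝ, E) 𝓘(ℝ, E) (fun m : M => g • m) m (horizontalField T θ i m)
      = horizontalField T θ i (g • m)
    unfold horizontalField
    rw [map_sub, h1, mfderiv_smul_fundamentalField, ← h1, θ.form_equivariant]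
  · change mfderiv 𝓘(ℝ, E) 𝓘(ℝ, E) (fun m : M => g • m) m (invariantField T b a m)
      = invariantField T b a (g • m)
    unfold invariantField
    rw [mfderiv_smul_fundamentalField, T.equivariant g m hm, Ad_mul]

end Pointwise

section Smooth

variable [FiniteDimensional ℝ F]

/-- The connection form is expanded in a basis of the model space of `G`, so that the vertical
part is a combination of fundamental fields with smooth coefficients. -/
theorem contMDiffAt_horizontalField {m : M} (hm : m ∈ T.toHomeo.source) (i : ι) :
    ContMDiffAt 𝓘(ℝ, E) 𝓘(ℝ, E).tangent ∞ (fun m =>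
      (⟨m, horizontalField T θ i m⟩ : TangentBundle 𝓘(ℝ, E) M)) m := by
  have hd := T.contMDiffAt_coordField hm i
  have h1 : ContMDiffAt (M' := F) 𝓘(ℝ, E) 𝓘(ℝ, F) ∞ (fun m => θ.form m (coordField T i m)) m :=
    ContMDiffAt.comp m θ.smooth.contMDiffAt hd
  let B : Module.Basis _ ℝ F := Module.finBasis ℝ F
  have h2 : ∀ a, ContMDiffAt 𝓘(ℝ, E) 𝓘(ℝ, ℝ) ∞
      (fun m => B.repr (θ.form m (coordField T i m) : F) a) m := fun a =>
    ContMDiffAt.comp m (g := fun ξ : F => B.repr ξ a)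
      ((LinearMap.toContinuousLinearMap (B.coord a)).contMDiff.contMDiffAt) h1
  have h3 := hd.sub_section (ContMDiffAt.sum_section (s := Finset.univ) fun a _ =>
    (h2 a).smul_section ((contMDiff_fundamentalField (M := M) (E := E) (F := F) (G := G)
      (B a)).contMDiffAt (x := m)))
  refine h3.congr_of_eventuallyEq (.of_forall fun n => ?_)
  have h4 : fundamentalField (θ.form n (coordField T i n)) n
      = ∑ a, B.repr (θ.form n (coordField T i n) : F) a •
        fundamentalField (E := E) (F := F) (G := G) (B a) n := by
    have h5 : (θ.form n (coordField T i n) : F) = _ :=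
      (B.sum_repr (θ.form n (coordField T i n) : F)).symm
    have h6 := congrArg (fun ξ : F => fundamentalLinear (E := E) (F := F) (G := G) n ξ) h5
    refine h6.trans ?_
    exact (map_sum (fundamentalLinear (E := E) (F := F) (G := G) n) _ _).trans
      (Finset.sum_congr rfl fun a _ =>
        map_smul (fundamentalLinear (E := E) (F := F) (G := G) n) _ _)
  refine congrArg (fun v : TangentSpace 𝓘(ℝ, E) n =>
    (⟨n, v⟩ : TangentBundle 𝓘(ℝ, E) M)) (?_ : horizontalField T θ i n = _)
  exact congrArg (fun v : TangentSpace 𝓘(ℝ, E) n => coordField T i n - v) h4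

theorem contMDiffAt_frame {m : M} (hm : m ∈ T.toHomeo.source) (α : ι ⊕ κ) :
    ContMDiffAt 𝓘(ℝ, E) 𝓘(ℝ, E).tangent ∞ (fun m =>
      (⟨m, frame T θ b α m⟩ : TangentBundle 𝓘(ℝ, E) M)) m := by
  rcases α with i | a
  · exact contMDiffAt_horizontalField T θ hm i
  · exact T.contMDiffAt_fundamentalField_Ad hm (b a)

end Smooth

/-- Constant vector fields on a normed space commute. -/
theorem mlieBracket_const {H : Type*} [NormedAddCommGroup H] [NormedSpace ℝ H] (c c' x : H) :
    VectorField.mlieBracket 𝓘(ℝ, H) (M := H) (fun _ => c) (fun _ => c') x = (0 : H) := by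
  have h : ∀ V W : ∀ x : H, TangentSpace 𝓘(ℝ, H) x,
      VectorField.mlieBracket 𝓘(ℝ, H) V W = VectorField.lieBracket ℝ V W := fun V W => by
    rw [← VectorField.mlieBracketWithin_univ, VectorField.mlieBracketWithin_eq_lieBracketWithin]
    exact VectorField.lieBracketWithin_univ
  refine (congrFun (h (fun _ => c) (fun _ => c')) x).trans ?_
  simp [VectorField.lieBracket]
  rfl

/-! ### Brackets of the frame fields -/

section Brackets

variable [FiniteDimensional ℝ F]

/-- The bracket of two frame fields is vertical. -/
theorem dx_mlieBracket_frame {m : M} (hm : m ∈ T.toHomeo.source) (α β : ι ⊕ κ) :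
    T.dx m (VectorField.mlieBracket 𝓘(ℝ, E) (frame T θ b α) (frame T θ b β) m) = 0 := by
  have hs := T.toHomeo.open_source.mem_nhds hm
  -- under `m ↦ x(m)` the frame fields are related to constant fields
  let c : ι ⊕ κ → ι → ℝ := Sum.elim (fun i => Pi.single i 1) 0
  have hc : ∀ α, ∀ᶠ n in 𝓝 m, c α = T.dx n (frame T θ b α n) := fun α => by
    filter_upwards [hs] with n hn
    rcases α with i | a
    · exact (dx_horizontalField T θ hn i).symm
    · exact (dx_invariantField T b hn a).symm
  have hcs : ∀ α, ContMDiffAt 𝓘(ℝ, ι → ℝ) 𝓘(ℝ, ι → ℝ).tangent ∞ (fun x : ι → ℝ =>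
      (⟨x, c α⟩ : TangentBundle 𝓘(ℝ, ι → ℝ) (ι → ℝ))) ((T.toHomeo m).1) := fun α =>
    contMDiffAt_vectorSpace_iff_contDiffAt.2 contDiffAt_const
  have h1 := mfderiv_mlieBracket_of_related (h := fun m => (T.toHomeo m).1)
    (V' := fun _ => c α) (W' := fun _ => c β)
    (by filter_upwards [hs] with n hn using T.contMDiffAt_baseCoord hn)
    (contMDiffAt_frame T θ b hm α) (contMDiffAt_frame T θ b hm β) (hcs α) (hcs β) (hc α) (hc β)
  exact h1.trans (mlieBracket_const _ _ _)

/-- As brackets of frame fields are vertical, only the `Ê_a` occur. -/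
theorem mlieBracket_frame_eq_sum {m : M} (hm : m ∈ T.toHomeo.source) (α β : ι ⊕ κ) :
    VectorField.mlieBracket 𝓘(ℝ, E) (frame T θ b α) (frame T θ b β) m
      = ∑ a, components (fun α => frame T θ b α m)
          (VectorField.mlieBracket 𝓘(ℝ, E) (frame T θ b α) (frame T θ b β) m) (Sum.inr a) •
            invariantField T b a m := by
  have h1 := (isBasisFamily_frame T θ b hm).sum_components
    (VectorField.mlieBracket 𝓘(ℝ, E) (frame T θ b α) (frame T θ b β) m)
  rw [Fintype.sum_sum_type] at h1
  simp only [components_frame_inl T θ b hm, dx_mlieBracket_frame T θ b hm, Pi.zero_apply,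
    zero_smul, Finset.sum_const_zero, zero_add] at h1
  exact h1.symm

/-- The smoothness required in Mathlib of the Lie bracket of a Lie group. -/
instance lieGroup_minSmoothness : LieGroup 𝓘(ℝ, F) (minSmoothness ℝ 3) G := by
  simp only [minSmoothness_of_isRCLikeNormedField]
  infer_instance

/-- The fields `Ê_a` have the brackets of left-invariant fields. -/
theorem mlieBracket_invariantField {m : M} (hm : m ∈ T.toHomeo.source) (a a' : κ) :
    VectorField.mlieBracket 𝓘(ℝ, E) (invariantField T b a) (invariantField T b a') m
      = ∑ c, structConst b a a' c • invariantField T b c m := by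
  have hb := T.fst_mem_base hm
  set x := (T.toHomeo m).1 with hx
  set g := (T.toHomeo m).2 with hg
  have hm' : T.toHomeo.symm (x, g) = m := T.toHomeo.left_inv hm
  have hT : ∀ h, T.toHomeo (T.toHomeo.symm (x, h)) = (x, h) := fun h =>
    T.toHomeo.right_inv ((T.mem_target_iff _).2 hb)
  have hj : ∀ h, ContMDiffAt 𝓘(ℝ, F) 𝓘(ℝ, E) ∞ (fun h => T.toHomeo.symm (x, h)) h := fun h =>
    ContMDiffAt.comp h (f := fun h => (x, h)) (T.contMDiffAt_symm (p := (x, h)) hb)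
      (contMDiffAt_const.prodMk contMDiffAt_id)
  -- on the fibre through `m`, the field `Ê_a` is the left-invariant field of `E_a`
  have hrel : ∀ (a : κ) (h : G), invariantField T b a (T.toHomeo.symm (x, h))
      = mfderiv 𝓘(ℝ, F) 𝓘(ℝ, E) (fun h => T.toHomeo.symm (x, h)) h
        (mulInvariantVectorField (b a) h) := fun a h => by
    unfold invariantField
    rw [hT]
    exact (T.mfderiv_mulInvariant hb h (b a)).symm
  have hsm : ∀ a, ContMDiffAt 𝓘(ℝ, E) 𝓘(ℝ, E).tangent ∞ (fun m =>
      (⟨m, invariantField T b a m⟩ : TangentBundle 𝓘(ℝ, E) M))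
      (T.toHomeo.symm (x, g)) := fun a => by
    rw [hm']
    exact T.contMDiffAt_fundamentalField_Ad hm (b a)
  have h1 := mfderiv_mlieBracket_of_related (h := fun h => T.toHomeo.symm (x, h)) (m := g)
    (V' := invariantField T b a) (W' := invariantField T b a')
    (.of_forall hj) (contMDiff_mulInvariant (b a)).contMDiffAt
    (contMDiff_mulInvariant (b a')).contMDiffAt (hsm a) (hsm a')
    (.of_forall (hrel a)) (.of_forall (hrel a'))
  have : CompleteSpace F := FiniteDimensional.complete ℝ F
  rw [← mulInvariantVector_mlieBracket, ← GroupLieAlgebra.bracket_def] at h1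
  have h2 := (T.mfderiv_mulInvariant hb g ⁅b a, b a'⁆).symm.trans h1
  have h3 : ∀ (m' : M), m' = m →
      (fundamentalField (Ad g ⁅b a, b a'⁆) m' : E) = (VectorField.mlieBracket 𝓘(ℝ, E)
        (invariantField T b a) (invariantField T b a') m' : E) →
      VectorField.mlieBracket 𝓘(ℝ, E) (invariantField T b a) (invariantField T b a') m
        = fundamentalField (Ad g ⁅b a, b a'⁆) m := by
    rintro m' rfl h; exact h.symm
  rw [h3 _ hm' h2]
  have h4 : invariantLinear (E := E) T m ⁅b a, b a'⁆ = fundamentalField (Ad g ⁅b a, b a'⁆) m := rfl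
  rw [← h4]
  conv_lhs => rw [← b.sum_repr ⁅b a, b a'⁆]
  simp only [map_sum, map_smul]
  rfl

end Brackets

end Frame

/-! ### Splitting the coordinate space -/

section Split

variable {ι κ : Type*} [Fintype ι] [Fintype κ]

/-- The point `(x^i, v^i, w^a)` of the coordinate space, from `(x^i)` and the family of all
quasi-velocities. -/
noncomputable def splitVel :
    ((ι → ℝ) × (ι ⊕ κ → ℝ)) →L[ℝ] (ι → ℝ) × (ι → ℝ) × (κ → ℝ) :=
  LinearMap.toContinuousLinearMap
    { toFun := fun p => (p.1, fun i => p.2 (Sum.inl i), fun a => p.2 (Sum.inr a))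
      map_add' := fun _ _ => rfl
      map_smul' := fun _ _ => rfl }

theorem splitVel_apply (p : (ι → ℝ) × (ι ⊕ κ → ℝ)) :
    splitVel p = (p.1, (fun i => p.2 (Sum.inl i)), fun a => p.2 (Sum.inr a)) := rfl

variable [DecidableEq ι] [DecidableEq κ]

theorem splitVel_single_inl (i : ι) :
    splitVel (0, (Pi.single (Sum.inl i) 1 : ι ⊕ κ → ℝ)) = (0, Pi.single i 1, 0) := by
  ext j <;> simp [splitVel_apply, Pi.single_apply]

theorem splitVel_single_inr (a : κ) :
    splitVel (0, (Pi.single (Sum.inr a) 1 : ι ⊕ κ → ℝ)) = (0, 0, Pi.single a 1) := by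
  ext j <;> simp [splitVel_apply, Pi.single_apply]

/-- A linear functional of the coordinates `(x, v, w)` in terms of its partial derivatives. -/
theorem map_splitVel (A : ((ι → ℝ) × (ι → ℝ) × (κ → ℝ)) →L[ℝ] ℝ) (x : ι → ℝ) (a : ι ⊕ κ → ℝ) :
    A (splitVel (x, a)) = ∑ i, x i * A (Pi.single i 1, 0, 0)
      + ∑ i, a (Sum.inl i) * A (0, Pi.single i 1, 0)
      + ∑ c, a (Sum.inr c) * A (0, 0, Pi.single c 1) := by
  have h : splitVel (x, a) = ∑ i, x i • ((Pi.single i 1, 0, 0) : (ι → ℝ) × (ι → ℝ) × (κ → ℝ))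
      + ∑ i, a (Sum.inl i) • ((0, Pi.single i 1, 0) : (ι → ℝ) × (ι → ℝ) × (κ → ℝ))
      + ∑ c, a (Sum.inr c) • ((0, 0, Pi.single c 1) : (ι → ℝ) × (ι → ℝ) × (κ → ℝ)) := by
    ext j <;> simp [splitVel_apply, Prod.fst_sum, Prod.snd_sum, Finset.sum_apply,
      Pi.single_apply]
  rw [h]
  simp only [map_add, map_sum, map_smul, smul_eq_mul]

end Split

/-! ### Components of a skew family -/

section LocalQuasiVelocities

variable {J : Type*} {V : Type*} [AddCommGroup V] [Module ℝ V]

theorem components_neg (b : J → V) (v : V) : components b (-v) = -components b v := by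
  unfold components
  split_ifs
  · rw [map_neg]
    rfl
  · exact neg_zero.symm

theorem IsBasisFamily.components_self [Fintype J] [DecidableEq J] {b : J → V}
    (h : IsBasisFamily b) (j : J) : components b (b j) = Pi.single j 1 :=
  h.components_eq_of_sum (by simp [Pi.single_apply])

theorem sum_smul_components_of_skew [Fintype J] {J' : Type*} (b : J' → V) (c : J → ℝ)
    {B : J → J → V} (hB : ∀ j k, B j k = -B k j) :
    ∑ j, c j • ∑ k, c k • components b (B j k) = 0 := by
  simp only [Finset.smul_sum]
  refine self_eq_neg.1 ?_
  conv_lhs => rw [Finset.sum_comm]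
  rw [← Finset.sum_neg_distrib]
  refine Finset.sum_congr rfl fun j _ => ?_
  rw [← Finset.sum_neg_distrib]
  refine Finset.sum_congr rfl fun k _ => ?_
  rw [hB k j, components_neg, smul_neg, smul_neg, smul_comm]

end LocalQuasiVelocities

/-! ### The lifted frame in natural coordinates -/

section FrameInCharts

variable {E : Type*} [NormedAddCommGroup E] [NormedSpace ℝ E]
  {M : Type*} [TopologicalSpace M] [ChartedSpace E M] [IsManifold 𝓘(ℝ, E) ∞ M]
  {F : Type*} [NormedAddCommGroup F] [NormedSpace ℝ F]
  {G : Type*} [TopologicalSpace G] [ChartedSpace F G] [Group G] [LieGroup 𝓘(ℝ, F) ∞ G]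
  [MulAction G M] [ContMDiffSMul 𝓘(ℝ, F) 𝓘(ℝ, E) ∞ G M]
  {ι κ : Type*} [Fintype ι] [DecidableEq ι] [Fintype κ]
  (T : CoordTrivialization E M F G ι) (θ : PrincipalConnection E M F G)
  (b : Module.Basis κ ℝ (GroupLieAlgebra 𝓘(ℝ, F) G))

/-- The frame at `v.1`, in the preferred chart at `m`. -/
theorem localRep_frame_apply {m : M} {v : TangentBundle 𝓘(ℝ, E) M}
    (hv : v.1 ∈ (chartAt E m).source) (α : ι ⊕ κ) :
    localRep (frame T θ b α) m (extChartAt 𝓘(ℝ, E) m v.1)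
      = mfderiv 𝓘(ℝ, E) 𝓘(ℝ, E) (extChartAt 𝓘(ℝ, E) m) v.1 (frame T θ b α v.1) := by
  unfold localRep
  rw [(extChartAt 𝓘(ℝ, E) m).left_inv (by simpa using hv)]

/-- The quasi-velocities are computed from the frame in any chart, components being natural under
the derivative of the chart. -/
theorem quasiVel_eq_components_localRep {u v : TangentBundle 𝓘(ℝ, E) M}
    (hv : v.1 ∈ (chartAt E u.1).source) :
    quasiVel T θ b v = components (fun α => localRep (frame T θ b α) u.1
      (extChartAt 𝓘(ℝ, E).tangent u v).1) (extChartAt 𝓘(ℝ, E).tangent u v).2 := by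
  obtain ⟨e, he⟩ := mfderiv_extChartAt_isInvertible (m := u.1) (x := v.1) hv
  have h1 := components_comp e.toLinearEquiv (fun α => frame T θ b α v.1) v.2
  unfold quasiVel
  rw [extChartAt_tangent_apply u v hv, ← h1]
  dsimp only
  have he' : ∀ w, e w = mfderiv 𝓘(ℝ, E) 𝓘(ℝ, E) (extChartAt 𝓘(ℝ, E) u.1) v.1 w := fun w =>
    DFunLike.congr_fun he w
  congr 1
  · funext α
    exact (he' _).trans (localRep_frame_apply T θ b hv α).symm
  · exact he' _

theorem isBasisFamily_localRep_frame {m : M} {n : M} (hn : n ∈ (chartAt E m).source)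
    (hn' : n ∈ T.toHomeo.source) :
    IsBasisFamily (fun α => localRep (frame T θ b α) m (extChartAt 𝓘(ℝ, E) m n)) := by
  obtain ⟨e, he⟩ := mfderiv_extChartAt_isInvertible (m := m) (x := n) hn
  have h1 := (isBasisFamily_frame T θ b hn').of_equiv e.toLinearEquiv
  exact (congrArg (IsBasisFamily (V := E)) (funext fun α =>
    (localRep_frame_apply T θ b (v := ⟨n, 0⟩) hn α).trans (DFunLike.congr_fun he _).symm)).mpr h1

variable {u : TangentBundle 𝓘(ℝ, E) M} (hu : u.1 ∈ T.toHomeo.source)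

/-- The frame of complete and vertical lifts, in the natural coordinates centred at `u`. -/
theorem natCoords_comp_liftedFrame (u : TangentBundle 𝓘(ℝ, E) M) :
    (fun j => natCoords (liftedFrame T θ b u j)) = Sum.elim
      (fun α => ((frame T θ b α u.1 : E),
        fderiv ℝ (localRep (frame T θ b α) u.1) (extChartAt 𝓘(ℝ, E) u.1 u.1) u.2))
      (fun α => ((0 : E), (frame T θ b α u.1 : E))) := by
  funext j
  rcases j with α | α
  · exact completeLift_eq _ _
  · exact verticalLift_eq _ _

include hu

theorem isBasisFamily_liftedFrame : IsBasisFamily (liftedFrame T θ b u) := by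
  have h0 : IsBasisFamily (V := E) (fun α => frame T θ b α u.1) := isBasisFamily_frame T θ b hu
  exact (congrArg (IsBasisFamily (V := E × E)) (natCoords_comp_liftedFrame T θ b u)).mpr
    (h0.sumElim fun α =>
      fderiv ℝ (localRep (frame T θ b α) u.1) (extChartAt 𝓘(ℝ, E) u.1 u.1) u.2)

/-- The components of a second-order tangent vector along the complete lifts are the
quasi-velocities. -/
theorem eq_sum_liftedFrame {W : TangentSpace 𝓘(ℝ, E).tangent u}
    (hW : (natCoords W).1 = u.2) :
    W = ∑ α, (quasiVel T θ b u α • completeLift (frame T θ b α) u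
      + components (liftedFrame T θ b u) W (Sum.inr α) • verticalLift (frame T θ b α) u) := by
  have h0 : IsBasisFamily (V := E) (fun α => frame T θ b α u.1) := isBasisFamily_frame T θ b hu
  have h1 := (isBasisFamily_liftedFrame T θ b hu).sum_components W
  have h2 : ∀ α, components (liftedFrame T θ b u) W (Sum.inl α) = quasiVel T θ b u α := fun α =>
    (congrArg (fun a => components (V := E × E) a (natCoords W) (Sum.inl α))
      (natCoords_comp_liftedFrame T θ b u)).trans ((h0.sumElim_components _ _ _ α).trans
        (congrArg (fun v : E => components (V := E) _ v α) hW))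
  rw [Fintype.sum_sum_type] at h1
  simp only [h2] at h1
  rw [Finset.sum_add_distrib]
  exact h1.symm

end FrameInCharts

/-! ### Derivatives of the invariant coordinates -/

section DerivativeOfCoordinates

variable {E : Type*} [NormedAddCommGroup E] [NormedSpace ℝ E]
  {M : Type*} [TopologicalSpace M] [ChartedSpace E M] [IsManifold 𝓘(ℝ, E) ∞ M]
  {F : Type*} [NormedAddCommGroup F] [NormedSpace ℝ F] [FiniteDimensional ℝ F]
  {G : Type*} [TopologicalSpace G] [ChartedSpace F G] [Group G] [LieGroup 𝓘(ℝ, F) ∞ G]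
  [MulAction G M] [ContMDiffSMul 𝓘(ℝ, F) 𝓘(ℝ, E) ∞ G M]
  {ι κ : Type*} [Fintype ι] [DecidableEq ι] [Fintype κ]
  (T : CoordTrivialization E M F G ι) (θ : PrincipalConnection E M F G)
  (b : Module.Basis κ ℝ (GroupLieAlgebra 𝓘(ℝ, F) G))

/-- The quasi-velocities in the natural coordinates induced by the preferred chart at `m`. -/
noncomputable def chartVel (m : M) (z : E × E) : ι ⊕ κ → ℝ :=
  components (fun α => localRep (frame T θ b α) m z.1) z.2

variable {u : TangentBundle 𝓘(ℝ, E) M} (hu : u.1 ∈ T.toHomeo.source)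
include hu

theorem contDiffAt_localRep_frame (α : ι ⊕ κ) :
    ContDiffAt ℝ ∞ (localRep (frame T θ b α) u.1) (extChartAt 𝓘(ℝ, E) u.1 u.1) :=
  contDiffAt_localRep (contMDiffAt_frame T θ b hu α)

theorem isBasisFamily_localRep_frame_self :
    IsBasisFamily (fun α => localRep (frame T θ b α) u.1 (extChartAt 𝓘(ℝ, E) u.1 u.1)) :=
  isBasisFamily_localRep_frame T θ b (mem_chart_source E u.1) hu

theorem contDiffAt_chartVel :
    ContDiffAt ℝ ∞ (chartVel T θ b u.1) (extChartAt 𝓘(ℝ, E).tangent u u) := by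
  rw [extChartAt_tangent_self]
  exact contDiffAt_components
    (fun α => (contDiffAt_localRep_frame T θ b hu α).comp (_, _) contDiffAt_fst) contDiffAt_snd
    (isBasisFamily_localRep_frame_self T θ b hu)

theorem contMDiffAt_quasiVel :
    ContMDiffAt 𝓘(ℝ, E).tangent 𝓘(ℝ, ι ⊕ κ → ℝ) ∞ (quasiVel T θ b) u := by
  have h1 : ContMDiffAt 𝓘(ℝ, E).tangent 𝓘(ℝ, E × E) ∞ (extChartAt 𝓘(ℝ, E).tangent u) u :=
    contMDiffAt_extChartAt
  refine ((contDiffAt_chartVel T θ b hu).contMDiffAt.comp u h1).congr_of_eventuallyEq ?_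
  filter_upwards [extChartAt_source_mem_nhds (I := 𝓘(ℝ, E).tangent) u] with v hv
  exact quasiVel_eq_components_localRep T θ b ((mem_extChartAt_tangent_source u v).1 hv)

theorem contMDiffAt_invCoords :
    ContMDiffAt 𝓘(ℝ, E).tangent 𝓘(ℝ, (ι → ℝ) × (ι → ℝ) × (κ → ℝ)) ∞ (invCoords T θ b) u := by
  have h1 : ContMDiffAt 𝓘(ℝ, E).tangent 𝓘(ℝ, ι → ℝ) ∞
      (fun u : TangentBundle 𝓘(ℝ, E) M => (T.toHomeo u.1).1) u :=
    (T.contMDiffAt_baseCoord hu).comp u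
      (Bundle.contMDiff_proj (TangentSpace 𝓘(ℝ, E))).contMDiffAt
  exact splitVel.contMDiff.contMDiffAt.comp u (h1.prodMk_space (contMDiffAt_quasiVel T θ b hu))

omit [FiniteDimensional ℝ F] in
/-- The chart at `u` maps a neighbourhood of `u` into the part over the trivialization. -/
theorem eventually_mem_chart : ∀ᶠ z in 𝓝 (extChartAt 𝓘(ℝ, E).tangent u u),
    z ∈ (extChartAt 𝓘(ℝ, E).tangent u).target ∧
      ((extChartAt 𝓘(ℝ, E).tangent u).symm z).1 ∈ T.toHomeo.source := by
  have h1 : Tendsto (fun z => ((extChartAt 𝓘(ℝ, E).tangent u).symm z).1)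
      (𝓝 (extChartAt 𝓘(ℝ, E).tangent u u)) (𝓝 u.1) := by
    have h2 := (FiberBundle.continuous_proj E (TangentSpace 𝓘(ℝ, E) (M := M))).continuousAt.comp
      (x := extChartAt 𝓘(ℝ, E).tangent u u) (continuousAt_extChartAt_symm (I := 𝓘(ℝ, E).tangent) u)
    have h3 : ((extChartAt 𝓘(ℝ, E).tangent u).symm (extChartAt 𝓘(ℝ, E).tangent u u)).1 = u.1 := by
      rw [extChartAt_to_inv]
    have h4 : Tendsto (fun z => ((extChartAt 𝓘(ℝ, E).tangent u).symm z).1)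
      (𝓝 (extChartAt 𝓘(ℝ, E).tangent u u))
      (𝓝 ((extChartAt 𝓘(ℝ, E).tangent u).symm (extChartAt 𝓘(ℝ, E).tangent u u)).1) := h2
    rwa [h3] at h4
  filter_upwards [extChartAt_target_mem_nhds (I := 𝓘(ℝ, E).tangent) u,
    h1 (T.toHomeo.open_source.mem_nhds hu)] with z hz hz'
  exact ⟨hz, hz'⟩

omit hu [FiniteDimensional ℝ F] in
/-- The invariant coordinates in natural coordinates: the base coordinates depend on the point of
`M` only. -/
theorem invCoords_chart_symm {z : E × E} (hz : z ∈ (extChartAt 𝓘(ℝ, E).tangent u).target) :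
    invCoords T θ b ((extChartAt 𝓘(ℝ, E).tangent u).symm z)
      = splitVel ((T.toHomeo ((extChartAt 𝓘(ℝ, E) u.1).symm z.1)).1, chartVel T θ b u.1 z) := by
  have h1 := (extChartAt 𝓘(ℝ, E).tangent u).map_target hz
  have h2 := quasiVel_eq_components_localRep T θ b ((mem_extChartAt_tangent_source u _).1 h1)
  rw [(extChartAt 𝓘(ℝ, E).tangent u).right_inv hz] at h2
  change splitVel (_, quasiVel T θ b _) = _
  rw [h2]
  rfl

theorem hasFDerivAt_baseCoord_chart :
    HasFDerivAt (fun x => (T.toHomeo ((extChartAt 𝓘(ℝ, E) u.1).symm x)).1)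
      (T.dx u.1 : E →L[ℝ] ι → ℝ) (extChartAt 𝓘(ℝ, E) u.1 u.1) := by
  have h1 := ((T.contMDiffAt_baseCoord hu).mdifferentiableAt (by simp)).hasMFDerivAt.2
  rw [𝓘(ℝ, E).range_eq_univ] at h1
  exact hasFDerivWithinAt_univ.1 h1

/-- The derivative at `u` of the invariant coordinates, in the natural coordinates centred at
`u`. -/
theorem hasFDerivAt_invCoords :
    HasFDerivAt (fun z => invCoords T θ b ((extChartAt 𝓘(ℝ, E).tangent u).symm z))
      (splitVel.comp (((T.dx u.1 : E →L[ℝ] ι → ℝ).comp (ContinuousLinearMap.fst ℝ E E)).prod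
        (fderiv ℝ (chartVel T θ b u.1) (extChartAt 𝓘(ℝ, E).tangent u u))))
      (extChartAt 𝓘(ℝ, E).tangent u u) := by
  have h1 : HasFDerivAt (fun z : E × E => (T.toHomeo ((extChartAt 𝓘(ℝ, E) u.1).symm z.1)).1)
      ((T.dx u.1 : E →L[ℝ] ι → ℝ).comp (ContinuousLinearMap.fst ℝ E E))
      (extChartAt 𝓘(ℝ, E).tangent u u) := by
    refine HasFDerivAt.comp (f := Prod.fst)
      (g := fun x => (T.toHomeo ((extChartAt 𝓘(ℝ, E) u.1).symm x)).1) _ ?_ hasFDerivAt_fst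
    rw [extChartAt_tangent_self]
    exact hasFDerivAt_baseCoord_chart T hu
  have h2 := ((contDiffAt_chartVel T θ b hu).differentiableAt (by simp)).hasFDerivAt
  refine (splitVel.hasFDerivAt.comp _ (h1.prodMk h2)).congr_of_eventuallyEq ?_
  filter_upwards [extChartAt_target_mem_nhds (I := 𝓘(ℝ, E).tangent) u] with z hz
  exact invCoords_chart_symm T θ b hz

/-- Near `u`, the derivative of the invariant coordinates along the vertical lifts of the frame. -/
theorem fderiv_invCoords_vertical [DecidableEq κ] (α : ι ⊕ κ) :
    ∀ᶠ z in 𝓝 (extChartAt 𝓘(ℝ, E).tangent u u),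
      fderiv ℝ (fun z => invCoords T θ b ((extChartAt 𝓘(ℝ, E).tangent u).symm z)) z
        (0, localRep (frame T θ b α) u.1 z.1) = splitVel (0, Pi.single α 1) := by
  filter_upwards [eventually_mem_chart T hu] with z hz
  have hb : IsBasisFamily (fun α => localRep (frame T θ b α) u.1 z.1) := by
    have h1 := isBasisFamily_localRep_frame T θ b
      ((mem_extChartAt_tangent_source u _).1 ((extChartAt 𝓘(ℝ, E).tangent u).map_target hz.1)) hz.2
    rw [extChartAt_tangent_symm_fst,
      (extChartAt 𝓘(ℝ, E) u.1).right_inv ((mem_extChartAt_tangent_target u z).1 hz.1)] at h1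
    exact h1
  have hd := (contDiffAt_chart_of_contMDiffAt u hz.1
    (contMDiffAt_invCoords T θ b hz.2)).differentiableAt (by simp)
  have h1 := HasFDerivAt.comp (f := fun p : E => (z.1, p)) z.2 hd.hasFDerivAt
    (hasFDerivAt_prodMk_right z.1 z.2)
  have h2 : HasFDerivAt (fun p : E => splitVel
      ((T.toHomeo ((extChartAt 𝓘(ℝ, E) u.1).symm z.1)).1,
        (combination fun α => localRep (frame T θ b α) u.1 z.1).inverse p))
      (splitVel.comp ((0 : E →L[ℝ] ι → ℝ).prod
        (combination fun α => localRep (frame T θ b α) u.1 z.1).inverse)) z.2 :=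
    splitVel.hasFDerivAt.comp z.2 ((hasFDerivAt_const _ _).prodMk
      (ContinuousLinearMap.hasFDerivAt _))
  have h3 : HasFDerivAt (fun p : E => invCoords T θ b
      ((extChartAt 𝓘(ℝ, E).tangent u).symm (z.1, p)))
      (splitVel.comp ((0 : E →L[ℝ] ι → ℝ).prod
        (combination fun α => localRep (frame T θ b α) u.1 z.1).inverse)) z.2 := by
    refine h2.congr_of_eventuallyEq (.of_forall fun p => ?_)
    have hp : (z.1, p) ∈ (extChartAt 𝓘(ℝ, E).tangent u).target :=
      (mem_extChartAt_tangent_target u _).2 ((mem_extChartAt_tangent_target u z).1 hz.1)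
    exact (invCoords_chart_symm T θ b hp).trans (congrArg splitVel
      (Prod.ext rfl (hb.components_eq_inverse p)))
  have h4 := DFunLike.congr_fun (h1.unique h3) (localRep (frame T θ b α) u.1 z.1)
  refine h4.trans (congrArg splitVel (Prod.ext rfl ?_))
  exact (hb.components_eq_inverse _).symm.trans (hb.components_self α)

/-- The derivative of the invariant coordinates along the complete lifts of the frame. -/
theorem fderiv_invCoords_completeLift (α : ι ⊕ κ) :
    fderiv ℝ (fun z => invCoords T θ b ((extChartAt 𝓘(ℝ, E).tangent u).symm z))
        (extChartAt 𝓘(ℝ, E).tangent u u) (natCoords (completeLift (frame T θ b α) u))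
      = splitVel (T.dx u.1 (frame T θ b α u.1), -∑ β, quasiVel T θ b u β •
          components (fun α => frame T θ b α u.1)
            (VectorField.mlieBracket 𝓘(ℝ, E) (frame T θ b α) (frame T θ b β) u.1)) := by
  have h1 := fderiv_components_completeLift (x := extChartAt 𝓘(ℝ, E) u.1 u.1) (p := u.2)
    (contDiffAt_localRep_frame T θ b hu) (isBasisFamily_localRep_frame_self T θ b hu) α
  rw [(hasFDerivAt_invCoords T θ b hu).fderiv]
  have h2 : natCoords (completeLift (frame T θ b α) u) = _ := completeLift_eq _ u
  rw [h2]
  refine congrArg splitVel (Prod.ext rfl ?_)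
  have h3 : ∀ β, localRep (frame T θ b β) u.1 (extChartAt 𝓘(ℝ, E) u.1 u.1) = frame T θ b β u.1 :=
    fun β => localRep_self _ _
  have h4 := extChartAt_tangent_self u
  change fderiv ℝ (chartVel T θ b u.1) (extChartAt 𝓘(ℝ, E).tangent u u) _ = _
  rw [h4]
  refine Eq.trans ?_ (h1.trans ?_)
  · exact congrArg (fun w : E => fderiv ℝ (chartVel T θ b u.1) (extChartAt 𝓘(ℝ, E) u.1 u.1, u.2)
      (w, fderiv ℝ (localRep (frame T θ b α) u.1) (extChartAt 𝓘(ℝ, E) u.1 u.1) u.2)) (h3 α).symm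
  · have h5 : (fun α => localRep (frame T θ b α) u.1 (extChartAt 𝓘(ℝ, E) u.1 u.1))
        = fun α => (frame T θ b α u.1 : E) := funext h3
    rw [h5]
    refine congrArg Neg.neg (Finset.sum_congr rfl fun β _ => ?_)
    exact congrArg (fun v : E => quasiVel T θ b u β • components (V := E) _ v)
      (mlieBracket_eq_lieBracket_localRep _ _ _).symm

/-- The derivative of the invariant coordinates along a second-order tangent vector. -/
theorem fderiv_invCoords_of_secondOrder [DecidableEq κ] {W : TangentSpace 𝓘(ℝ, E).tangent u}
    (hW : (natCoords W).1 = u.2) :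
    fderiv ℝ (fun z => invCoords T θ b ((extChartAt 𝓘(ℝ, E).tangent u).symm z))
        (extChartAt 𝓘(ℝ, E).tangent u u) (natCoords W)
      = splitVel (fun i => quasiVel T θ b u (Sum.inl i),
          fun α => components (liftedFrame T θ b u) W (Sum.inr α)) := by
  set N := fderiv ℝ (fun z => invCoords T θ b ((extChartAt 𝓘(ℝ, E).tangent u).symm z))
        (extChartAt 𝓘(ℝ, E).tangent u u) with hN
  have hV : ∀ α, N (natCoords (verticalLift (frame T θ b α) u)) = splitVel (0, Pi.single α 1) :=
    fun α => by
      have h1 := (fderiv_invCoords_vertical T θ b hu α).self_of_nhds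
      refine Eq.trans (congrArg N ?_) h1
      rw [extChartAt_tangent_self]
      refine (verticalLift_eq (frame T θ b α) u).trans (Prod.ext rfl ?_)
      exact (localRep_self (frame T θ b α) u.1).symm
  have h1 : N (natCoords W) = ∑ α, (quasiVel T θ b u α •
        N (natCoords (completeLift (frame T θ b α) u))
      + components (liftedFrame T θ b u) W (Sum.inr α) • splitVel (0, Pi.single α 1)) := by
    have h2 : natCoords W = ∑ α, (quasiVel T θ b u α • natCoords (completeLift (frame T θ b α) u)
      + components (liftedFrame T θ b u) W (Sum.inr α) •
        natCoords (verticalLift (frame T θ b α) u)) := eq_sum_liftedFrame T θ b hu hW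
    conv_lhs => rw [h2]
    simp only [map_sum, map_add, map_smul, hV]
  rw [h1]
  simp only [hN, fderiv_invCoords_completeLift T θ b hu, ← map_smul, ← map_add, ← map_sum]
  refine congrArg splitVel (Prod.ext ?_ ?_)
  · funext i
    simp [Prod.fst_sum, Fintype.sum_sum_type, frame, dx_horizontalField T θ hu,
      dx_invariantField T b hu, Finset.sum_apply, Pi.single_apply]
  -- the complete lifts contribute `∑ v^α v^β [Z_α, Z_β] = 0`
  · have h2 := sum_smul_components_of_skew (fun α => frame T θ b α u.1) (quasiVel T θ b u)
      (B := fun α β => VectorField.mlieBracket 𝓘(ℝ, E) (frame T θ b α) (frame T θ b β) u.1)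
      fun α β => VectorField.mlieBracket_swap_apply
    simp only [Prod.snd_sum, Prod.snd_add, Prod.smul_snd, Finset.sum_add_distrib, smul_neg,
      Finset.sum_neg_distrib, h2, neg_zero, zero_add]
    funext α
    simp [Finset.sum_apply, Pi.single_apply]

end DerivativeOfCoordinates

/-! ### Vector fields along maps -/

section SectionsAlongMaps

variable {E : Type*} [NormedAddCommGroup E] [NormedSpace ℝ E]
  {M : Type*} [TopologicalSpace M] [ChartedSpace E M] [IsManifold 𝓘(ℝ, E) ∞ M]
  {H : Type*} [NormedAddCommGroup H] [NormedSpace ℝ H] {J : Type*} [Fintype J]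

/-- Combinations of vector fields along a map, with smooth coefficients, are smooth. -/
theorem contMDiffAt_sum_smul_along {f : H → M} {c : H → J → ℝ}
    {Z : J → ∀ m : M, TangentSpace 𝓘(ℝ, E) m} {p : H}
    (hf : ContMDiffAt 𝓘(ℝ, H) 𝓘(ℝ, E) ∞ f p) (hc : ContDiffAt ℝ ∞ c p)
    (hZ : ∀ j, ContMDiffAt 𝓘(ℝ, E) 𝓘(ℝ, E).tangent ∞
      (fun m => (⟨m, Z j m⟩ : TangentBundle 𝓘(ℝ, E) M)) (f p)) :
    ContMDiffAt 𝓘(ℝ, H) 𝓘(ℝ, E).tangent ∞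
      (fun p => (⟨f p, ∑ j, c p j • Z j (f p)⟩ : TangentBundle 𝓘(ℝ, E) M)) p := by
  let u : TangentBundle 𝓘(ℝ, E) M := ⟨f p, 0⟩
  have hx : ContDiffAt ℝ ∞ (fun p' => extChartAt 𝓘(ℝ, E) (f p) (f p')) p :=
    (ContMDiffAt.comp p (contMDiffAt_extChartAt (I := 𝓘(ℝ, E)) (n := ∞) (x := f p)) hf).contDiffAt
  have hv : ContDiffAt ℝ ∞ (fun p' => ∑ j, c p' j •
      localRep (Z j) (f p) (extChartAt 𝓘(ℝ, E) (f p) (f p'))) p :=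
    ContDiffAt.sum fun j _ => (contDiffAt_pi.1 hc j).smul
      (ContDiffAt.comp (g := localRep (Z j) (f p)) p (contDiffAt_localRep (hZ j)) hx)
  have hφ : ContMDiffAt 𝓘(ℝ, E × E) 𝓘(ℝ, E).tangent ∞ (extChartAt 𝓘(ℝ, E).tangent u).symm
      (extChartAt 𝓘(ℝ, E) (f p) (f p), ∑ j, c p j •
        localRep (Z j) (f p) (extChartAt 𝓘(ℝ, E) (f p) (f p))) := by
    refine (contMDiffOn_extChartAt_symm (I := 𝓘(ℝ, E).tangent) (n := ∞) u).contMDiffAt ?_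
    refine (isOpen_extChartAt_target u).mem_nhds ((mem_extChartAt_tangent_target u _).2 ?_)
    exact mem_extChartAt_target (I := 𝓘(ℝ, E)) (f p)
  refine (hφ.comp p (hx.prodMk hv).contMDiffAt).congr_of_eventuallyEq ?_
  filter_upwards [hf.continuousAt.preimage_mem_nhds (chart_source_mem_nhds E (f p))] with p' hp'
  have h1 : (⟨f p', ∑ j, c p' j • Z j (f p')⟩ : TangentBundle 𝓘(ℝ, E) M)
      ∈ (extChartAt 𝓘(ℝ, E).tangent u).source := (mem_extChartAt_tangent_source u _).2 hp'
  rw [← (extChartAt 𝓘(ℝ, E).tangent u).left_inv h1]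
  refine congrArg (extChartAt 𝓘(ℝ, E).tangent u).symm ?_
  rw [extChartAt_tangent_apply u ⟨f p', _⟩ hp']
  refine Prod.ext rfl ?_
  refine (map_sum (mfderiv 𝓘(ℝ, E) 𝓘(ℝ, E) (extChartAt 𝓘(ℝ, E) (f p)) (f p')) _ _).trans
    (Finset.sum_congr rfl fun j _ => ?_)
  refine (map_smul (mfderiv 𝓘(ℝ, E) 𝓘(ℝ, E) (extChartAt 𝓘(ℝ, E) (f p)) (f p')) _ _).trans ?_
  unfold localRep
  rw [(extChartAt 𝓘(ℝ, E) (f p)).left_inv (by simpa using hp')]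
  rfl

end SectionsAlongMaps

/-! ### The invariant chart of the orbit space -/

section InvariantChart

variable {E : Type*} [NormedAddCommGroup E] [NormedSpace ℝ E]
  {M : Type*} [TopologicalSpace M] [ChartedSpace E M] [IsManifold 𝓘(ℝ, E) ∞ M]
  {F : Type*} [NormedAddCommGroup F] [NormedSpace ℝ F] [FiniteDimensional ℝ F]
  {G : Type*} [TopologicalSpace G] [ChartedSpace F G] [Group G] [LieGroup 𝓘(ℝ, F) ∞ G]
  [MulAction G M] [ContMDiffSMul 𝓘(ℝ, F) 𝓘(ℝ, E) ∞ G M]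
  {ι κ : Type*} [Fintype ι] [DecidableEq ι] [Fintype κ]
  (T : CoordTrivialization E M F G ι) (θ : PrincipalConnection E M F G)
  (b : Module.Basis κ ℝ (GroupLieAlgebra 𝓘(ℝ, F) G))

section Invariance

omit [FiniteDimensional ℝ F]

/-- The action maps the frame to the frame, hence preserves components. -/
theorem quasiVel_tangentAct {u : TangentBundle 𝓘(ℝ, E) M} (hu : u.1 ∈ T.toHomeo.source) (g : G) :
    quasiVel T θ b (tangentAct g u) = quasiVel T θ b u := by
  obtain ⟨e, he⟩ := exists_linearEquiv_mfderiv_smul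
    (contMDiff_action (E := E) (M := M) (G := G) F) g u.1
  refine Eq.trans ?_ (components_comp e (fun α => frame T θ b α u.1) u.2)
  unfold quasiVel
  congr 1
  · funext α
    rw [he, mfderiv_smul_frame T θ b hu]
    rfl
  · exact (he u.2).symm

theorem invCoords_tangentAct {u : TangentBundle 𝓘(ℝ, E) M} (hu : u.1 ∈ T.toHomeo.source) (g : G) :
    invCoords T θ b (tangentAct g u) = invCoords T θ b u := by
  change splitVel ((T.toHomeo (g • u.1)).1, quasiVel T θ b (tangentAct g u)) = _
  rw [quasiVel_tangentAct T θ b hu, T.equivariant g _ hu]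
  rfl

/-- A tangent vector is determined by its base point and its quasi-velocities. -/
theorem eq_of_quasiVel_eq {u u' : TangentBundle 𝓘(ℝ, E) M} (hu : u.1 ∈ T.toHomeo.source)
    (h : u.1 = u'.1) (hv : quasiVel T θ b u = quasiVel T θ b u') : u = u' := by
  obtain ⟨m, v⟩ := u
  obtain ⟨m', v'⟩ := u'
  obtain rfl : m = m' := h
  have hb := isBasisFamily_frame T θ b hu
  have h1 : v = v' := by
    rw [← hb.sum_components v, ← hb.sum_components v']
    exact Finset.sum_congr rfl fun j _ =>
      congrArg (fun r : ℝ => r • frame T θ b j m) (congrFun hv j)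
  rw [h1]

end Invariance

/-- The representative with coordinates `(x, v, w)` in the fibres over the section `g = 1` of the
trivialization. -/
noncomputable def coordSection (p : (ι → ℝ) × (ι → ℝ) × (κ → ℝ)) : TangentBundle 𝓘(ℝ, E) M :=
  ⟨T.toHomeo.symm (p.1, 1), ∑ α, (Sum.elim p.2.1 p.2.2 α : ℝ) •
    frame T θ b α (T.toHomeo.symm (p.1, 1))⟩

omit [FiniteDimensional ℝ F] [LieGroup 𝓘(ℝ, F) ∞ G] [ContMDiffSMul 𝓘(ℝ, F) 𝓘(ℝ, E) ∞ G M] in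
theorem coordSection_fst_mem {p : (ι → ℝ) × (ι → ℝ) × (κ → ℝ)} (hp : p.1 ∈ T.base) :
    (coordSection T θ b p).1 ∈ T.toHomeo.source :=
  T.toHomeo.map_target ((T.mem_target_iff (p.1, 1)).2 hp)

theorem contMDiffAt_coordSection {p : (ι → ℝ) × (ι → ℝ) × (κ → ℝ)} (hp : p.1 ∈ T.base) :
    ContMDiffAt 𝓘(ℝ, (ι → ℝ) × (ι → ℝ) × (κ → ℝ)) 𝓘(ℝ, E).tangent ∞ (coordSection T θ b) p := by
  refine contMDiffAt_sum_smul_along (f := fun p : (ι → ℝ) × (ι → ℝ) × (κ → ℝ) =>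
      T.toHomeo.symm (p.1, 1)) (c := fun p => Sum.elim p.2.1 p.2.2) ?_ ?_
    fun α => contMDiffAt_frame T θ b (coordSection_fst_mem T θ b hp) α
  · exact ContMDiffAt.comp p (T.contMDiffAt_symm (p := (p.1, 1)) hp)
      (contDiffAt_fst.contMDiffAt.prodMk contMDiffAt_const)
  · refine contDiffAt_pi.2 fun α => ?_
    rcases α with i | a
    · exact contDiffAt_pi.1 (contDiffAt_fst.comp p contDiffAt_snd) i
    · exact contDiffAt_pi.1 (contDiffAt_snd.comp p contDiffAt_snd) a

section Representatives

omit [FiniteDimensional ℝ F]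

theorem quasiVel_coordSection {p : (ι → ℝ) × (ι → ℝ) × (κ → ℝ)} (hp : p.1 ∈ T.base) :
    quasiVel T θ b (coordSection T θ b p) = Sum.elim p.2.1 p.2.2 :=
  (isBasisFamily_frame T θ b (coordSection_fst_mem T θ b hp)).components_sum _

theorem invCoords_coordSection {p : (ι → ℝ) × (ι → ℝ) × (κ → ℝ)} (hp : p.1 ∈ T.base) :
    invCoords T θ b (coordSection T θ b p) = p := by
  change splitVel ((T.toHomeo (T.toHomeo.symm (p.1, 1))).1, quasiVel T θ b _) = _
  rw [quasiVel_coordSection T θ b hp, T.toHomeo.right_inv ((T.mem_target_iff (p.1, 1)).2 hp)]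
  rfl

/-- Each orbit over the trivialization meets the section `g = 1`: the element `(T.toHomeo u.1).2`
carries the representative there to `u`. -/
theorem proj_coordSection_invCoords {u : TangentBundle 𝓘(ℝ, E) M}
    (hu : u.1 ∈ T.toHomeo.source) :
    proj G (coordSection T θ b (invCoords T θ b u)) = proj G u := by
  have hp : (invCoords T θ b u).1 ∈ T.base := T.fst_mem_base hu
  rw [proj_eq_proj_iff (contMDiff_action F)]
  refine ⟨(T.toHomeo u.1).2, ?_⟩
  have h1 : (tangentAct (T.toHomeo u.1).2 (coordSection T θ b (invCoords T θ b u))).1 = u.1 := by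
    change (T.toHomeo u.1).2 • T.toHomeo.symm ((T.toHomeo u.1).1, 1) = u.1
    rw [T.smul_symm (T.fst_mem_base hu), mul_one]
    exact T.toHomeo.left_inv hu
  refine eq_of_quasiVel_eq T θ b (T.smul_mem _ _ (coordSection_fst_mem T θ b hp)) h1 ?_
  rw [quasiVel_tangentAct T θ b (coordSection_fst_mem T θ b hp), quasiVel_coordSection T θ b hp]
  funext α
  rcases α with i | a <;> rfl

/-- The chosen representative of the orbit of `u` has the coordinates of `u`. -/
theorem invCoords_out {u : TangentBundle 𝓘(ℝ, E) M} (hu : u.1 ∈ T.toHomeo.source) :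
    invCoords T θ b (Quot.out (proj G u)) = invCoords T θ b u := by
  obtain ⟨g, hg⟩ := (proj_eq_proj_iff (contMDiff_action F)).1 (Quot.out_eq (proj G u)).symm
  rw [← hg, invCoords_tangentAct T θ b hu]

theorem mem_source_of_proj_mem {u : TangentBundle 𝓘(ℝ, E) M}
    (hu : proj G u ∈ proj G '' {u : TangentBundle 𝓘(ℝ, E) M | u.1 ∈ T.toHomeo.source}) :
    u.1 ∈ T.toHomeo.source := by
  obtain ⟨u', hu', h⟩ := hu
  obtain ⟨g, rfl⟩ := (proj_eq_proj_iff (contMDiff_action F)).1 h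
  exact T.smul_mem g _ hu'

end Representatives

/-- The chart `(x^i, v^i, w^a)` of `TM/G`. Its value at an orbit is computed from an arbitrary
representative, as the coordinates are invariant. -/
noncomputable def invariantChart :
    OpenPartialHomeomorph (RedTangent E M G) ((ι → ℝ) × (ι → ℝ) × (κ → ℝ)) where
  toFun q := invCoords T θ b (Quot.out q)
  invFun p := proj G (coordSection T θ b p)
  source := proj G '' {u | u.1 ∈ T.toHomeo.source}
  target := T.base ×ˢ univ
  map_source' := by
    rintro _ ⟨u, hu, rfl⟩
    rw [invCoords_out T θ b hu]
    exact ⟨T.fst_mem_base hu, mem_univ _⟩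
  map_target' p hp := ⟨_, coordSection_fst_mem T θ b hp.1, rfl⟩
  left_inv' := by
    rintro _ ⟨u, hu, rfl⟩
    rw [invCoords_out T θ b hu, proj_coordSection_invCoords T θ b hu]
  right_inv' p hp := by
    rw [invCoords_out T θ b (coordSection_fst_mem T θ b hp.1), invCoords_coordSection T θ b hp.1]
  open_source := isOpenMap_proj (contMDiff_action F) _
    (T.toHomeo.open_source.preimage (FiberBundle.continuous_proj E (TangentSpace 𝓘(ℝ, E))))
  open_target := T.isOpen_base.prod isOpen_univ
  continuousOn_toFun := by
    rintro _ ⟨u, hu, rfl⟩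
    refine ContinuousAt.continuousWithinAt ?_
    have hq : IsOpenQuotientMap (proj (E := E) (M := M) G) :=
      ⟨proj_surjective, continuous_proj, isOpenMap_proj (contMDiff_action F)⟩
    rw [← hq.continuousAt_comp_iff]
    refine (contMDiffAt_invCoords T θ b hu).continuousAt.congr ?_
    filter_upwards [(T.toHomeo.open_source.preimage
      (FiberBundle.continuous_proj E (TangentSpace 𝓘(ℝ, E)))).mem_nhds hu] with u' hu'
    exact (invCoords_out T θ b hu').symm
  continuousOn_invFun p hp := (continuous_proj.continuousAt.comp
    (contMDiffAt_coordSection T θ b hp.1).continuousAt).continuousWithinAt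

/-- Functions on `TM/G` are pulled back to the tangent bundle by `proj` and to the coordinate
space by `coordSection`; both passages, and `invCoords` back, are smooth. -/
theorem isInvariantChart_invariantChart : IsInvariantChart T θ b (invariantChart T θ b) where
  source_eq := rfl
  target_eq := rfl
  apply_proj u hu := invCoords_out T θ b hu
  smooth_iff f W hW hWs := by
    constructor
    · rintro hf _ ⟨q, hq, rfl⟩
      refine ContDiffAt.contDiffWithinAt ?_
      have hp : (invariantChart T θ b q).1 ∈ T.base :=
        ((invariantChart T θ b).map_source (hWs hq)).1
      have h1 : proj G (coordSection T θ b (invariantChart T θ b q)) = q :=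
        (invariantChart T θ b).left_inv (hWs hq)
      exact (ContMDiffAt.comp _ (hf.contMDiffAt hW (mem_of_eq_of_mem h1 hq))
        (contMDiffAt_coordSection T θ b hp)).contDiffAt
    · intro hf u hu
      refine ContMDiffAt.contMDiffWithinAt ?_
      have hO : IsOpen (proj (E := E) (M := M) G ⁻¹' W) := hW.preimage continuous_proj
      have hus : ∀ u' ∈ proj (E := E) (M := M) G ⁻¹' W, u'.1 ∈ T.toHomeo.source := fun u' hu' =>
        mem_source_of_proj_mem T (hWs hu')
      have hcu : ∀ u' ∈ proj (E := E) (M := M) G ⁻¹' W,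
          invariantChart T θ b (proj G u') = invCoords T θ b u' := fun u' hu' =>
        invCoords_out T θ b (hus u' hu')
      have h1 : invCoords T θ b u ∈ invariantChart T θ b '' W := ⟨_, hu, hcu u hu⟩
      have h2 := (hf.contDiffAt (((invariantChart T θ b).isOpen_image_of_subset_source hW
        hWs).mem_nhds h1)).contMDiffAt
      refine (h2.comp u (contMDiffAt_invCoords T θ b (hus u hu))).congr_of_eventuallyEq ?_
      filter_upwards [hO.mem_nhds hu] with u' hu'
      refine congrArg f ?_
      rw [← hcu u' hu']
      exact ((invariantChart T θ b).left_inv (hWs hu')).symm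

end InvariantChart

/-! ### The Lagrange-Poincaré equations -/

section LagrangePoincare

variable {E : Type*} [NormedAddCommGroup E] [NormedSpace ℝ E]
  {M : Type*} [TopologicalSpace M] [ChartedSpace E M] [IsManifold 𝓘(ℝ, E) ∞ M]
  {F : Type*} [NormedAddCommGroup F] [NormedSpace ℝ F] [FiniteDimensional ℝ F]
  {G : Type*} [TopologicalSpace G] [ChartedSpace F G] [Group G] [LieGroup 𝓘(ℝ, F) ∞ G]
  [MulAction G M] [ContMDiffSMul 𝓘(ℝ, F) 𝓘(ℝ, E) ∞ G M]
  {ι κ : Type*} [Fintype ι] [DecidableEq ι] [Fintype κ] [DecidableEq κ]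
  {T : CoordTrivialization E M F G ι} {θ : PrincipalConnection E M F G}
  {b : Module.Basis κ ℝ (GroupLieAlgebra 𝓘(ℝ, F) G)}
  {L : TangentBundle 𝓘(ℝ, E) M → ℝ}
  {Γ : ∀ u : TangentBundle 𝓘(ℝ, E) M, TangentSpace 𝓘(ℝ, E).tangent u}

/-- An Euler-Lagrange field is second-order. -/
theorem IsEulerLagrangeField.natCoords_fst (hΓ : IsEulerLagrangeField L Γ)
    (u : TangentBundle 𝓘(ℝ, E) M) : (natCoords (Γ u)).1 = u.2 :=
  (hΓ.in_chart u).1.trans (congrArg Prod.snd (extChartAt_tangent_self u))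

section VertCoeff

variable {u : TangentBundle 𝓘(ℝ, E) M} (hu : u.1 ∈ T.toHomeo.source)
include hu

/-- The derivative of a quasi-velocity along a second-order tangent vector is the corresponding
coefficient of the vertical lifts. -/
theorem dirDeriv_quasiVel {W : TangentSpace 𝓘(ℝ, E).tangent u} (hW : (natCoords W).1 = u.2)
    (α : ι ⊕ κ) :
    dirDeriv (fun u => quasiVel T θ b u α) u W
      = components (liftedFrame T θ b u) W (Sum.inr α) := by
  let A : ((ι → ℝ) × (ι → ℝ) × (κ → ℝ)) →L[ℝ] ℝ := Sum.elim
    (fun i => (ContinuousLinearMap.proj i).comp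
      ((ContinuousLinearMap.fst ℝ _ _).comp (ContinuousLinearMap.snd ℝ _ _)))
    (fun a => (ContinuousLinearMap.proj a).comp
      ((ContinuousLinearMap.snd ℝ _ _).comp (ContinuousLinearMap.snd ℝ _ _))) α
  have hA : ∀ p, A (splitVel p) = p.2 α := fun p => by
    rcases α with i | a <;> rfl
  have hN := (hasFDerivAt_invCoords T θ b hu).differentiableAt.hasFDerivAt
  have h1 : HasFDerivAt (fun z => quasiVel T θ b ((extChartAt 𝓘(ℝ, E).tangent u).symm z) α) _ _ :=
    (A.hasFDerivAt.comp _ hN).congr_of_eventuallyEq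
      (.of_forall fun z => (hA (_, quasiVel T θ b _)).symm)
  have hs : ContMDiffAt 𝓘(ℝ, E).tangent 𝓘(ℝ, ℝ) ∞ (fun u => quasiVel T θ b u α) u :=
    contMDiffAt_pi_space.1 (contMDiffAt_quasiVel T θ b hu) α
  rw [dirDeriv_eq_of_contMDiffAt hs h1, ContinuousLinearMap.comp_apply,
    fderiv_invCoords_of_secondOrder T θ b hu hW, hA]

/-- The coefficients are derivatives `Γ(v^i)`, `Γ(w^a)` of invariant functions along an invariant
field. -/
theorem vertCoeff_tangentAct (hΓ : IsEulerLagrangeField L Γ)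
    (hinv : ∀ (g : G) (u : TangentBundle 𝓘(ℝ, E) M),
      mfderiv 𝓘(ℝ, E).tangent 𝓘(ℝ, E).tangent
        (tangentAct g : TangentBundle 𝓘(ℝ, E) M → TangentBundle 𝓘(ℝ, E) M) u (Γ u)
        = Γ (tangentAct g u)) (g : G) (α : ι ⊕ κ) :
    vertCoeff T θ b Γ α (tangentAct g u) = vertCoeff T θ b Γ α u := by
  have hgu : (tangentAct g u).1 ∈ T.toHomeo.source := T.smul_mem g _ hu
  unfold vertCoeff
  rw [← dirDeriv_quasiVel hgu (hΓ.natCoords_fst _), ← dirDeriv_quasiVel hu (hΓ.natCoords_fst _),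
    ← hinv g u]
  refine dirDeriv_tangentAct (contMDiff_action F)
    ((contMDiffAt_pi_space.1 (contMDiffAt_quasiVel T θ b hgu) α).mdifferentiableAt (by simp)) ?_ _
  filter_upwards [(T.toHomeo.open_source.preimage
      (FiberBundle.continuous_proj E (TangentSpace 𝓘(ℝ, E)))).mem_nhds hu] with u' hu'
  exact congrFun (quasiVel_tangentAct T θ b hu' g) α

end VertCoeff

/-- The partial derivative of a function on `TM/G` with respect to a quasi-velocity, in the chart
`c`. -/
noncomputable def partialVel
    (c : OpenPartialHomeomorph (RedTangent E M G) ((ι → ℝ) × (ι → ℝ) × (κ → ℝ)))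
    (f : RedTangent E M G → ℝ) (α : ι ⊕ κ) (q : RedTangent E M G) : ℝ :=
  fderiv ℝ (fun z => f (c.symm z)) (c q) (splitVel (0, Pi.single α 1))

section PartialVel

variable (c : OpenPartialHomeomorph (RedTangent E M G) ((ι → ℝ) × (ι → ℝ) × (κ → ℝ)))
  (f : RedTangent E M G → ℝ)

theorem partialVel_inl (i : ι) : partialVel c f (Sum.inl i) = partialV c f i := by
  funext q
  rw [partialVel, splitVel_single_inl, partialV]

theorem partialVel_inr (a : κ) : partialVel c f (Sum.inr a) = partialW c f a := by
  funext q
  rw [partialVel, splitVel_single_inr, partialW]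

end PartialVel

namespace IsInvariantChart

variable {c : OpenPartialHomeomorph (RedTangent E M G) ((ι → ℝ) × (ι → ℝ) × (κ → ℝ))}
  (hc : IsInvariantChart T θ b c) {u : TangentBundle 𝓘(ℝ, E) M} (hu : u.1 ∈ T.toHomeo.source)
  {f : RedTangent E M G → ℝ}
include hc hu

theorem proj_mem_source : proj G u ∈ c.source := by
  rw [hc.source_eq]
  exact ⟨u, hu, rfl⟩

/-- A function smooth near the orbit of `u` is smooth in the chart on an open set around it. -/
theorem exists_contDiffOn (hf : SmoothNearRed f (proj G u)) :
    ∃ W : Set (RedTangent E M G), IsOpen W ∧ proj G u ∈ W ∧ W ⊆ c.source ∧ IsOpen (c '' W) ∧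
      ContDiffOn ℝ ∞ (fun z => f (c.symm z)) (c '' W) := by
  obtain ⟨W, hW, huW, hfW⟩ := hf
  have hW' := hW.inter c.open_source
  refine ⟨W ∩ c.source, hW', ⟨huW, hc.proj_mem_source hu⟩, inter_subset_right,
    c.isOpen_image_of_subset_source hW' inter_subset_right, ?_⟩
  exact (hc.smooth_iff f _ hW' inter_subset_right).1 (hfW.mono (preimage_mono inter_subset_left))

theorem contDiffAt (hf : SmoothNearRed f (proj G u)) :
    ContDiffAt ℝ ∞ (fun z => f (c.symm z)) (invCoords T θ b u) := by
  obtain ⟨W, -, huW, -, hcW, hfW⟩ := hc.exists_contDiffOn hu hf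
  exact hfW.contDiffAt (hcW.mem_nhds ⟨_, huW, hc.apply_proj u hu⟩)

/-- Partial derivatives in the chart of a function smooth near an orbit are again smooth functions
there, so that the projected field may be applied to them. -/
theorem smoothNearRed_partialVel (hf : SmoothNearRed f (proj G u)) (α : ι ⊕ κ) :
    SmoothNearRed (partialVel c f α) (proj G u) := by
  obtain ⟨W, hW, huW, hWs, hcW, hfW⟩ := hc.exists_contDiffOn hu hf
  refine ⟨W, hW, huW, (hc.smooth_iff _ W hW hWs).2 ?_⟩
  have h1 : ContDiffOn ℝ ∞ (fun z => fderiv ℝ (fun z => f (c.symm z)) z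
      (splitVel (0, Pi.single α 1))) (c '' W) :=
    (hfW.fderiv_of_isOpen hcW (by simp)).clm_apply contDiffOn_const
  refine h1.congr ?_
  rintro _ ⟨q, hq, rfl⟩
  rw [c.left_inv (hWs hq), partialVel]

/-- Near `u`, the pullback of a function to the tangent bundle is a function of the invariant
coordinates. -/
theorem fderiv_pullback (hf : SmoothNearRed f (proj G u)) :
    ∀ᶠ z in 𝓝 (extChartAt 𝓘(ℝ, E).tangent u u),
      fderiv ℝ (fun z => f (proj G ((extChartAt 𝓘(ℝ, E).tangent u).symm z))) z
        = (fderiv ℝ (fun z => f (c.symm z))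
            (invCoords T θ b ((extChartAt 𝓘(ℝ, E).tangent u).symm z))).comp
          (fderiv ℝ (fun z => invCoords T θ b ((extChartAt 𝓘(ℝ, E).tangent u).symm z)) z) := by
  obtain ⟨W, hW, huW, hfW⟩ := hf
  have h1 : ∀ᶠ z in 𝓝 (extChartAt 𝓘(ℝ, E).tangent u u),
      proj G ((extChartAt 𝓘(ℝ, E).tangent u).symm z) ∈ W := by
    have h2 := (continuous_proj (G := G)).continuousAt.comp
      (continuousAt_extChartAt_symm (I := 𝓘(ℝ, E).tangent) u)
    refine h2 (hW.mem_nhds ?_)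
    rw [Function.comp_apply, extChartAt_to_inv]
    exact huW
  filter_upwards [h1, (eventually_mem_chart T hu).eventually_nhds] with z hzW hz
  obtain ⟨hzt, hzs⟩ := hz.self_of_nhds
  have hN := (contDiffAt_chart_of_contMDiffAt u hzt
    (contMDiffAt_invCoords T θ b hzs)).differentiableAt (by simp)
  have hF := (hc.contDiffAt hzs ⟨W, hW, hzW, hfW⟩).differentiableAt (by simp)
  refine ((hF.hasFDerivAt.comp z hN.hasFDerivAt).congr_of_eventuallyEq ?_).fderiv
  filter_upwards [hz] with z' hz'
  rw [Function.comp_apply, ← hc.apply_proj _ hz'.2, c.left_inv (hc.proj_mem_source hz'.2)]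

/-- Partial derivatives with respect to the quasi-velocities are derivatives along the vertical
lifts of the frame. -/
theorem partialVel_eventuallyEq (hf : SmoothNearRed f (proj G u)) (α : ι ⊕ κ) :
    (fun z => partialVel c f α (proj G ((extChartAt 𝓘(ℝ, E).tangent u).symm z)))
      =ᶠ[𝓝 (extChartAt 𝓘(ℝ, E).tangent u u)] fun z =>
        fderiv ℝ (fun z => f (proj G ((extChartAt 𝓘(ℝ, E).tangent u).symm z))) z
          (0, localRep (frame T θ b α) u.1 z.1) := by
  filter_upwards [hc.fderiv_pullback hu hf, fderiv_invCoords_vertical T θ b hu α,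
    eventually_mem_chart T hu] with z h1 h2 h3
  rw [h1, ContinuousLinearMap.comp_apply, h2, partialVel, hc.apply_proj _ h3.2]

/-- The derivative at `u` of the pullback of a function. -/
theorem fderiv_pullback_apply (hf : SmoothNearRed f (proj G u)) (W : E × E) :
    fderiv ℝ (fun z => f (proj G ((extChartAt 𝓘(ℝ, E).tangent u).symm z)))
        (extChartAt 𝓘(ℝ, E).tangent u u) W
      = fderiv ℝ (fun z => f (c.symm z)) (c (proj G u))
          (fderiv ℝ (fun z => invCoords T θ b ((extChartAt 𝓘(ℝ, E).tangent u).symm z))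
            (extChartAt 𝓘(ℝ, E).tangent u u) W) := by
  rw [(hc.fderiv_pullback hu hf).self_of_nhds, ContinuousLinearMap.comp_apply, extChartAt_to_inv,
    hc.apply_proj u hu]

/-- The projected field in the invariant chart: `v^i ∂/∂x^i + Γ^i ∂/∂v^i + Γ^a ∂/∂w^a`. -/
theorem projection_apply {Y : RedVectorField E M G} (hY : IsProjection Γ Y)
    (hΓ : IsEulerLagrangeField L Γ) (hf : SmoothNearRed f (proj G u)) :
    Y.toFun f (proj G u) = ∑ i, quasiVel T θ b u (Sum.inl i) * partialX c f i (proj G u)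
      + ∑ i, vertCoeff T θ b Γ (Sum.inl i) u * partialV c f i (proj G u)
      + ∑ a, vertCoeff T θ b Γ (Sum.inr a) u * partialW c f a (proj G u) := by
  rw [hY u f hf, dirDeriv_eq_of_contMDiffAt hf.contMDiffAt (hasFDerivAt_chart hf.contMDiffAt),
    hc.fderiv_pullback_apply hu hf, fderiv_invCoords_of_secondOrder T θ b hu (hΓ.natCoords_fst u),
    map_splitVel]
  rfl

/-- The Lagrange-Poincaré equations for all the quasi-velocities at once, with the brackets of the
frame not yet expressed by curvature and structure constants. -/
theorem projection_partialVel {Y : RedVectorField E M G} (hY : IsProjection Γ Y)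
    (hΓ : IsEulerLagrangeField L Γ) (hL : ContMDiff 𝓘(ℝ, E).tangent 𝓘(ℝ, ℝ) ∞ L)
    {l : RedTangent E M G → ℝ} (hl : ∀ u, l (proj G u) = L u) (α : ι ⊕ κ) :
    Y.toFun (partialVel c l α) (proj G u)
      = ∑ i, T.dx u.1 (frame T θ b α u.1) i * partialX c l i (proj G u)
        - ∑ a, (∑ β, quasiVel T θ b u β * components (fun α => frame T θ b α u.1)
            (VectorField.mlieBracket 𝓘(ℝ, E) (frame T θ b α) (frame T θ b β) u.1) (Sum.inr a))
              * partialW c l a (proj G u) := by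
  have hlL : (fun z => l (proj G ((extChartAt 𝓘(ℝ, E).tangent u).symm z)))
      = fun z => L ((extChartAt 𝓘(ℝ, E).tangent u).symm z) := funext fun z => hl _
  have hls : SmoothNearRed l (proj G u) := by
    refine ⟨univ, isOpen_univ, mem_univ _, ContMDiff.contMDiffOn ?_⟩
    exact (funext hl : (fun u => l (proj G u)) = L) ▸ hL
  have hps := hc.smoothNearRed_partialVel hu hls α
  have h1 := hc.partialVel_eventuallyEq hu hls α
  rw [hlL] at h1
  have hz := extChartAt_tangent_self u
  have hL2 : ContDiffAt ℝ 2 (fun z => L ((extChartAt 𝓘(ℝ, E).tangent u).symm z))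
      (extChartAt 𝓘(ℝ, E).tangent u u) :=
    (contDiffAt_chart_of_contMDiffAt u (mem_extChartAt_target u) hL.contMDiffAt).of_le
      (by norm_cast)
  have hZ : DifferentiableAt ℝ (localRep (frame T θ b α) u.1)
      (extChartAt 𝓘(ℝ, E).tangent u u).1 := by
    rw [hz]
    exact (contDiffAt_localRep_frame T θ b hu α).differentiableAt (by simp)
  have hEL := hΓ.in_chart u
  -- the Euler-Lagrange equations in the form `Γ(Z^V L) = Z^C L`, with `Z` the frame field
  have h2 := fderiv_verticalLift_of_eulerLagrange hL2 hEL.1 hZ (hEL.2 _)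
  have h3 : (localRep (frame T θ b α) u.1 (extChartAt 𝓘(ℝ, E).tangent u u).1,
      fderiv ℝ (localRep (frame T θ b α) u.1) (extChartAt 𝓘(ℝ, E).tangent u u).1
        (extChartAt 𝓘(ℝ, E).tangent u u).2) = natCoords (completeLift (frame T θ b α) u) := by
    rw [hz]
    refine Eq.trans ?_ (completeLift_eq (frame T θ b α) u).symm
    exact Prod.ext (localRep_self _ _) rfl
  rw [hY u _ hps, dirDeriv_eq_of_contMDiffAt hps.contMDiffAt (hasFDerivAt_chart hps.contMDiffAt),
    h1.fderiv_eq, h2, h3, ← hlL, hc.fderiv_pullback_apply hu hls,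
    fderiv_invCoords_completeLift T θ b hu, map_splitVel]
  have h4 : ∀ i β, components (fun α => frame T θ b α u.1)
      (VectorField.mlieBracket 𝓘(ℝ, E) (frame T θ b α) (frame T θ b β) u.1) (Sum.inl i) = 0 :=
    fun i β => (components_frame_inl T θ b hu _ i).trans
      (congrFun (dx_mlieBracket_frame T θ b hu α β) i)
  simp only [Pi.neg_apply, Finset.sum_apply, Pi.smul_apply, smul_eq_mul, h4, mul_zero,
    Finset.sum_const_zero, neg_zero, zero_mul, add_zero, neg_mul, Finset.sum_neg_distrib]
  rw [← sub_eq_add_neg]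
  rfl

/-- The equation of the `v^i`: here `dx(X_i)` is the `i`-th unit vector, which produces `∂l/∂x^i`.
-/
theorem lagrangePoincare_inl {Y : RedVectorField E M G} (hY : IsProjection Γ Y)
    (hΓ : IsEulerLagrangeField L Γ) (hL : ContMDiff 𝓘(ℝ, E).tangent 𝓘(ℝ, ℝ) ∞ L)
    {l : RedTangent E M G → ℝ} (hl : ∀ u, l (proj G u) = L u) (i : ι) :
    Y.toFun (partialV c l i) (proj G u) - partialX c l i (proj G u)
      = -∑ a, (∑ k, curv T θ b a i k u.1 * quasiVel T θ b u (Sum.inl k)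
          + ∑ d, upsilon T θ b a i d u.1 * quasiVel T θ b u (Sum.inr d))
            * partialW c l a (proj G u) := by
  have h1 := hc.projection_partialVel hu hY hΓ hL hl (Sum.inl i)
  have h2 : T.dx u.1 (frame T θ b (Sum.inl i) u.1) = Pi.single i 1 := dx_horizontalField T θ hu i
  rw [partialVel_inl, h2] at h1
  rw [h1, sub_right_comm]
  simp only [Pi.single_apply, ite_mul, one_mul, zero_mul, Finset.sum_ite_eq', Finset.mem_univ,
    if_true, sub_self, zero_sub, Fintype.sum_sum_type]
  refine congrArg Neg.neg (Finset.sum_congr rfl fun a _ => ?_)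
  congr 1
  exact congrArg₂ (· + ·) (Finset.sum_congr rfl fun k _ => mul_comm _ _)
    (Finset.sum_congr rfl fun d _ => mul_comm _ _)

/-- The equation of the `w^a`: here `dx(Ê_a) = 0`, and `[Ê_a, X_i] = -Υ_{ia}`. -/
theorem lagrangePoincare_inr {Y : RedVectorField E M G} (hY : IsProjection Γ Y)
    (hΓ : IsEulerLagrangeField L Γ) (hL : ContMDiff 𝓘(ℝ, E).tangent 𝓘(ℝ, ℝ) ∞ L)
    {l : RedTangent E M G → ℝ} (hl : ∀ u, l (proj G u) = L u) (a : κ) :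
    Y.toFun (partialW c l a) (proj G u)
      = ∑ d, (∑ i, upsilon T θ b d i a u.1 * quasiVel T θ b u (Sum.inl i)
          - ∑ e, structConst b a e d * quasiVel T θ b u (Sum.inr e))
            * partialW c l d (proj G u) := by
  have h1 := hc.projection_partialVel hu hY hΓ hL hl (Sum.inr a)
  have h2 : T.dx u.1 (frame T θ b (Sum.inr a) u.1) = 0 := dx_invariantField T b hu a
  rw [partialVel_inr, h2] at h1
  rw [h1]
  simp only [Pi.zero_apply, zero_mul, Finset.sum_const_zero, zero_sub, ← Finset.sum_neg_distrib,
    ← neg_mul, Fintype.sum_sum_type]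
  refine Finset.sum_congr rfl fun d _ => ?_
  congr 1
  have h3 : ∀ i, components (fun α => frame T θ b α u.1) (VectorField.mlieBracket 𝓘(ℝ, E)
      (frame T θ b (Sum.inr a)) (frame T θ b (Sum.inl i)) u.1) (Sum.inr d)
        = -upsilon T θ b d i a u.1 := fun i => by
    rw [VectorField.mlieBracket_swap_apply, components_neg]
    rfl
  have h4 : ∀ e, components (fun α => frame T θ b α u.1) (VectorField.mlieBracket 𝓘(ℝ, E)
      (frame T θ b (Sum.inr a)) (frame T θ b (Sum.inr e)) u.1) (Sum.inr d)
        = structConst b a e d := fun e => by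
    have h5 : ∑ α, (Sum.elim 0 (structConst b a e) : ι ⊕ κ → ℝ) α • frame T θ b α u.1
        = VectorField.mlieBracket 𝓘(ℝ, E) (frame T θ b (Sum.inr a)) (frame T θ b (Sum.inr e))
          u.1 := by
      rw [Fintype.sum_sum_type]
      simp only [Sum.elim_inl, Sum.elim_inr, Pi.zero_apply, zero_smul, Finset.sum_const_zero,
        zero_add]
      exact (mlieBracket_invariantField T b hu a e).symm
    exact congrFun ((isBasisFamily_frame T θ b hu).components_eq_of_sum h5) (Sum.inr d)
  simp only [h3, h4, mul_neg, Finset.sum_neg_distrib, neg_add, neg_neg]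
  rw [← sub_eq_add_neg]
  exact congrArg₂ (· - ·) (Finset.sum_congr rfl fun k _ => mul_comm _ _)
    (Finset.sum_congr rfl fun d _ => mul_comm _ _)

end IsInvariantChart

end LagrangePoincare

end LagPoin

theorem mainTheorem3
    {E : Type*} [NormedAddCommGroup E] [NormedSpace ℝ E] [FiniteDimensional ℝ E]
    {M : Type*} [TopologicalSpace M] [ChartedSpace E M] [IsManifold 𝓘(ℝ, E) ∞ M]
    [T2Space M] [SecondCountableTopology M]
    {F : Type*} [NormedAddCommGroup F] [NormedSpace ℝ F] [FiniteDimensional ℝ F]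
    {G : Type*} [TopologicalSpace G] [ChartedSpace F G] [Group G] [LieGroup 𝓘(ℝ, F) ∞ G]
    [T2Space G] [SecondCountableTopology G] [ConnectedSpace G]
    -- a smooth, free and proper left action of `G` on `M`
    [MulAction G M] [ContMDiffSMul 𝓘(ℝ, F) 𝓘(ℝ, E) ∞ G M] [ProperSMul G M]
    (hfree : ∀ (g : G) (m : M), g • m = m → g = 1)
    -- a smooth, regular, invariant Lagrangian and its Euler-Lagrange field
    (L : TangentBundle 𝓘(ℝ, E) M → ℝ)
    (hLsmooth : ContMDiff 𝓘(ℝ, E).tangent 𝓘(ℝ, ℝ) ∞ L)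
    (hLreg : LagPoin.IsRegular L)
    (hLinv : ∀ (g : G) (u : TangentBundle 𝓘(ℝ, E) M), L (LagPoin.tangentAct g u) = L u)
    (Γ : ∀ u : TangentBundle 𝓘(ℝ, E) M, TangentSpace 𝓘(ℝ, E).tangent u)
    (hΓ : LagPoin.IsEulerLagrangeField L Γ) :
    -- `Γ` is invariant
    (∀ (g : G) (u : TangentBundle 𝓘(ℝ, E) M),
      mfderiv 𝓘(ℝ, E).tangent 𝓘(ℝ, E).tangent
        (LagPoin.tangentAct g : TangentBundle 𝓘(ℝ, E) M → TangentBundle 𝓘(ℝ, E) M) u (Γ u)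
        = Γ (LagPoin.tangentAct g u)) ∧
    -- and projects to a unique vector field `Y` on `TM/G`
    ∃ Y : LagPoin.RedVectorField E M G,
      LagPoin.IsProjection Γ Y ∧
      (∀ Y' : LagPoin.RedVectorField E M G, LagPoin.IsProjection Γ Y' → Y' = Y) ∧
      ∀ {ι κ : Type*} [Fintype ι] [DecidableEq ι] [Fintype κ] [DecidableEq κ]
        (T : LagPoin.CoordTrivialization E M F G ι) (θ : LagPoin.PrincipalConnection E M F G)
        (b : Module.Basis κ ℝ (GroupLieAlgebra 𝓘(ℝ, F) G)),
        -- the invariant frame, its bracket relations, and the components of `Γ`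
        (∀ m ∈ T.toHomeo.source,
          LagPoin.IsBasisFamily (fun α => LagPoin.frame T θ b α m) ∧
          (∀ i j, VectorField.mlieBracket 𝓘(ℝ, E)
              (LagPoin.horizontalField T θ i) (LagPoin.horizontalField T θ j) m
            = ∑ a, LagPoin.curv T θ b a i j m • LagPoin.invariantField T b a m) ∧
          (∀ i a, VectorField.mlieBracket 𝓘(ℝ, E)
              (LagPoin.horizontalField T θ i) (LagPoin.invariantField T b a) m
            = ∑ c, LagPoin.upsilon T θ b c i a m • LagPoin.invariantField T b c m) ∧
          (∀ a a', VectorField.mlieBracket 𝓘(ℝ, E)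
              (LagPoin.invariantField T b a) (LagPoin.invariantField T b a') m
            = ∑ c, LagPoin.structConst b a a' c • LagPoin.invariantField T b c m)) ∧
        (∀ u : TangentBundle 𝓘(ℝ, E) M, u.1 ∈ T.toHomeo.source →
          LagPoin.IsBasisFamily (LagPoin.liftedFrame T θ b u) ∧
          Γ u = ∑ α, (LagPoin.quasiVel T θ b u α • LagPoin.completeLift (LagPoin.frame T θ b α) u
            + LagPoin.vertCoeff T θ b Γ α u • LagPoin.verticalLift (LagPoin.frame T θ b α) u) ∧
          ∀ (g : G) (α : ι ⊕ κ),
            LagPoin.vertCoeff T θ b Γ α (LagPoin.tangentAct g u) = LagPoin.vertCoeff T θ b Γ α u) ∧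
        -- `(x^i, v^i, w^a)` are coordinates on `TM/G`
        ∃ c : OpenPartialHomeomorph (LagPoin.RedTangent E M G) ((ι → ℝ) × (ι → ℝ) × (κ → ℝ)),
          LagPoin.IsInvariantChart T θ b c ∧
          let l := LagPoin.reducedLagrangian L hLinv
          (∀ u : TangentBundle 𝓘(ℝ, E) M, u.1 ∈ T.toHomeo.source →
            let q := LagPoin.proj G u
            let v : ι → ℝ := fun i => LagPoin.quasiVel T θ b u (Sum.inl i)
            let w : κ → ℝ := fun a => LagPoin.quasiVel T θ b u (Sum.inr a)
            -- `Y = v^i ∂/∂x^i + Γ^i ∂/∂v^i + Γ^a ∂/∂w^a`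
            (∀ f : LagPoin.RedTangent E M G → ℝ, LagPoin.SmoothNearRed f q →
              Y.toFun f q = ∑ i, v i * LagPoin.partialX c f i q
                + ∑ i, LagPoin.vertCoeff T θ b Γ (Sum.inl i) u * LagPoin.partialV c f i q
                + ∑ a, LagPoin.vertCoeff T θ b Γ (Sum.inr a) u * LagPoin.partialW c f a q) ∧
            -- the Lagrange-Poincaré equations for the vector field `Y`
            (∀ i, Y.toFun (LagPoin.partialV c l i) q - LagPoin.partialX c l i q
              = -∑ a, (∑ k, LagPoin.curv T θ b a i k u.1 * v k
                  + ∑ d, LagPoin.upsilon T θ b a i d u.1 * w d) * LagPoin.partialW c l a q) ∧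
            (∀ a, Y.toFun (LagPoin.partialW c l a) q
              = ∑ d, (∑ i, LagPoin.upsilon T θ b d i a u.1 * v i
                  - ∑ e, LagPoin.structConst b a e d * w e) * LagPoin.partialW c l d q)) ∧
          -- and along its integral curves
          (∀ (γ : ℝ → LagPoin.RedTangent E M G) (S : Set ℝ), IsOpen S →
            LagPoin.IsIntegralCurve Y γ S →
            ∀ t ∈ S, ∀ u : TangentBundle 𝓘(ℝ, E) M, u.1 ∈ T.toHomeo.source →
              γ t = LagPoin.proj G u →
              let v : ι → ℝ := fun i => LagPoin.quasiVel T θ b u (Sum.inl i)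
              let w : κ → ℝ := fun a => LagPoin.quasiVel T θ b u (Sum.inr a)
              (∀ i, ∃ p : ℝ,
                HasDerivAt (fun s => LagPoin.partialV c l i (γ s)) p t ∧
                p - LagPoin.partialX c l i (γ t)
                  = -∑ a, (∑ k, LagPoin.curv T θ b a i k u.1 * v k
                      + ∑ d, LagPoin.upsilon T θ b a i d u.1 * w d)
                        * LagPoin.partialW c l a (γ t)) ∧
              (∀ a, HasDerivAt (fun s => LagPoin.partialW c l a (γ s))
                (∑ d, (∑ i, LagPoin.upsilon T θ b d i a u.1 * v i
                  - ∑ e, LagPoin.structConst b a e d * w e)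
                    * LagPoin.partialW c l d (γ t)) t)) := by
  have hG : ∀ g : G, ContMDiff 𝓘(ℝ, E) 𝓘(ℝ, E) ∞ (fun m : M => g • m) := LagPoin.contMDiff_action F
  have hinv := hΓ.invariant hG hLsmooth hLreg hLinv
  have hY : LagPoin.IsProjection Γ (LagPoin.projectedField hG hΓ.1 hinv) := fun u f hf =>
    LagPoin.projectedDeriv_proj hG hinv hf
  refine ⟨hinv, _, hY, fun Y' hY' => hY.unique hY', ?_⟩
  intro ι κ _ _ _ _ T θ b
  have hc := LagPoin.isInvariantChart_invariantChart T θ b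
  have hl : ∀ u, LagPoin.reducedLagrangian L hLinv (LagPoin.proj G u) = L u := fun _ => rfl
  have hls : ∀ q, LagPoin.SmoothNearRed (LagPoin.reducedLagrangian L hLinv) q := fun q =>
    ⟨univ, isOpen_univ, mem_univ _, hLsmooth.contMDiffOn⟩
  refine ⟨fun m hm => ⟨LagPoin.isBasisFamily_frame T θ b hm,
      fun i j => LagPoin.mlieBracket_frame_eq_sum T θ b hm (Sum.inl i) (Sum.inl j),
      fun i a => LagPoin.mlieBracket_frame_eq_sum T θ b hm (Sum.inl i) (Sum.inr a),
      LagPoin.mlieBracket_invariantField T b hm⟩,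
    fun u hu => ⟨LagPoin.isBasisFamily_liftedFrame T θ b hu,
      LagPoin.eq_sum_liftedFrame T θ b hu (hΓ.natCoords_fst u),
      LagPoin.vertCoeff_tangentAct hu hΓ hinv⟩,
    LagPoin.invariantChart T θ b, hc,
    fun u hu => ⟨fun f hf => hc.projection_apply hu hY hΓ hf,
      hc.lagrangePoincare_inl hu hY hΓ hLsmooth hl,
      hc.lagrangePoincare_inr hu hY hΓ hLsmooth hl⟩, ?_⟩
  intro γ S _ hγ t ht u hu hγu
  constructor
  · intro i
    refine ⟨_, hγ t ht _ ?_, ?_⟩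
    · rw [hγu, ← LagPoin.partialVel_inl]
      exact hc.smoothNearRed_partialVel hu (hls _) _
    · rw [hγu]
      exact hc.lagrangePoincare_inl hu hY hΓ hLsmooth hl i
  · intro a
    have h := hγ t ht (LagPoin.partialW (LagPoin.invariantChart T θ b)
      (LagPoin.reducedLagrangian L hLinv) a) (by
        rw [hγu, ← LagPoin.partialVel_inr]
        exact hc.smoothNearRed_partialVel hu (hls _) _)
    rw [hγu, hc.lagrangePoincare_inr hu hY hΓ hLsmooth hl a] at h
    simpa only [hγu] using h
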